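/- **Setting.** Fix $r\ge 1$, $k\ge 3$, $\varepsilon>0$ and $\kappa\ge 1$. For every $n\ge r$ let $v_1,\dots,v_r\in\mathbb R^n$ be orthonormal, let $\beta_1,\dots,\beta_r\in\mathbb R\setminus\{0\}$ with $|\beta_j|\le|\beta_1|$, and let $a\in\mathbb R^n$ be a deterministic unit vector (all of these may depend on $n$). Let $$X=\sum_{j=1}^r\beta_j v_j^{\otimes k}+Z\in\otimes^k\mathbb R^n,$$ where $Z$ has i.i.d. $N(0,1/n)$ entries, and let $u$ be uniformly distributed on the unit sphere of $\mathbb R^n$, independent of $Z$. Let $X[w^{\otimes(k-1)}]$ be the vector with $l$-th coordinate $\langle X,e_l\otimes w^{\otimes(k-1)}\rangle$, and put $u_0=u$, $u_{t+1}=X[u_t^{\otimes(k-1)}]/\|X[u_t^{\otimes(k-1)}]\|$, $\hat v=u_T$, $\hat\beta=\langle X,\hat v^{\otimes k}\rangle$. Assume that for all large $n$ one has $|\beta_1|\ge n^{(k-2)/2+\varepsilon}$ and that the deterministic number of iterations $T=T_n\in\mathbb N$ satisfies $$T\ge 1+\frac1\varepsilon\Big(\frac12+\frac{2\log|\beta_1|}{\log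 n}\Big)+\frac{\log\log(\sqrt n|\beta_1|)}{\log(k-1)}\qquad\text{and}\qquad T\ge 1+\frac{\log\big(\kappa\log(\sqrt n|\beta_1|)\big)}{\log(k-1)}$$ (the second bound follows from the first if $\varepsilon$ is small enough in terms of $\kappa$, e.g. if $\kappa\le (k-1)^{1/\varepsilon}$). **Events and weights.** Let $$p_i=\mathbb P\big(i=\operatorname{argmax}_j|\beta_j\langle u,v_j\rangle^{k-2}|\big).$$ Let $E_i$ be the event that $1/\sqrt{\kappa n}\le|\langle u,v_j\rangle|\le\sqrt{\kappa/n}$ for all $j$ and $|\beta_j\langle u,v_j\rangle^{k-2}|\le(1-1/\kappa)|\beta_i\langle u,v_i\rangle^{k-2}|$ for all $j\ne i$. Let $\sigma_i=\operatorname{sgn}\beta_i$ if $k$ is odd, and $\sigma_i=(\operatorname{sgn}\beta_i)^T\operatorname{sgn}\langle u,v_i\rangle$ if $k$ is even. For $s\in\{1,-1\}$ let $E_{i,s}=E_i\cap\{\sigma_i=s\}$. Let $p_{i,s}=p_i/2$ if $k$ is even; if $k$ is odd let $p_{i,s}=p_i$ for $s=\operatorname{sgn}\beta_i$ and $p_{i,s}=0$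 otherwise. Say that $a$ is *not asymptotically aligned with* $v_i$ if $\beta_1^2\,(1-\langle a,v_i\rangle^2)\to\infty$ as $n\to\infty$ (for instance if $|\langle a,v_i\rangle|$ stays bounded away from $1$). **Theorem.** There is a constant $C>0$ depending only on $r$ such that in the above setting the following hold. 1. For all $n\ge r$, all $i$ and all $s\in\{1,-1\}$, $$p_i=\int_0^\infty\sqrt{\tfrac2\pi}\,e^{-x^2/2}\prod_{\ell\ne i}\bigg(\int_0^{(|\beta_i|/|\beta_\ell|)^{1/(k-2)}x}\sqrt{\tfrac2\pi}\,e^{-y^2/2}\,dy\bigg)dx,$$ $$|\mathbb P(E_i)-p_i|\le \frac{C}{\sqrt\kappa},\qquad |\mathbb P(E_{i,s})-p_{i,s}|\le \frac{C}{\sqrt\kappa}.$$ 2. For all $i$ and $s$, on the event $E_{i,s}$, as $n\to\infty$, the statistics are asymptotically standard normal around the limit $(s^k\beta_i,\,s v_i)$: $$\frac{\sqrt n\,\hat\beta}{\sqrt{\langle a,(I_n-\hat v\hat v^\top)a\rangle}}\Big[\langle a,\hat v\rangle-\Big(1-\frac1{2\hat\beta^2}\Big)\langle a,s v_i\rangle\Big]\xrightarrow{d}N(0,1),$$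 provided $a$ is not asymptotically aligned with $v_i$, and $$\sqrt n\Big(s^k\beta_i-\hat\beta-\frac{k/2-1}{\hat\beta}\Big)\xrightarrow{d}N(0,1).$$ (In particular, if $k$ is odd and $\beta_i>0$, this holds on $E_i$ with limit $(\beta_i,v_i)$.) Here "$S_n\xrightarrow{d}N(0,1)$ on events $E_n$" means $\mathbb P(E_n\cap\{S_n\le t\})-\mathbb P(E_n)\,\mathbb P(N(0,1)\le t)\to0$ for every $t\in\mathbb R$; if $\mathbb P(E_n)$ is bounded away from $0$ this is convergence in law conditionally on $E_n$. 3. The estimators are asymptotically Gaussian mixtures with weights $p_i$, split over the sign for even $k$: for all large $n$, $$\sup_{t\in\mathbb R}\Big|\mathbb P(\hat\beta\le t)-\sum_{i=1}^r\sum_{s=\pm1}p_{i,s}\,\mathbb P\Big(N\Big(s^k\beta_i-\frac{k/2-1}{s^k\beta_i},\ \frac1n\Big)\le t\Big)\Big|\le\frac{C}{\sqrt\kappa},$$ and, if $a$ is not asymptotically aligned with any $v_i$, for all large $n$, $$\sup_{t\in\mathbb R}\Big|\mathbb P(\langle a,\hat v\rangle\le t)-\sum_{i=1}^r\sum_{s=\pm1}p_{i,s}\,\mathbb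 P\Big(N\Big(\Big(1-\frac1{2\beta_i^2}\Big)s\langle a,v_i\rangle,\ \frac{1-\langle a,v_i\rangle^2}{n\beta_i^2}\Big)\le t\Big)\Big|\le\frac{C}{\sqrt\kappa}.$$ -/

import Mathlib

open MeasureTheory ProbabilityTheory Filter Topology
open scoped NNReal

namespace SpikedTensor

/-- Real tensors of order `k` on `ℝⁿ`, as arrays of their `n ^ k` coordinates. -/
abbrev Tensor (k n : ℕ) : Type := (Fin k → Fin n) → ℝ

/-- The entrywise inner product of two tensors. -/
def tinner {k n : ℕ} (τ η : Tensor k n) : ℝ := ∑ I, τ I * η I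

/-- The pure tensor `w 0 ⊗ w 1 ⊗ ⋯ ⊗ w (k - 1)`. -/
def pureTensor {k n : ℕ} (w : Fin k → EuclideanSpace ℝ (Fin n)) : Tensor k n :=
  fun I => ∏ s, w s (I s)

/-- The power `v ^ ⊗k`. -/
def tpow (k : ℕ) {n : ℕ} (v : EuclideanSpace ℝ (Fin n)) : Tensor k n :=
  pureTensor fun _ => v

/-- The vector `X[v ^ ⊗(k-1)]`, whose `l`-th coordinate is `⟨X, e_l ⊗ v ⊗ ⋯ ⊗ v⟩`. -/
noncomputable def contract {k n : ℕ} (X : Tensor k n) (v : EuclideanSpace ℝ (Fin n)) :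
    EuclideanSpace ℝ (Fin n) :=
  WithLp.toLp 2 fun l =>
    tinner X (pureTensor fun s => if (s : ℕ) = 0 then EuclideanSpace.single l (1 : ℝ) else v)

/-- Tensor power iteration: `u₀ = u`, `u_{t+1} = X[u_t ^ ⊗(k-1)] / ‖X[u_t ^ ⊗(k-1)]‖`. -/
noncomputable def powerIter {k n : ℕ} (X : Tensor k n) (u : EuclideanSpace ℝ (Fin n)) :
    ℕ → EuclideanSpace ℝ (Fin n)
  | 0 => u
  | t + 1 => ‖contract X (powerIter X u t)‖⁻¹ • contract X (powerIter X u t)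

/-- The estimator `β̂ = ⟨X, v̂ ^ ⊗k⟩` computed from `v̂`. -/
def betaHat {k n : ℕ} (X : Tensor k n) (vhat : EuclideanSpace ℝ (Fin n)) : ℝ :=
  tinner X (tpow k vhat)

/-- The signal `∑ j, β j • (v j) ^ ⊗k`. -/
def signal (k : ℕ) {n r : ℕ} (β : Fin r → ℝ) (v : Fin r → EuclideanSpace ℝ (Fin n)) :
    Tensor k n :=
  ∑ j, β j • tpow k (v j)

/-- The law of a noise tensor with i.i.d. `N(0, 1/n)` entries. -/
noncomputable def noiseLaw (k n : ℕ) : Measure (Tensor k n) :=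
  Measure.pi fun _ => gaussianReal 0 ((n : ℝ≥0)⁻¹)

/-- The uniform probability measure on the unit sphere of `ℝⁿ` (for `n ≥ 1`), as a measure
on `ℝⁿ`: normalized surface measure. -/
noncomputable def sphereUniform (n : ℕ) : Measure (EuclideanSpace ℝ (Fin n)) :=
  (((volume : Measure (EuclideanSpace ℝ (Fin n))).toSphere Set.univ)⁻¹ •
    (volume : Measure (EuclideanSpace ℝ (Fin n))).toSphere).map Subtype.val

/-- `i` maximizes `|β_j ⟨u, v_j⟩ ^ (k-2)|` over `j`. -/
def IsArgmax (k : ℕ) {n r : ℕ} (β : Fin r → ℝ) (v : Fin r → EuclideanSpace ℝ (Fin n))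
    (i : Fin r) (u : EuclideanSpace ℝ (Fin n)) : Prop :=
  ∀ j, |β j * inner ℝ u (v j) ^ (k - 2)| ≤ |β i * inner ℝ u (v i) ^ (k - 2)|

/-- The mixture weight `p_i`, by its explicit Gaussian integral formula. -/
noncomputable def weight (k : ℕ) {r : ℕ} (β : Fin r → ℝ) (i : Fin r) : ℝ :=
  ∫ x in Set.Ioi (0 : ℝ), √(2 / Real.pi) * Real.exp (-x ^ 2 / 2) *
    ∏ l ∈ Finset.univ.erase i,
      ∫ y in (0 : ℝ)..((|β i| / |β l|) ^ (1 / ((k : ℝ) - 2)) * x),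
        √(2 / Real.pi) * Real.exp (-y ^ 2 / 2)

/-- The initializations, for a given `κ`, from which spike `i` is selected: all overlaps with
the spikes have order `1 / √n` up to `√κ` (so that ratios of overlaps lie in `[1/κ, κ]`), and `i`
is the maximizer of `|β_j ⟨u, v_j⟩ ^ (k-2)|`, separated from the others by the factor
`1 - 1/κ`. -/
def GoodInit (k : ℕ) {n r : ℕ} (κ : ℝ) (β : Fin r → ℝ)
    (v : Fin r → EuclideanSpace ℝ (Fin n)) (i : Fin r) (u : EuclideanSpace ℝ (Fin n)) : Prop :=
  (∀ j, 1 / √(κ * n) ≤ |inner ℝ u (v j)| ∧ |inner ℝ u (v j)| ≤ √(κ / n)) ∧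
  ∀ j, j ≠ i →
    |β j * inner ℝ u (v j) ^ (k - 2)| ≤ (1 - 1 / κ) * |β i * inner ℝ u (v i) ^ (k - 2)|

/-- The sign `s` of the limit `(s ^ k β_i, s v_i)` of `(β̂, v̂)` at time `T`, where `b = β_i` and
`x = ⟨u, v_i⟩`. For odd `k` it is the sign of `β_i`, so that the limit is `(β_i, v_i)` when
`β_i > 0` and `(-β_i, -v_i)` when `β_i < 0`. For even `k` and `β_i > 0` it is the sign of
`⟨u, v_i⟩`, with limit `(β_i, ± v_i)`; for even `k` and `β_i < 0` it alternates with `T`. -/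
noncomputable def limitSign (k : ℕ) (b : ℝ) (T : ℕ) (x : ℝ) : ℝ :=
  if Odd k then Real.sign b else Real.sign b ^ T * Real.sign x

/-- The weight of the limit `(s ^ k β_i, s v_i)`: for odd `k` the full weight `p_i` is carried by
the one possible sign, for even `k` each of the two signs has weight `p_i / 2`. -/
noncomputable def signedWeight (k : ℕ) {r : ℕ} (β : Fin r → ℝ) (i : Fin r) (s : ℤˣ) : ℝ :=
  if Odd k then (if Real.sign (β i) = ((s : ℤ) : ℝ) then weight k β i else 0)
  else weight k β i / 2

/-- The normalized linear statistic
`√n β̂ / √⟨a, (I - v̂ v̂ᵀ) a⟩ * (⟨a, v̂⟩ - (1 - 1 / (2 β̂²)) ⟨a, w⟩)`. -/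
noncomputable def linearStat {n : ℕ} (a vhat w : EuclideanSpace ℝ (Fin n)) (bhat : ℝ) : ℝ :=
  √n * bhat / √(inner ℝ a (a - inner ℝ vhat a • vhat)) *
    (inner ℝ a vhat - (1 - 1 / (2 * bhat ^ 2)) * inner ℝ a w)

/-- The normalized strength statistic `√n (b - β̂ - (k/2 - 1) / β̂)`. -/
noncomputable def strengthStat (k n : ℕ) (b bhat : ℝ) : ℝ :=
  √n * (b - bhat - ((k : ℝ) / 2 - 1) / bhat)

/-- On the events `E n`, the variables `S n` converge in law to `N(0,1)`:
`P(S n ≤ t, E n) - P(E n) Φ(t) → 0` for all `t`. When `P(E n)` is bounded away from `0` this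
says that the conditional law of `S n` given `E n` converges weakly to `N(0,1)`; the product
form also makes sense when `P(E n)` is `0` or tends to `0`. -/
def AsympNormalOn {Ω : ℕ → Type*} [∀ n, MeasurableSpace (Ω n)] (P : ∀ n, Measure (Ω n))
    (E : ∀ n, Set (Ω n)) (S : ∀ n, Ω n → ℝ) : Prop :=
  ∀ t : ℝ, Tendsto
    (fun n => (P n).real (E n ∩ {ω | S n ω ≤ t}) -
      (P n).real (E n) * (gaussianReal 0 1).real (Set.Iic t)) atTop (𝓝 0)

end SpikedTensor

/-! Write `k = d + 2`. The iteration is followed through the overlaps `o t j = ⟨u_t, v_j⟩`, which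
satisfy `o (t + 1) j * R t = β j * o t j ^ (d + 1) + z t j`, with `R t` the norm before
normalization and `z t j` the overlap of `v_j` with the contracted noise. Without noise, the ratios
`y j = o j / o i` follow `y j ↦ γ j * y j ^ (d + 1)`, where `γ j = β j / β i`. Hence `ρ j = |γ j| |y
j| ^ d` is raised to the power `d + 1` at each step, and the maximizer `i` of `|β j * o 0 j ^ d|`
wins doubly exponentially fast. Outside an event of vanishing probability, the selected spike and
its sign are functions of `u` alone, hence independent of the noise; this is why mixtures appear.

The noise is controlled in two ways. Its injective norm is `O(1)`, by a net argument
(`noiseLaw_real_not_opBound_le`). This is too crude at the start, where the signal may be as small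
as `n ^ (-1/2 + ε)`. There one needs `|z t j| ≤ n ^ (-1/2 + ε/2)` for a fixed number `t₁` of steps,
although the iterates depend on the noise. Contraction with an iterate is an adaptive linear query
of a Gaussian vector, and resampling the queried directions one after another bounds the answers by
independent Gaussians (`gaussVec_adaptive_tail`). During this first phase the signal gains a factor
`n ^ ε` per step, and compactness reduces the ratios to the noiseless recursion
(`PhaseOne.eventually_dominates`). In the second phase the invariant `Dominates` persists for
arbitrarily many steps under the injective norm bound alone (`PhaseTwo.succ`), while the time
condition makes the competing spikes negligible.

At the end, up to sign, the iterate is the normalization of `v_i + (g + δ) / β_i`, with `g` the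
noise contracted along the fixed vector `v_i` and `√n ‖δ‖ → 0` (`Selects.limit`). The rest is an
expansion. The part of `a` orthogonal to `v_i` tests `g` and gives a Gaussian. The loss of overlap
is about `‖g‖ ^ 2 / (2 β_i ^ 2)`, and `‖g‖` is close to one, which gives the bias `1 / (2 β_i ^ 2)`.
The estimated strength fluctuates with `⟨Z, v_i ^ ⊗k⟩`, up to `O(1 / β_i) = o(1 / √n)`.

The weights come from the polar decomposition of a Gaussian vector (`map_polar_stdGaussian`): scale
invariant events in the overlaps have their Gaussian probability. Anti-concentration shows that the
good initializations lose only `O(1 / √κ)`, and `Model.mixture` assembles the components. -/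

namespace SpikedTensor

/-! ### Gaussian vectors: linear functionals, resampling of a subspace, tails. -/

section GaussianVectors
open Matrix

/-- The law of a vector with i.i.d. centred Gaussian entries of variance `c`. -/
noncomputable abbrev gaussVec (I : Type*) [Fintype I] (c : ℝ≥0) : Measure (I → ℝ) :=
  Measure.pi fun _ => gaussianReal 0 c

variable {I J : Type*} [Fintype I] [Fintype J]

lemma dotProduct_self_nonneg' (η : I → ℝ) : 0 ≤ η ⬝ᵥ η :=
  Finset.sum_nonneg fun i _ => mul_self_nonneg (η i)

lemma measurable_dotProduct (η : I → ℝ) : Measurable fun z : I → ℝ => η ⬝ᵥ z :=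
  Continuous.measurable (by fun_prop)

lemma map_dotProduct_gaussVec (c : ℝ≥0) (η : I → ℝ) :
    (gaussVec I c).map (fun z => η ⬝ᵥ z) = gaussianReal 0 ((η ⬝ᵥ η).toNNReal * c) := by
  apply Measure.ext_of_charFun
  ext t
  have h0 : (0 : ℝ) ≤ η ⬝ᵥ η := dotProduct_self_nonneg' η
  rw [charFun_apply_real, integral_map (by fun_prop) (by fun_prop), charFun_gaussianReal]
  simp_rw [dotProduct, Complex.ofReal_sum, Finset.mul_sum, Finset.sum_mul, Complex.exp_sum]
  rw [integral_fintype_prod_eq_prod (f := fun i (x : ℝ) => Complex.exp (t * ↑(η i * x) * Complex.I))]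
  have : ∀ i, ∫ x : ℝ, Complex.exp (t * ↑(η i * x) * Complex.I) ∂(gaussianReal 0 c)
      = Complex.exp (-(c * (t * η i) ^ 2 / 2)) := by
    intro i
    have := charFun_gaussianReal (μ := 0) (v := c) (t * η i)
    rw [charFun_apply_real] at this
    convert this using 2
    · ext x; push_cast; ring_nf
    · push_cast; ring_nf
  simp_rw [this, ← Complex.exp_sum]
  congr 1
  have h1 : ((((∑ i, η i * η i).toNNReal : ℝ≥0) : ℝ) : ℂ) = ((∑ i, η i * η i : ℝ) : ℂ) := by
    congr 1
    exact Real.coe_toNNReal _ (dotProduct_self_nonneg' η)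
  push_cast at h1 ⊢
  rw [h1, Finset.sum_neg_distrib]
  simp only [Finset.sum_mul, Finset.sum_div, mul_zero, zero_mul, zero_sub]
  congr 1
  refine Finset.sum_congr rfl fun i _ => by ring

/-- Cramér–Wold: the characteristic function at a functional is that of the corresponding
one-dimensional projection at `1`. -/
lemma eq_gaussVec_of_map_dotProduct {c : ℝ≥0} {μ : Measure (I → ℝ)} [IsFiniteMeasure μ]
    (h : ∀ η : I → ℝ, μ.map (fun z => η ⬝ᵥ z) = gaussianReal 0 ((η ⬝ᵥ η).toNNReal * c)) :
    μ = gaussVec I c := by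
  classical
  apply Measure.ext_of_charFunDual
  ext L
  have hL : (L : (I → ℝ) → ℝ) = fun z => (fun i => L (Pi.single i 1)) ⬝ᵥ z := by
    ext z
    conv_lhs => rw [pi_eq_sum_univ' z]
    simp [dotProduct, map_sum, mul_comm]
  rw [charFunDual_eq_charFun_map_one, charFunDual_eq_charFun_map_one, hL, h,
    map_dotProduct_gaussVec]

/-- The hypothesis makes `A * Aᵀ` the projection onto the range of `A`; the component of the second
vector in that range is discarded and replaced by `A` applied to the fresh first vector. Tested
against `η`, the result is a sum of independent Gaussians with coefficients `a = Aᵀ η` and `b = η -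
A a`, and the variances add up by Pythagoras. -/
lemma map_add_mulVec_gaussVec (c : ℝ≥0) (A : Matrix I J ℝ) (hA : A * Aᵀ * A = A) :
    ((gaussVec J c).prod (gaussVec I c)).map (fun p => p.2 + A *ᵥ (p.1 - Aᵀ *ᵥ p.2))
      = gaussVec I c := by
  have hm : Measurable fun p : (J → ℝ) × (I → ℝ) => p.2 + A *ᵥ (p.1 - Aᵀ *ᵥ p.2) := by
    apply Continuous.measurable
    fun_prop
  have : IsProbabilityMeasure
      (((gaussVec J c).prod (gaussVec I c)).map (fun p => p.2 + A *ᵥ (p.1 - Aᵀ *ᵥ p.2))) :=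
    Measure.isProbabilityMeasure_map hm.aemeasurable
  refine eq_gaussVec_of_map_dotProduct fun η => ?_
  rw [Measure.map_map (measurable_dotProduct η) hm]
  set a := Aᵀ *ᵥ η
  set b := η - A *ᵥ a
  have hf : (fun z => η ⬝ᵥ z) ∘ (fun p : (J → ℝ) × (I → ℝ) => p.2 + A *ᵥ (p.1 - Aᵀ *ᵥ p.2))
      = fun p => a ⬝ᵥ p.1 + b ⬝ᵥ p.2 := by
    ext p
    simp only [Function.comp, a, b, dotProduct_add, mulVec_sub, dotProduct_sub, sub_dotProduct,
      dotProduct_mulVec, mulVec_transpose]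
    have : A *ᵥ (η ᵥ* A) ⬝ᵥ p.2 = η ᵥ* A ⬝ᵥ p.2 ᵥ* A := by
      rw [dotProduct_comm, dotProduct_mulVec, dotProduct_comm]
    rw [this]
    ring
  rw [hf]
  have hab : a ⬝ᵥ a + b ⬝ᵥ b = η ⬝ᵥ η := by
    have h1 : A *ᵥ (Aᵀ *ᵥ (A *ᵥ a)) = A *ᵥ a := by
      rw [mulVec_mulVec, mulVec_mulVec, hA]
    have h2 : ∀ (x : J → ℝ) (y : I → ℝ), A *ᵥ x ⬝ᵥ y = x ⬝ᵥ Aᵀ *ᵥ y := by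
      intro x y
      rw [dotProduct_mulVec, vecMul_transpose]
    have h3 : A *ᵥ a ⬝ᵥ A *ᵥ a = a ⬝ᵥ a := by
      have : A *ᵥ a ⬝ᵥ A *ᵥ a = (A *ᵥ (Aᵀ *ᵥ (A *ᵥ a))) ⬝ᵥ η := by
        rw [h2, h2, dotProduct_comm]
      rw [this, h1, h2]
    simp only [b, sub_dotProduct, dotProduct_sub, h3]
    have h4 : A *ᵥ a ⬝ᵥ η = a ⬝ᵥ a := h2 a η
    rw [dotProduct_comm η (A *ᵥ a), h4]
    ring
  have h1 : HasLaw (fun p : (J → ℝ) × (I → ℝ) => a ⬝ᵥ p.1)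
      (gaussianReal 0 ((a ⬝ᵥ a).toNNReal * c)) ((gaussVec J c).prod (gaussVec I c)) := by
    refine ⟨by fun_prop, ?_⟩
    rw [← map_dotProduct_gaussVec]
    have := Measure.map_map (μ := (gaussVec J c).prod (gaussVec I c)) (measurable_dotProduct a) measurable_fst
    rw [Measure.map_fst_prod] at this
    simpa [Function.comp_def] using this.symm
  have h2 : HasLaw (fun p : (J → ℝ) × (I → ℝ) => b ⬝ᵥ p.2)
      (gaussianReal 0 ((b ⬝ᵥ b).toNNReal * c)) ((gaussVec J c).prod (gaussVec I c)) := by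
    refine ⟨by fun_prop, ?_⟩
    rw [← map_dotProduct_gaussVec]
    have := Measure.map_map (μ := (gaussVec J c).prod (gaussVec I c)) (measurable_dotProduct b) measurable_snd
    rw [Measure.map_snd_prod] at this
    simpa [Function.comp_def] using this.symm
  have hind : IndepFun (fun p : (J → ℝ) × (I → ℝ) => a ⬝ᵥ p.1) (fun p => b ⬝ᵥ p.2)
      ((gaussVec J c).prod (gaussVec I c)) := indepFun_prod (measurable_dotProduct a) (measurable_dotProduct b)
  have := gaussianReal_add_gaussianReal_of_indepFun hind h1.map_eq h2.map_eq
  have e : (fun p : (J → ℝ) × (I → ℝ) => a ⬝ᵥ p.1 + b ⬝ᵥ p.2)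
    = (fun p => a ⬝ᵥ p.1) + (fun p => b ⬝ᵥ p.2) := rfl
  rw [e, this, ← hab, Real.toNNReal_add (dotProduct_self_nonneg' a) (dotProduct_self_nonneg' b)]
  simp [add_mul]

lemma gaussianReal_real_abs_gt_le (c : ℝ≥0) {x : ℝ} (hx : 0 ≤ x) :
    (gaussianReal 0 c).real {y | x < |y|} ≤ 2 * Real.exp (-x ^ 2 / (2 * c)) := by
  have h1 : HasSubgaussianMGF (fun y : ℝ => y) c (gaussianReal 0 c) :=
    ⟨fun t => integrable_exp_mul_gaussianReal t, fun t => by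
      rw [mgf_fun_id_gaussianReal]; simp⟩
  have h2 : HasSubgaussianMGF (fun y : ℝ => -y) c (gaussianReal 0 c) := h1.neg
  have hs : {y : ℝ | x < |y|} ⊆ {y | x ≤ y} ∪ {y | x ≤ -y} := by
    intro y (hy : x < |y|)
    rcases lt_abs.1 hy with h | h
    · exact Or.inl h.le
    · exact Or.inr h.le
  calc _ ≤ (gaussianReal 0 c).real ({y | x ≤ y} ∪ {y | x ≤ -y}) := measureReal_mono hs
    _ ≤ _ := measureReal_union_le _ _
    _ ≤ _ := by linarith [h1.measure_ge_le hx, h2.measure_ge_le hx]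

lemma gaussVec_real_abs_dotProduct_gt_le (c : ℝ≥0) (η : I → ℝ) (hη : η ⬝ᵥ η ≤ 1) {x : ℝ}
    (hx : 0 ≤ x) :
    (gaussVec I c).real {z | x < |η ⬝ᵥ z|} ≤ 2 * Real.exp (-x ^ 2 / (2 * c)) := by
  have hm : Measurable fun z : I → ℝ => η ⬝ᵥ z := Continuous.measurable (by fun_prop)
  have hs : MeasurableSet {y : ℝ | x < |y|} := measurableSet_lt (by fun_prop) (by fun_prop)
  have h := map_measureReal_apply (μ := gaussVec I c) hm hs
  rw [map_dotProduct_gaussVec] at h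
  rw [show {z : I → ℝ | x < |η ⬝ᵥ z|} = (fun z => η ⬝ᵥ z) ⁻¹' {y : ℝ | x < |y|} from rfl, ← h]
  have h0 : (0 : ℝ) ≤ η ⬝ᵥ η := dotProduct_self_nonneg' η
  -- For variance zero the general tail bound degenerates to `2`, through division by zero, so this
  -- case is done by hand.
  rcases eq_or_lt_of_le h0 with h0 | h0
  · rw [← h0]
    have : (0 : ℝ) ∉ {y : ℝ | x < |y|} := by simp [hx]
    simp only [Real.toNNReal_zero, zero_mul, gaussianReal_zero_var, measureReal_def]
    rw [Measure.dirac_apply' _ hs]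
    simp only [Set.indicator_of_notMem this, ENNReal.toReal_zero]
    positivity
  refine (gaussianReal_real_abs_gt_le _ hx).trans ?_
  have hc : ((((η ⬝ᵥ η).toNNReal * c : ℝ≥0)) : ℝ) = (η ⬝ᵥ η) * c := by
    rw [NNReal.coe_mul, Real.coe_toNNReal _ h0.le]
  rw [hc]
  gcongr 2 * Real.exp ?_
  rcases eq_or_lt_of_le (c.coe_nonneg) with hc0 | hc0
  · simp [← hc0]
  rw [neg_div, neg_div, neg_le_neg_iff]
  gcongr
  nlinarith

end GaussianVectors

end SpikedTensor

namespace SpikedTensor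

/-! ### Adaptive linear queries of a Gaussian vector. -/

section AdaptiveQueries
open Matrix

set_option linter.unusedSectionVars false

variable {I J : Type*} [Fintype I] [Fintype J] {S Y : Type*}

/-- The state after `t` rounds of adaptive linear queries `(A (q s))ᵀ *ᵥ Z` of a random vector `Z`:
in state `s` the query `q s` is made, and the answer `z` leads to the state `F s z`. -/
def adaptState (A : Y → Matrix I J ℝ) (q : S → Y) (F : S → (J → ℝ) → S) (s₀ : S) (Z : I → ℝ) :
    ℕ → S
  | 0 => s₀
  | t + 1 => F (adaptState A q F s₀ Z t) ((A (q (adaptState A q F s₀ Z t)))ᵀ *ᵥ Z)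

/-- Peels off the first round instead of the last, as the induction on the number of queries
requires. -/
lemma adaptState_succ' (A : Y → Matrix I J ℝ) (q : S → Y) (F : S → (J → ℝ) → S) (s₀ : S)
    (Z : I → ℝ) (t : ℕ) :
    adaptState A q F s₀ Z (t + 1) = adaptState A q F (F s₀ ((A (q s₀))ᵀ *ᵥ Z)) Z t := by
  induction t with
  | zero => rfl
  | succ t ih => rw [adaptState, ih]; rfl

variable [MeasurableSpace S] [NormedAddCommGroup Y] [InnerProductSpace ℝ Y] [MeasurableSpace Y]
  [BorelSpace Y] [FiniteDimensional ℝ Y]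

lemma measurable_query (A : Y →ₗ[ℝ] Matrix I J ℝ) :
    Measurable fun p : Y × (I → ℝ) => (A p.1)ᵀ *ᵥ p.2 := by
  have : Continuous A := A.continuous_of_finiteDimensional
  apply Continuous.measurable
  fun_prop

lemma measurable_adaptState (A : Y →ₗ[ℝ] Matrix I J ℝ) {q : S → Y} {F : S → (J → ℝ) → S}
    (hq : Measurable q) (hF : Measurable (Function.uncurry F)) (s₀ : S) (t : ℕ) :
    Measurable fun Z => adaptState A q F s₀ Z t := by
  induction t with
  | zero => exact measurable_const
  | succ t ih =>
    exact hF.comp (ih.prodMk ((measurable_query A).comp ((hq.comp ih).prodMk measurable_id)))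

/-- After resampling along `e`, the part of the query along `e` sees the fresh vector and only the
projected query still sees `Z`. -/
lemma query_add_mulVec [DecidableEq J] (A : Y →ₗ[ℝ] Matrix I J ℝ)
    (hA : ∀ y y', (A y)ᵀ * A y' = (inner ℝ y y' : ℝ) • (1 : Matrix J J ℝ)) (y e : Y)
    (ξ : J → ℝ) (Z : I → ℝ) :
    (A y)ᵀ *ᵥ (Z + A e *ᵥ (ξ - (A e)ᵀ *ᵥ Z))
      = (inner ℝ y e : ℝ) • ξ + (A (y - (inner ℝ y e : ℝ) • e))ᵀ *ᵥ Z := by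
  rw [mulVec_add, mulVec_mulVec, hA, map_sub, map_smul, transpose_sub, transpose_smul,
    sub_mulVec, smul_mulVec, smul_mulVec, one_mulVec, smul_sub]
  abel

/-- Adaptive schemes are stable under resampling: for frozen `ξ` one gets a scheme for the original
`Z`, with projected queries and a shifted update. The induction hypothesis therefore applies to it.
-/
lemma adaptState_add_mulVec [DecidableEq J] (A : Y →ₗ[ℝ] Matrix I J ℝ)
    (hA : ∀ y y', (A y)ᵀ * A y' = (inner ℝ y y' : ℝ) • (1 : Matrix J J ℝ)) (q : S → Y)
    (F : S → (J → ℝ) → S) (s₀ : S) (e : Y) (ξ : J → ℝ) (Z : I → ℝ) (t : ℕ) :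
    adaptState A q F s₀ (Z + A e *ᵥ (ξ - (A e)ᵀ *ᵥ Z)) t
      = adaptState A (fun s => q s - (inner ℝ (q s) e : ℝ) • e)
          (fun s z => F s ((inner ℝ (q s) e : ℝ) • ξ + z)) s₀ Z t := by
  induction t with
  | zero => rfl
  | succ t ih => rw [adaptState, ih, query_add_mulVec A hA]; rfl

/-- Each of the first `m` answers to adaptive queries of norm at most one to a Gaussian vector is
dominated, in given directions, by `m` times a fresh Gaussian. -/
theorem gaussVec_adaptive_tail [DecidableEq J] (c : ℝ≥0) (A : Y →ₗ[ℝ] Matrix I J ℝ)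
    (hA : ∀ y y', (A y)ᵀ * A y' = (inner ℝ y y' : ℝ) • (1 : Matrix J J ℝ))
    {κ : Type*} [Fintype κ] (w : κ → J → ℝ) (l : ℝ) (m : ℕ) :
    ∀ {q : S → Y} {F : S → (J → ℝ) → S} (s₀ : S), Measurable q → Measurable (Function.uncurry F) →
      ‖q s₀‖ ≤ 1 → (∀ s z, ‖q (F s z)‖ ≤ 1) →
      gaussVec I c {Z | ∃ t < m, ∃ j,
          m * l < |w j ⬝ᵥ ((A (q (adaptState A q F s₀ Z t)))ᵀ *ᵥ Z)|}
        ≤ m * gaussVec J c {ξ | ∃ j, l < |w j ⬝ᵥ ξ|} := by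
  induction m with
  | zero => intro q F s₀ _ _ _ _; simp
  | succ m ih =>
    intro q F s₀ hq hF hs₀ hqF
    -- The direction of the first query is deterministic. If that query vanishes then `e = 0`, and
    -- `A e` still satisfies the resampling hypothesis.
    set e : Y := ‖q s₀‖⁻¹ • q s₀ with he
    have hqe : q s₀ = (inner ℝ (q s₀) e : ℝ) • e := by
      rcases eq_or_ne (q s₀) 0 with h | h
      · simp [he, h]
      · have : ‖q s₀‖ ≠ 0 := norm_ne_zero_iff.2 h
        rw [he, inner_smul_right, real_inner_self_eq_norm_sq, smul_smul]
        field_simp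
        simp
    have hen : ‖e‖ ≤ 1 := by
      rw [he, norm_smul, norm_inv, norm_norm]
      exact inv_mul_le_one
    have hee : (inner ℝ e e : ℝ) • e = e := by
      rcases eq_or_ne (q s₀) 0 with h | h
      · simp [he, h]
      · have : ‖q s₀‖ ≠ 0 := norm_ne_zero_iff.2 h
        have : ‖e‖ = 1 := by rw [he, norm_smul, norm_inv, norm_norm, inv_mul_cancel₀ this]
        rw [real_inner_self_eq_norm_sq, this]; simp
    have hAe : A e * (A e)ᵀ * A e = A e := by
      rw [Matrix.mul_assoc, hA, Matrix.mul_smul, Matrix.mul_one, ← map_smul, hee]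
    set Ev : Set (I → ℝ) := {Z | ∃ t < m + 1, ∃ j,
          ((m + 1 : ℕ) : ℝ) * l < |w j ⬝ᵥ ((A (q (adaptState A q F s₀ Z t)))ᵀ *ᵥ Z)|} with hEv
    have hEvm : MeasurableSet Ev := by
      simp only [hEv, Set.ofPred_exists, ← exists_prop]
      refine MeasurableSet.iUnion fun t => MeasurableSet.iUnion fun _ => MeasurableSet.iUnion
        fun j => measurableSet_lt measurable_const ?_
      refine Measurable.abs ((measurable_dotProduct (w j)).comp ?_)
      exact (measurable_query A).comp
        ((hq.comp (measurable_adaptState A hq hF s₀ t)).prodMk measurable_id)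
    set B : Set (J → ℝ) := {ξ | ∃ j, l < |w j ⬝ᵥ ξ|} with hB
    have hBm : MeasurableSet B := by
      simp only [hB, Set.ofPred_exists]
      exact MeasurableSet.iUnion fun j => measurableSet_lt measurable_const
        (measurable_dotProduct (w j)).abs
    have hm : Measurable fun p : (J → ℝ) × (I → ℝ) => p.2 + A e *ᵥ (p.1 - (A e)ᵀ *ᵥ p.2) := by
      apply Continuous.measurable
      fun_prop
    set Ψ := fun p : (J → ℝ) × (I → ℝ) => p.2 + A e *ᵥ (p.1 - (A e)ᵀ *ᵥ p.2) with hΨ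
    -- What the first query sees of `Z` is replaced by an independent `ξ`. The event `B` that `ξ` is
    -- large is paid for once; off `B` the remaining rounds are treated for frozen `ξ`.
    have hlaw : gaussVec I c Ev = ((gaussVec J c).prod (gaussVec I c)) (Ψ ⁻¹' Ev) := by
      rw [← Measure.map_apply hm hEvm, map_add_mulVec_gaussVec c _ hAe]
    rw [hlaw]
    have hsplit : Ψ ⁻¹' Ev ⊆ (B ×ˢ Set.univ) ∪ (Ψ ⁻¹' Ev \ (B ×ˢ Set.univ)) := by
      intro p hp
      by_cases h : p ∈ B ×ˢ (Set.univ : Set (I → ℝ))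
      · exact Or.inl h
      · exact Or.inr ⟨hp, h⟩
    have hbound : ((gaussVec J c).prod (gaussVec I c)) (Ψ ⁻¹' Ev \ (B ×ˢ Set.univ))
        ≤ m * gaussVec J c B := by
      rw [Measure.prod_apply ((hm hEvm).diff (hBm.prod MeasurableSet.univ))]
      calc _ ≤ ∫⁻ _, (m * gaussVec J c B) ∂(gaussVec J c) := by
            refine lintegral_mono fun ξ => ?_
            by_cases hξ : ξ ∈ B
            · have : (Prod.mk ξ ⁻¹' (Ψ ⁻¹' Ev \ (B ×ˢ Set.univ))) = ∅ := by
                ext Z; simp [hξ]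
              rw [this]; simp
            set q' : S → Y := fun s => q s - (inner ℝ (q s) e : ℝ) • e with hq'
            set F' : S → (J → ℝ) → S := fun s z => F s ((inner ℝ (q s) e : ℝ) • ξ + z) with hF'
            set s₁ := F s₀ ((inner ℝ (q s₀) e : ℝ) • ξ) with hs₁
            have hq'm : Measurable q' := by
              have h1 : Measurable fun y : Y => y - (inner ℝ y e : ℝ) • e :=
                Continuous.measurable (by fun_prop)
              exact h1.comp hq
            have hF'm : Measurable (Function.uncurry F') := by
              have h1 : Measurable fun p : Y × (J → ℝ) => (inner ℝ p.1 e : ℝ) • ξ + p.2 :=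
                Continuous.measurable (by fun_prop)
              exact hF.comp (measurable_fst.prodMk
                (h1.comp ((hq.comp measurable_fst).prodMk measurable_snd)))
            have hproj : ∀ y : Y, ‖y - (inner ℝ y e : ℝ) • e‖ ≤ ‖y‖ := by
              intro y
              have h1 : ‖y - (inner ℝ y e : ℝ) • e‖ ^ 2 ≤ ‖y‖ ^ 2 := by
                rw [norm_sub_sq_real, inner_smul_right, norm_smul, mul_pow, Real.norm_eq_abs,
                  sq_abs]
                have : ‖e‖ ^ 2 ≤ 1 := by nlinarith [norm_nonneg e]
                nlinarith [sq_nonneg (inner ℝ y e : ℝ)]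
              exact (sq_le_sq₀ (norm_nonneg _) (norm_nonneg _)).1 h1
            have := ih s₁ hq'm hF'm ((hproj _).trans (hqF _ _))
              (fun s z => (hproj _).trans (hqF _ _))
            -- An answer is a multiple of `ξ`, contributing at most `l`, plus an answer of the
            -- projected scheme; to exceed `(m + 1) l` the latter must exceed `m l`.
            refine le_trans (measure_mono ?_) this
            rintro Z ⟨⟨t, ht, j, hj⟩, -⟩
            have hξj : |w j ⬝ᵥ ξ| ≤ l := by
              by_contra h
              exact hξ ⟨j, not_le.1 h⟩
            simp only [hΨ] at hj
            rw [adaptState_add_mulVec A hA, query_add_mulVec A hA] at hj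
            have hin : ∀ s, ‖q s‖ ≤ 1 → |(inner ℝ (q s) e : ℝ)| ≤ 1 := fun s hs =>
              (abs_real_inner_le_norm _ _).trans (mul_le_one₀ hs (norm_nonneg _) hen)
            cases t with
            | zero =>
              exfalso
              simp only [adaptState] at hj
              rw [← hqe, sub_self, map_zero, transpose_zero, zero_mulVec, add_zero,
                dotProduct_smul, smul_eq_mul, abs_mul] at hj
              have h1 := hin _ hs₀
              have h0 : 0 ≤ l := (abs_nonneg _).trans hξj
              have : |(inner ℝ (q s₀) e : ℝ)| * |w j ⬝ᵥ ξ| ≤ 1 * l := by gcongr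
              push_cast at hj
              nlinarith [mul_nonneg (Nat.cast_nonneg (α := ℝ) m) h0]
            | succ t =>
              refine ⟨t, by omega, j, ?_⟩
              rw [adaptState_succ'] at hj
              -- The first projected query is zero, so the state after one round depends on `ξ`
              -- only: a deterministic starting point for one round less.
              have hfirst : F s₀ ((inner ℝ (q s₀) e : ℝ) • ξ
                  + (A (q s₀ - (inner ℝ (q s₀) e : ℝ) • e))ᵀ *ᵥ Z) = s₁ := by
                rw [← hqe, sub_self, map_zero, transpose_zero, zero_mulVec, add_zero]
              simp only [← hq', ← hF'] at hj
              rw [hfirst] at hj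
              set st := adaptState (⇑A) q' F' s₁ Z t with hst
              have hqst : ‖q st‖ ≤ 1 := by
                rw [hst]
                cases t with
                | zero => exact hqF _ _
                | succ t => exact hqF _ _
              have h1 := hin _ hqst
              rw [dotProduct_add, dotProduct_smul, smul_eq_mul] at hj
              have h0 : 0 ≤ l := (abs_nonneg _).trans hξj
              have h2 : |(inner ℝ (q st) e : ℝ)| * |w j ⬝ᵥ ξ| ≤ 1 * l := by gcongr
              have h3 := abs_add_le ((inner ℝ (q st) e : ℝ) * w j ⬝ᵥ ξ)
                (w j ⬝ᵥ (A (q st - (inner ℝ (q st) e : ℝ) • e))ᵀ *ᵥ Z)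
              rw [abs_mul] at h3
              push_cast at hj
              change _ < |w j ⬝ᵥ (A (q st - (inner ℝ (q st) e : ℝ) • e))ᵀ *ᵥ Z|
              linarith
        _ = _ := by simp
    calc _ ≤ ((gaussVec J c).prod (gaussVec I c)) (B ×ˢ Set.univ)
          + ((gaussVec J c).prod (gaussVec I c)) (Ψ ⁻¹' Ev \ (B ×ˢ Set.univ)) :=
          (measure_mono hsplit).trans (measure_union_le _ _)
      _ ≤ gaussVec J c B + m * gaussVec J c B := by
          gcongr
          rw [Measure.prod_prod]; simp
      _ = _ := by push_cast; ring

end AdaptiveQueries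

end SpikedTensor

namespace SpikedTensor

/-! ### Tensor contractions as multilinear forms and as linear queries. -/

section TensorAlgebra
open Matrix

variable {k m n r : ℕ}

lemma tinner_eq_dotProduct (X η : Tensor k n) : tinner X η = η ⬝ᵥ X := by
  rw [dotProduct_comm]; rfl

lemma tinner_add_left (X Y η : Tensor k n) : tinner (X + Y) η = tinner X η + tinner Y η := by
  simp [tinner_eq_dotProduct]

lemma tinner_pureTensor_pureTensor (w w' : Fin k → EuclideanSpace ℝ (Fin n)) :
    tinner (pureTensor w) (pureTensor w') = ∏ s, (inner ℝ (w s) (w' s) : ℝ) := by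
  simp only [tinner, pureTensor, PiLp.inner_apply, Finset.prod_univ_sum, Fintype.piFinset_univ,
    ← Finset.prod_mul_distrib]
  simp [mul_comm]

/-- The multilinear form `w ↦ ⟨X, w 0 ⊗ ⋯ ⊗ w (k - 1)⟩`. -/
noncomputable def tensorForm (X : Tensor k n) :
    MultilinearMap ℝ (fun _ : Fin k => EuclideanSpace ℝ (Fin n)) ℝ :=
  ∑ I, X I • (MultilinearMap.mkPiAlgebra ℝ (Fin k) ℝ).compLinearMap
    fun s => (EuclideanSpace.proj (I s) : EuclideanSpace ℝ (Fin n) →L[ℝ] ℝ).toLinearMap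

lemma tensorForm_apply (X : Tensor k n) (w : Fin k → EuclideanSpace ℝ (Fin n)) :
    tensorForm X w = tinner X (pureTensor w) := by
  simp [tensorForm, tinner, pureTensor]

/-- The vector sequence `(x, v, …, v)`. -/
def headTail (m : ℕ) (x v : EuclideanSpace ℝ (Fin n)) : Fin (m + 1) → EuclideanSpace ℝ (Fin n) :=
  Fin.cons x fun _ => v

lemma ite_eq_headTail (x v : EuclideanSpace ℝ (Fin n)) :
    (fun s : Fin (m + 1) => if (s : ℕ) = 0 then x else v) = headTail m x v := by
  ext s : 1
  refine Fin.cases ?_ (fun i => ?_) s <;> simp [headTail]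

lemma contract_apply (X : Tensor (m + 1) n) (v : EuclideanSpace ℝ (Fin n)) (l : Fin n) :
    contract X v l = tinner X (pureTensor (headTail m (EuclideanSpace.single l 1) v)) := by
  simp only [contract, ← ite_eq_headTail]

lemma inner_contract (X : Tensor (m + 1) n) (x v : EuclideanSpace ℝ (Fin n)) :
    inner ℝ x (contract X v) = tinner X (pureTensor (headTail m x v)) := by
  have h : ∀ y, tinner X (pureTensor (headTail m y v))
      = (tensorForm X).toLinearMap (headTail m 0 v) 0 y := by
    intro y
    rw [MultilinearMap.toLinearMap_apply, tensorForm_apply]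
    congr 2
    simp [headTail]
  rw [h]
  have hx : x = ∑ l, x l • EuclideanSpace.single l (1 : ℝ) := by
    ext i; simp [Pi.single_apply]
  conv_rhs => rw [hx]
  rw [map_sum]
  simp_rw [map_smul, ← h, ← contract_apply, PiLp.inner_apply]
  simp [mul_comm]

lemma contract_add (X Y : Tensor (m + 1) n) (v : EuclideanSpace ℝ (Fin n)) :
    contract (X + Y) v = contract X v + contract Y v := by
  ext l
  simp [contract_apply, tinner_add_left]

lemma inner_contract_self (X : Tensor (m + 1) n) (v : EuclideanSpace ℝ (Fin n)) :
    inner ℝ v (contract X v) = tinner X (tpow (m + 1) v) := by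
  rw [inner_contract]
  congr 2
  ext s : 1
  refine Fin.cases ?_ (fun i => ?_) s <;> simp [headTail]

lemma tinner_signal_pureTensor (β : Fin r → ℝ) (v : Fin r → EuclideanSpace ℝ (Fin n))
    (w : Fin k → EuclideanSpace ℝ (Fin n)) :
    tinner (signal k β v) (pureTensor w) = ∑ j, β j * ∏ s, (inner ℝ (v j) (w s) : ℝ) := by
  have : ∀ j, ∏ s, (inner ℝ (v j) (w s) : ℝ) = tinner (tpow k (v j)) (pureTensor w) := fun j =>
    (tinner_pureTensor_pureTensor _ _).symm
  simp only [this, tinner, signal, Finset.mul_sum, Finset.sum_apply, Finset.sum_mul,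
    Pi.smul_apply, smul_eq_mul, mul_assoc]
  rw [Finset.sum_comm]

lemma contract_signal (β : Fin r → ℝ) (v : Fin r → EuclideanSpace ℝ (Fin n))
    (u : EuclideanSpace ℝ (Fin n)) :
    contract (signal (m + 1) β v) u = ∑ j, (β j * inner ℝ u (v j) ^ m) • v j := by
  ext l
  rw [contract_apply, tinner_signal_pureTensor]
  simp [headTail, Fin.prod_univ_succ, real_inner_comm u, EuclideanSpace.inner_single_right]
  exact Finset.sum_congr rfl fun j _ => by ring

lemma tinner_signal_tpow (β : Fin r → ℝ) (v : Fin r → EuclideanSpace ℝ (Fin n))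
    (u : EuclideanSpace ℝ (Fin n)) :
    tinner (signal k β v) (tpow k u) = ∑ j, β j * inner ℝ u (v j) ^ k := by
  rw [tpow, tinner_signal_pureTensor]
  simp [real_inner_comm u]

/-- `M` bounds the injective norm of the tensor `X`. -/
def OpBound (M : ℝ) (X : Tensor k n) : Prop :=
  ∀ w : Fin k → EuclideanSpace ℝ (Fin n), |tinner X (pureTensor w)| ≤ M * ∏ s, ‖w s‖

/-- The vector `contract X v` is tested against itself. -/
lemma OpBound.norm_contract_le {M : ℝ} {X : Tensor (m + 1) n} (h : OpBound M X)
    {v : EuclideanSpace ℝ (Fin n)} (hM : 0 ≤ M) (hv : ‖v‖ ≤ 1) : ‖contract X v‖ ≤ M := by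
  have h1 := h (headTail m (contract X v) v)
  rw [← inner_contract, real_inner_self_eq_norm_sq, abs_of_nonneg (sq_nonneg _)] at h1
  simp only [headTail, Fin.prod_univ_succ, Fin.cons_zero, Fin.cons_succ, Finset.prod_const,
    Finset.card_univ, Fintype.card_fin] at h1
  have h2 : ‖v‖ ^ m ≤ 1 := pow_le_one₀ (norm_nonneg _) hv
  have h3 : ‖contract X v‖ ^ 2 ≤ M * ‖contract X v‖ := by
    refine h1.trans ?_
    have : ‖contract X v‖ * ‖v‖ ^ m ≤ ‖contract X v‖ * 1 := by gcongr
    nlinarith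
  by_contra hlt
  push Not at hlt
  nlinarith

lemma OpBound.norm_sub_le {M : ℝ} {X : Tensor k n} (h : OpBound M X) (hM : 0 ≤ M)
    {w w' : Fin k → EuclideanSpace ℝ (Fin n)} {δ : ℝ} (hδ : 0 ≤ δ) (hw : ∀ s, ‖w s‖ ≤ 1)
    (hw' : ∀ s, ‖w' s‖ ≤ 1) (hd : ∀ s, ‖w s - w' s‖ ≤ δ) :
    |tinner X (pureTensor w) - tinner X (pureTensor w')| ≤ M * k * δ := by
  have := (tensorForm X).norm_image_sub_le_of_bound hM
    (fun w => by rw [tensorForm_apply]; exact h w) w w'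
  rw [tensorForm_apply, tensorForm_apply, Real.norm_eq_abs, Fintype.card_fin] at this
  refine this.trans ?_
  have h1 : ‖w‖ ≤ 1 := (pi_norm_le_iff_of_nonneg zero_le_one).2 hw
  have h2 : ‖w'‖ ≤ 1 := (pi_norm_le_iff_of_nonneg zero_le_one).2 hw'
  have h3 : ‖w - w'‖ ≤ δ := (pi_norm_le_iff_of_nonneg hδ).2 hd
  have h4 : max ‖w‖ ‖w'‖ ^ (k - 1) ≤ 1 := pow_le_one₀ (by positivity) (max_le h1 h2)
  calc _ ≤ M * k * 1 * δ := by gcongr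
    _ = _ := by ring

/-- Duality: the difference is paired with the unit vector in its own direction, which puts the
multilinear Lipschitz bound at disposal. -/
lemma OpBound.norm_contract_sub_le {M : ℝ} {X : Tensor (m + 1) n} (h : OpBound M X) (hM : 0 ≤ M)
    {v w : EuclideanSpace ℝ (Fin n)} (hv : ‖v‖ ≤ 1) (hw : ‖w‖ ≤ 1) :
    ‖contract X v - contract X w‖ ≤ M * (m + 1) * ‖v - w‖ := by
  set d := contract X v - contract X w with hd
  rcases eq_or_ne d 0 with h0 | h0
  · rw [h0, norm_zero]; positivity
  have hdn : ‖d‖ ≠ 0 := norm_ne_zero_iff.2 h0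
  set x := ‖d‖⁻¹ • d with hx
  have hxn : ‖x‖ = 1 := by rw [hx, norm_smul, norm_inv, norm_norm, inv_mul_cancel₀ hdn]
  have h1 : inner ℝ x d = ‖d‖ := by
    rw [hx, inner_smul_left, real_inner_self_eq_norm_sq]
    simp; field_simp
  have h2 := h.norm_sub_le hM (w := headTail m x v) (w' := headTail m x w) (δ := ‖v - w‖)
    (norm_nonneg _) (fun s => by refine Fin.cases ?_ (fun i => ?_) s <;> simp [headTail, hxn, hv])
    (fun s => by refine Fin.cases ?_ (fun i => ?_) s <;> simp [headTail, hxn, hw])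
    (fun s => by refine Fin.cases ?_ (fun i => ?_) s <;> simp [headTail])
  rw [← inner_contract, ← inner_contract, ← inner_sub_right, ← hd, h1, abs_norm] at h2
  exact_mod_cast h2

lemma OpBound.abs_tinner_tpow_sub_le {M : ℝ} {X : Tensor k n} (h : OpBound M X) (hM : 0 ≤ M)
    {v w : EuclideanSpace ℝ (Fin n)} (hv : ‖v‖ ≤ 1) (hw : ‖w‖ ≤ 1) :
    |tinner X (tpow k v) - tinner X (tpow k w)| ≤ M * k * ‖v - w‖ :=
  h.norm_sub_le hM (norm_nonneg _) (fun _ => hv) (fun _ => hw) fun _ => le_rfl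

lemma tinner_tpow_smul (X : Tensor k n) (s : ℝ) (v : EuclideanSpace ℝ (Fin n)) :
    tinner X (tpow k (s • v)) = s ^ k * tinner X (tpow k v) := by
  have := (tensorForm X).map_smul_univ (fun _ => s) (fun _ => v)
  simpa [tensorForm_apply, tpow] using this

lemma contract_smul (X : Tensor (m + 1) n) (s : ℝ) (v : EuclideanSpace ℝ (Fin n)) :
    contract X (s • v) = s ^ m • contract X v := by
  ext l
  have := (tensorForm X).map_smul_univ (Fin.cons 1 fun _ => s)
    (headTail m (EuclideanSpace.single l 1) v)
  simp only [tensorForm_apply, Fin.prod_univ_succ, Fin.cons_zero, Fin.cons_succ,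
    Finset.prod_const, Finset.card_univ, Fintype.card_fin, one_mul] at this
  rw [PiLp.smul_apply, contract_apply, contract_apply, ← this]
  congr 2
  ext s : 1
  refine Fin.cases ?_ (fun i => ?_) s <;> simp [headTail]

/-- The tensor `y` of order `m`, placed in the slots `1, …, m` of a tensor of order `m + 1`: the
matrix whose transpose contracts these slots with `y`. -/
def tailMatrix (m n : ℕ) :
    EuclideanSpace ℝ (Fin m → Fin n) →ₗ[ℝ] Matrix (Fin (m + 1) → Fin n) (Fin n) ℝ where
  toFun y := Matrix.of fun I l => if I 0 = l then y (Fin.tail I) else 0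
  map_add' x y := by ext I l; by_cases h : I 0 = l <;> simp [h]
  map_smul' c y := by ext I l; by_cases h : I 0 = l <;> simp [h]

lemma sum_tensor_index (f : (Fin (m + 1) → Fin n) → ℝ) :
    ∑ I, f I = ∑ l, ∑ I, f (Fin.cons l I) := by
  rw [← Fintype.sum_prod_type' fun l I => f (Fin.cons l I)]
  exact ((Fin.consEquiv fun _ : Fin (m + 1) => Fin n).sum_comp f).symm

/-- This is the orthogonality relation required of adaptive queries: different first indices do not
interact, and for equal ones the sum over the other indices is the inner product. -/
lemma tailMatrix_transpose_mul (y y' : EuclideanSpace ℝ (Fin m → Fin n)) :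
    (tailMatrix m n y)ᵀ * tailMatrix m n y' = (inner ℝ y y' : ℝ) • (1 : Matrix (Fin n) (Fin n) ℝ) := by
  ext l l'
  rw [Matrix.mul_apply, sum_tensor_index]
  simp only [tailMatrix, LinearMap.coe_mk, AddHom.coe_mk, Matrix.transpose_apply, Matrix.of_apply,
    Fin.cons_zero, Fin.tail_cons, Matrix.smul_apply, smul_eq_mul, Matrix.one_apply,
    PiLp.inner_apply]
  rw [Finset.sum_eq_single l]
  · by_cases h : l = l' <;> simp [h, mul_comm]
  · intro b _ hb; simp [hb]
  · simp

/-- The power `v ^ ⊗m`, in Euclidean space. -/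
noncomputable def tailPow (m : ℕ) (v : EuclideanSpace ℝ (Fin n)) :
    EuclideanSpace ℝ (Fin m → Fin n) :=
  WithLp.toLp 2 (tpow m v)

lemma norm_tailPow (v : EuclideanSpace ℝ (Fin n)) : ‖tailPow m v‖ = ‖v‖ ^ m := by
  have : ‖tailPow m v‖ ^ 2 = (‖v‖ ^ m) ^ 2 := by
    have h1 : ‖tailPow m v‖ ^ 2 = tinner (tpow m v) (tpow m v) := by
      rw [EuclideanSpace.real_norm_sq_eq]
      simp [tailPow, tinner, sq]
    rw [h1, tpow, tinner_pureTensor_pureTensor]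
    simp
    ring
  exact (sq_eq_sq₀ (norm_nonneg _) (by positivity)).1 this

/-- Exhibits the contraction as the answer to the query `v ^ ⊗m`. -/
lemma ofLp_contract (X : Tensor (m + 1) n) (v : EuclideanSpace ℝ (Fin n)) :
    WithLp.ofLp (contract X v) = (tailMatrix m n (tailPow m v))ᵀ *ᵥ X := by
  ext l
  change contract X v l = _
  rw [contract_apply, tinner, sum_tensor_index, mulVec, dotProduct, sum_tensor_index]
  refine Finset.sum_congr rfl fun i _ => Finset.sum_congr rfl fun I _ => ?_
  simp only [tailMatrix, LinearMap.coe_mk, AddHom.coe_mk, Matrix.transpose_apply, Matrix.of_apply,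
    Fin.cons_zero, Fin.tail_cons, pureTensor, headTail, Fin.prod_univ_succ, Fin.cons_succ,
    tailPow, tpow, PiLp.single_apply]
  by_cases h : i = l <;> simp [h, mul_comm]

end TensorAlgebra

end SpikedTensor

namespace SpikedTensor

/-! ### The injective norm of the noise. -/

section InjectiveNorm

variable {k m n r : ℕ}

/-- A half-net of the unit ball of exponential cardinality. -/
lemma exists_half_net (n : ℕ) : ∃ N : Finset (EuclideanSpace ℝ (Fin n)), N.card ≤ 5 ^ n ∧
    (∀ p ∈ N, ‖p‖ ≤ 1) ∧ ∀ x : EuclideanSpace ℝ (Fin n), ‖x‖ ≤ 1 → ∃ p ∈ N, ‖x - p‖ ≤ 1 / 2 := by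
  classical
  let P : Finset (EuclideanSpace ℝ (Fin n)) → Prop := fun s =>
    (∀ c ∈ s, ‖c‖ ≤ 1) ∧ ∀ c ∈ s, ∀ d ∈ s, c ≠ d → 1 / 2 ≤ ‖c - d‖
  have hcard : ∀ s, P s → s.card ≤ 5 ^ n := by
    intro s hs
    have hinj : Function.Injective fun c : EuclideanSpace ℝ (Fin n) => (2 : ℝ) • c :=
      smul_right_injective _ two_ne_zero
    -- The packing bound concerns 1-separated sets in the ball of radius 2, whence the dilation.
    have := Besicovitch.card_le_of_separated (s.image fun c => (2 : ℝ) • c) ?_ ?_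
    · rwa [Finset.card_image_of_injective _ hinj, finrank_euclideanSpace_fin] at this
    · intro c hc
      obtain ⟨c, hc', rfl⟩ := Finset.mem_image.1 hc
      rw [norm_smul]; norm_num; linarith [hs.1 c hc']
    · intro c hc d hd hcd
      obtain ⟨c, hc', rfl⟩ := Finset.mem_image.1 hc
      obtain ⟨d, hd', rfl⟩ := Finset.mem_image.1 hd
      rw [← smul_sub, norm_smul]
      have := hs.2 c hc' d hd' (fun h => hcd (by rw [h]))
      norm_num; linarith
  -- A separated set of maximal cardinality is a net, since an uncovered point could be added to it.
  let S : Set ℕ := {c | ∃ s, P s ∧ s.card = c}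
  have hne : S.Nonempty := ⟨0, ∅, by simp [P], rfl⟩
  have hb : BddAbove S := ⟨5 ^ n, by rintro _ ⟨s, hs, rfl⟩; exact hcard s hs⟩
  obtain ⟨N, hN, hNc⟩ := Nat.sSup_mem hne hb
  refine ⟨N, hcard N hN, hN.1, fun x hx => ?_⟩
  by_contra! hcon
  have hxN : x ∉ N := fun h => by have := hcon x h; simp at this; linarith
  have hP : P (insert x N) := by
    refine ⟨fun c hc => ?_, fun c hc d hd hcd => ?_⟩
    · rcases Finset.mem_insert.1 hc with rfl | h
      · exact hx
      · exact hN.1 c h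
    · rcases Finset.mem_insert.1 hc with rfl | h <;> rcases Finset.mem_insert.1 hd with rfl | h'
      · exact absurd rfl hcd
      · exact (hcon d h').le
      · rw [norm_sub_rev]; exact (hcon c h).le
      · exact hN.2 c h d h' hcd
  have := le_csSup hb (⟨_, hP, rfl⟩ : (insert x N).card ∈ S)
  rw [Finset.card_insert_of_notMem hxN, hNc] at this
  omega

/-- Approximation by the net gives `‖g‖ ≤ C + ‖g‖ / 2`. -/
lemma abs_le_two_mul_of_net {N : Finset (EuclideanSpace ℝ (Fin n))}
    (hN : ∀ x : EuclideanSpace ℝ (Fin n), ‖x‖ ≤ 1 → ∃ p ∈ N, ‖x - p‖ ≤ 1 / 2)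
    (f : EuclideanSpace ℝ (Fin n) →ₗ[ℝ] ℝ) {C : ℝ} (hf : ∀ p ∈ N, |f p| ≤ C)
    (x : EuclideanSpace ℝ (Fin n)) : |f x| ≤ 2 * C * ‖x‖ := by
  set g := LinearMap.toContinuousLinearMap f
  have hC : 0 ≤ C := by
    obtain ⟨p, hp, -⟩ := hN 0 (by simp)
    exact (abs_nonneg _).trans (hf p hp)
  have h1 : ‖g‖ ≤ C + ‖g‖ / 2 := by
    refine g.opNorm_le_of_unit_norm (by positivity) fun x hx => ?_
    obtain ⟨p, hp, hxp⟩ := hN x hx.le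
    have h2 : ‖g (x - p)‖ ≤ ‖g‖ * (1 / 2) := (g.le_opNorm _).trans (by gcongr)
    have h3 : ‖g p‖ ≤ C := hf p hp
    calc ‖g x‖ = ‖g p + g (x - p)‖ := by rw [← map_add]; simp
      _ ≤ ‖g p‖ + ‖g (x - p)‖ := norm_add_le _ _
      _ ≤ _ := by linarith
  calc |f x| = ‖g x‖ := rfl
    _ ≤ ‖g‖ * ‖x‖ := g.le_opNorm x
    _ ≤ _ := by gcongr; linarith

/-- The slots are freed from the net one at a time, each at the cost of a factor `2`. -/
lemma opBound_of_net {N : Finset (EuclideanSpace ℝ (Fin n))}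
    (hN : ∀ x : EuclideanSpace ℝ (Fin n), ‖x‖ ≤ 1 → ∃ p ∈ N, ‖x - p‖ ≤ 1 / 2)
    {X : Tensor k n} {C : ℝ} (h : ∀ p : Fin k → EuclideanSpace ℝ (Fin n), (∀ s, p s ∈ N) →
      |tinner X (pureTensor p)| ≤ C) : OpBound (2 ^ k * C) X := by
  classical
  have key : ∀ S : Finset (Fin k), ∀ w : Fin k → EuclideanSpace ℝ (Fin n), (∀ s ∉ S, w s ∈ N) →
      |tensorForm X w| ≤ 2 ^ S.card * C * ∏ s ∈ S, ‖w s‖ := by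
    intro S
    induction S using Finset.induction_on with
    | empty => intro w hw; simpa [tensorForm_apply] using h w (by simpa using hw)
    | insert a S ha ih =>
      intro w hw
      have h1 := abs_le_two_mul_of_net hN ((tensorForm X).toLinearMap w a)
        (C := 2 ^ S.card * C * ∏ s ∈ S, ‖w s‖) ?_ (w a)
      · rw [MultilinearMap.toLinearMap_apply, Function.update_eq_self] at h1
        rw [Finset.card_insert_of_notMem ha, Finset.prod_insert ha]
        refine h1.trans (le_of_eq ?_)
        ring
      · intro p hp
        rw [MultilinearMap.toLinearMap_apply]
        refine (ih (Function.update w a p) fun s hs => ?_).trans (le_of_eq ?_)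
        · by_cases hsa : s = a
          · subst hsa; simpa using hp
          · rw [Function.update_of_ne hsa]
            exact hw s (by simp [hsa, hs])
        · congr 1
          refine Finset.prod_congr rfl fun s hs => ?_
          rw [Function.update_of_ne]
          rintro rfl; exact ha hs
  intro w
  simpa [tensorForm_apply] using key Finset.univ w (by simp)

instance (k n : ℕ) : IsProbabilityMeasure (noiseLaw k n) := by
  unfold noiseLaw; infer_instance

/-- Union bound over at most `5 ^ (n k)` tuples of net points. Since the entries have variance `1 /
n`, the tail exponent at level `l` is `n l ^ 2 / 2 = n (k log 5 + 1)`: it cancels the entropy and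
leaves `exp (-n)`. -/
lemma noiseLaw_real_not_opBound_le (k n : ℕ) :
    (noiseLaw k n).real {Z | ¬ OpBound (2 ^ k * √(2 * (k * Real.log 5 + 1))) Z}
      ≤ 2 * Real.exp (-n) := by
  classical
  obtain ⟨N, hNc, hN1, hN⟩ := exists_half_net n
  set l : ℝ := √(2 * (k * Real.log 5 + 1)) with hl
  have hlog : 0 ≤ Real.log 5 := Real.log_nonneg (by norm_num)
  have hl2 : l ^ 2 = 2 * (k * Real.log 5 + 1) := Real.sq_sqrt (by positivity)
  set W := Fintype.piFinset fun _ : Fin k => N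
  have hsub : {Z : Tensor k n | ¬ OpBound (2 ^ k * l) Z}
      ⊆ ⋃ p ∈ W, {Z | l < |pureTensor p ⬝ᵥ Z|} := by
    intro Z hZ
    by_contra hcon
    simp only [Set.mem_iUnion, Set.mem_ofPred_eq, not_exists, not_lt] at hcon
    refine hZ (opBound_of_net hN fun p hp => ?_)
    rw [tinner_eq_dotProduct]
    exact hcon p (by simpa [W] using hp)
  have hp : ∀ p ∈ W, (noiseLaw k n).real {Z | l < |pureTensor p ⬝ᵥ Z|}
      ≤ 2 * Real.exp (-(n * (k * Real.log 5 + 1))) := by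
    intro p hp
    have h1 : pureTensor p ⬝ᵥ pureTensor p ≤ 1 := by
      rw [← tinner_eq_dotProduct, tinner_pureTensor_pureTensor]
      refine Finset.prod_le_one (fun s _ => real_inner_self_nonneg) fun s _ => ?_
      rw [real_inner_self_eq_norm_sq]
      have := hN1 (p s) (by simpa [W] using (Fintype.mem_piFinset.1 hp) s)
      exact pow_le_one₀ (norm_nonneg _) this
    refine (gaussVec_real_abs_dotProduct_gt_le _ _ h1 (Real.sqrt_nonneg _)).trans ?_
    rw [hl2]
    gcongr 2 * Real.exp ?_
    push_cast
    rcases Nat.eq_zero_or_pos n with rfl | hn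
    · simp
    · field_simp
      rfl
  calc _ ≤ (noiseLaw k n).real (⋃ p ∈ W, {Z | l < |pureTensor p ⬝ᵥ Z|}) :=
        measureReal_mono hsub (measure_ne_top _ _)
    _ ≤ ∑ p ∈ W, (noiseLaw k n).real {Z | l < |pureTensor p ⬝ᵥ Z|} :=
        measureReal_biUnion_finset_le _ _
    _ ≤ W.card * (2 * Real.exp (-(n * (k * Real.log 5 + 1)))) := by
        rw [← nsmul_eq_mul]
        exact Finset.sum_le_card_nsmul _ _ _ hp
    _ ≤ ((5 : ℝ) ^ n) ^ k * (2 * Real.exp (-(n * (k * Real.log 5 + 1)))) := by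
        gcongr
        rw [Fintype.card_piFinset]
        simp only [Finset.prod_const, Finset.card_univ, Fintype.card_fin]
        push_cast
        gcongr
        exact_mod_cast hNc
    _ = 2 * Real.exp (-n) := by
        have : ((5 : ℝ) ^ n) ^ k = Real.exp (n * (k * Real.log 5)) := by
          rw [← pow_mul]
          conv_lhs => rw [← Real.exp_log (show (0 : ℝ) < 5 by norm_num)]
          rw [← Real.exp_nat_mul]; push_cast; ring_nf
        rw [this, mul_left_comm, ← Real.exp_add]
        ring_nf

end InjectiveNorm

/-! ### The contracted noise, along fixed directions and along the iterates. -/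

section NoiseContraction
open Matrix

variable {k m n r : ℕ}

lemma continuous_contract : Continuous fun p : Tensor k n × EuclideanSpace ℝ (Fin n) =>
    contract p.1 p.2 := by
  unfold contract tinner pureTensor
  refine (PiLp.continuous_toLp 2 _).comp (continuous_pi fun l => ?_)
  refine continuous_finsetSum _ fun I _ => (by fun_prop : Continuous _).mul
    (continuous_finsetProd _ fun s _ => ?_)
  by_cases h : (s : ℕ) = 0 <;> simp only [h, if_true, if_false] <;> fun_prop

lemma measurable_powerIter (t : ℕ) :
    Measurable fun p : Tensor k n × EuclideanSpace ℝ (Fin n) => powerIter p.1 p.2 t := by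
  induction t with
  | zero => exact measurable_snd
  | succ t ih =>
    have h : Measurable fun p : Tensor k n × EuclideanSpace ℝ (Fin n) =>
        contract p.1 (powerIter p.1 p.2 t) :=
      continuous_contract.measurable.comp (measurable_fst.prodMk ih)
    exact h.norm.inv.smul h

lemma norm_powerIter_le (X : Tensor k n) {u : EuclideanSpace ℝ (Fin n)} (hu : ‖u‖ ≤ 1) (t : ℕ) :
    ‖powerIter X u t‖ ≤ 1 := by
  cases t with
  | zero => exact hu
  | succ t =>
    rw [powerIter, norm_smul, norm_inv, norm_norm]
    exact inv_mul_le_one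

/-- For a unit vector the query matrix is an isometry. Resampling along it preserves the noise and
turns the contraction into the fresh vector itself. -/
lemma map_contract_noiseLaw {v : EuclideanSpace ℝ (Fin n)} (hv : ‖v‖ = 1) :
    (noiseLaw (m + 1) n).map (fun Z => WithLp.ofLp (contract Z v)) = gaussVec (Fin n) (n : ℝ≥0)⁻¹ := by
  set A := tailMatrix m n (tailPow m v)
  have hAA : Aᵀ * A = 1 := by
    rw [tailMatrix_transpose_mul, real_inner_self_eq_norm_sq, norm_tailPow, hv]; simp
  have hA : A * Aᵀ * A = A := by rw [Matrix.mul_assoc, hAA, Matrix.mul_one]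
  have h := map_add_mulVec_gaussVec (n : ℝ≥0)⁻¹ A hA
  have hm : Measurable fun p : (Fin n → ℝ) × Tensor (m + 1) n => p.2 + A *ᵥ (p.1 - Aᵀ *ᵥ p.2) := by
    apply Continuous.measurable
    fun_prop
  simp_rw [ofLp_contract]
  rw [show noiseLaw (m + 1) n = gaussVec _ (n : ℝ≥0)⁻¹ from rfl, ← h, Measure.map_map _ hm]
  · have : ((fun Z : Tensor (m + 1) n => Aᵀ *ᵥ Z) ∘
        fun p : (Fin n → ℝ) × Tensor (m + 1) n => p.2 + A *ᵥ (p.1 - Aᵀ *ᵥ p.2)) = Prod.fst := by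
      ext1 p
      simp [Function.comp, mulVec_add, mulVec_mulVec, hAA]
    rw [this]
    simp
  · apply Continuous.measurable
    fun_prop

/-- Second moment bound for the squared norm of the contracted noise. -/
lemma noiseLaw_real_abs_norm_sq_sub_one_gt_le : ∃ c : ℝ, 0 ≤ c ∧ ∀ (m n : ℕ)
    (v : EuclideanSpace ℝ (Fin n)), ‖v‖ = 1 → ∀ δ : ℝ, 0 < δ →
    (noiseLaw (m + 1) n).real {Z | δ < |‖contract Z v‖ ^ 2 - 1|} ≤ c / (n * δ ^ 2) := by
  refine ⟨Var[fun x => x ^ 2; gaussianReal 0 1], variance_nonneg _ _, ?_⟩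
  intro m n v hv δ hδ
  have hn : 0 < n := by
    rcases Nat.eq_zero_or_pos n with rfl | h
    · have := Subsingleton.elim v 0
      simp [this] at hv
    · exact h
  set μ := gaussVec (Fin n) (n : ℝ≥0)⁻¹
  have hmeas : MeasurableSet {z : Fin n → ℝ | δ < |∑ i, z i ^ 2 - 1|} :=
    measurableSet_lt measurable_const (by fun_prop)
  have h1 : (noiseLaw (m + 1) n).real {Z | δ < |‖contract Z v‖ ^ 2 - 1|}
      = μ.real {z | δ < |∑ i, z i ^ 2 - 1|} := by
    rw [show μ = _ from (map_contract_noiseLaw (m := m) hv).symm, map_measureReal_apply _ hmeas]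
    · simp [EuclideanSpace.real_norm_sq_eq]
    · exact (PiLp.continuous_ofLp 2 _).measurable.comp
        (continuous_contract.measurable.comp (measurable_id.prodMk measurable_const))
  rw [h1]
  -- By scaling, each squared coordinate has variance `n ^ (-2)` times a universal constant, so the
  -- sum has variance of order `1 / n`.
  have hsc : gaussianReal 0 (n : ℝ≥0)⁻¹ = (gaussianReal 0 1).map (fun x => √((n : ℝ)⁻¹) * x) := by
    rw [gaussianReal_map_const_mul]
    simp only [mul_zero, mul_one]
    congr 1
    ext
    simp [Real.sq_sqrt]
  have hmem1 : ∀ c, MemLp (fun x : ℝ => x ^ 2) 2 (gaussianReal 0 c) := by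
    intro c
    have := (memLp_id_gaussianReal' (μ := 0) (v := c) 4 (by simp)).norm_rpow_div (q := 2)
    have h42 : (4 : ENNReal) / 2 = 2 := by
      rw [show (4 : ENNReal) = 2 * 2 by norm_num]
      exact ENNReal.mul_div_cancel_right (by simp) (by simp)
    rw [h42] at this
    refine this.congr_norm (by fun_prop) (Filter.Eventually.of_forall fun x => ?_)
    simp
  have hvar : Var[fun x => x ^ 2; gaussianReal 0 (n : ℝ≥0)⁻¹]
      = ((n : ℝ)⁻¹) ^ 2 * Var[fun x => x ^ 2; gaussianReal 0 1] := by
    rw [hsc, variance_map (by fun_prop) (by fun_prop)]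
    have : (fun x : ℝ => x ^ 2) ∘ (fun x : ℝ => √((n : ℝ)⁻¹) * x)
        = fun x => (n : ℝ)⁻¹ * x ^ 2 := by
      ext x; simp [mul_pow]
    rw [this, variance_const_mul]
  have hmean : ∫ x, x ^ 2 ∂(gaussianReal 0 (n : ℝ≥0)⁻¹) = (n : ℝ)⁻¹ := by
    have h := variance_fun_id_gaussianReal (μ := 0) (v := (n : ℝ≥0)⁻¹)
    rw [variance_of_integral_eq_zero (by fun_prop) (by simp)] at h
    simpa using h
  have hmemi : ∀ i : Fin n, MemLp (fun z : Fin n → ℝ => z i ^ 2) 2 μ := fun i =>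
    (hmem1 _).comp_measurePreserving (measurePreserving_eval _ i)
  have hE : ∫ z, ∑ i, z i ^ 2 ∂μ = 1 := by
    rw [integral_finsetSum _ fun i _ => (hmemi i).integrable (by norm_num)]
    have : ∀ i : Fin n, ∫ z, z i ^ 2 ∂μ = (n : ℝ)⁻¹ := by
      intro i
      rw [← hmean]
      exact integral_comp_eval (μ := fun _ : Fin n => gaussianReal 0 (n : ℝ≥0)⁻¹)
        (f := fun x : ℝ => x ^ 2) (by fun_prop)
    simp only [this]
    simp
    field_simp
  have hV : Var[fun z : Fin n → ℝ => ∑ i, z i ^ 2; μ]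
      = (n : ℝ)⁻¹ * Var[fun x => x ^ 2; gaussianReal 0 1] := by
    have := variance_sum_pi (μ := fun _ : Fin n => gaussianReal 0 (n : ℝ≥0)⁻¹)
      (X := fun _ x => x ^ 2) (fun i => hmem1 _)
    rw [show (fun z : Fin n → ℝ => ∑ i, z i ^ 2) = ∑ i, fun z : Fin n → ℝ => z i ^ 2 by
      ext z; simp]
    rw [this]
    simp only [hvar, Finset.sum_const, Finset.card_univ, Fintype.card_fin, nsmul_eq_mul]
    field_simp
  have hmem : MemLp (fun z : Fin n → ℝ => ∑ i, z i ^ 2) 2 μ :=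
    memLp_finsetSum _ fun i _ => hmemi i
  have hch := meas_ge_le_variance_div_sq hmem hδ
  rw [hE, hV] at hch
  have h2 : μ.real {z | δ < |∑ i, z i ^ 2 - 1|} ≤ μ.real {z | δ ≤ |∑ i, z i ^ 2 - 1|} :=
    measureReal_mono fun z (hz : δ < _) => (hz.le : δ ≤ _)
  refine h2.trans ?_
  have h3 := ENNReal.toReal_mono ENNReal.ofReal_ne_top hch
  rw [ENNReal.toReal_ofReal (by have := variance_nonneg (fun x : ℝ => x ^ 2) (gaussianReal 0 1); positivity)] at h3
  refine h3.trans (le_of_eq ?_)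
  field_simp

/-- The iterate is the state; its update sees the noise only through the answer to the query, the
contraction of `Y` being a known shift. -/
lemma powerIter_eq_adaptState (Y Z : Tensor (m + 1) n) (u : EuclideanSpace ℝ (Fin n)) (t : ℕ) :
    powerIter (Y + Z) u t = adaptState (tailMatrix m n) (tailPow m)
      (fun s z => ‖contract Y s + WithLp.toLp 2 z‖⁻¹ • (contract Y s + WithLp.toLp 2 z)) u Z t := by
  induction t with
  | zero => rfl
  | succ t ih =>
    rw [powerIter, adaptState, ← ih, ← ofLp_contract, contract_add]

/-- The overlaps of the contracted noise with fixed directions stay of order `1 / √n` along a fixed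
number of iterations. -/
lemma noiseLaw_overlap_tail (Y : Tensor (m + 1) n) (v : Fin r → EuclideanSpace ℝ (Fin n))
    (hv : ∀ j, ‖v j‖ = 1) {u : EuclideanSpace ℝ (Fin n)} (hu : ‖u‖ ≤ 1) (M : ℕ) {l : ℝ}
    (hl : 0 ≤ l) :
    noiseLaw (m + 1) n {Z | ∃ t < M, ∃ j,
        M * l < |inner ℝ (v j) (contract Z (powerIter (Y + Z) u t))|}
      ≤ ENNReal.ofReal (M * (r * (2 * Real.exp (-(n * l ^ 2 / 2))))) := by
  have hF : Measurable (Function.uncurry fun (s : EuclideanSpace ℝ (Fin n)) (z : Fin n → ℝ) =>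
      ‖contract Y s + WithLp.toLp 2 z‖⁻¹ • (contract Y s + WithLp.toLp 2 z)) := by
    have h : Measurable fun p : EuclideanSpace ℝ (Fin n) × (Fin n → ℝ) =>
        contract Y p.1 + WithLp.toLp 2 p.2 := by
      apply Continuous.measurable
      refine (continuous_contract.comp (continuous_const.prodMk continuous_fst)).add ?_
      exact (PiLp.continuous_toLp 2 _).comp continuous_snd
    exact h.norm.inv.smul h
  have hq : Measurable (tailPow m : EuclideanSpace ℝ (Fin n) → _) := by
    apply Continuous.measurable
    unfold tailPow tpow pureTensor
    refine (PiLp.continuous_toLp 2 _).comp (continuous_pi fun I => ?_)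
    fun_prop
  have h := gaussVec_adaptive_tail (n : ℝ≥0)⁻¹ (tailMatrix m n) tailMatrix_transpose_mul
    (fun j => WithLp.ofLp (v j)) l M (q := tailPow m) u hq hF
    (by rw [norm_tailPow]; exact pow_le_one₀ (norm_nonneg _) hu)
    (fun s z => by
      rw [norm_tailPow]
      refine pow_le_one₀ (norm_nonneg _) ?_
      rw [norm_smul, norm_inv, norm_norm]
      exact inv_mul_le_one)
  have hset : {Z : Tensor (m + 1) n | ∃ t < M, ∃ j,
        M * l < |inner ℝ (v j) (contract Z (powerIter (Y + Z) u t))|}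
      = {Z | ∃ t < M, ∃ j, M * l < |WithLp.ofLp (v j) ⬝ᵥ
          ((tailMatrix m n (tailPow m (adaptState (tailMatrix m n) (tailPow m)
      (fun s z => ‖contract Y s + WithLp.toLp 2 z‖⁻¹ • (contract Y s + WithLp.toLp 2 z))
          u Z t)))ᵀ *ᵥ Z)|} := by
    ext Z
    simp only [Set.mem_ofPred_eq, ← powerIter_eq_adaptState, ← ofLp_contract]
    simp [PiLp.inner_apply, dotProduct, mul_comm]
  rw [hset]
  refine h.trans ?_
  have hB : gaussVec (Fin n) (n : ℝ≥0)⁻¹ {ξ | ∃ j, l < |WithLp.ofLp (v j) ⬝ᵥ ξ|}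
      ≤ ENNReal.ofReal (r * (2 * Real.exp (-(n * l ^ 2 / 2)))) := by
    rw [← ofReal_measureReal]
    apply ENNReal.ofReal_le_ofReal
    rw [Set.ofPred_exists]
    refine (measureReal_iUnion_fintype_le _).trans ?_
    have : ∀ j, (gaussVec (Fin n) (n : ℝ≥0)⁻¹).real {ξ | l < |WithLp.ofLp (v j) ⬝ᵥ ξ|}
        ≤ 2 * Real.exp (-(n * l ^ 2 / 2)) := by
      intro j
      have h1 : WithLp.ofLp (v j) ⬝ᵥ WithLp.ofLp (v j) ≤ 1 := by
        have : WithLp.ofLp (v j) ⬝ᵥ WithLp.ofLp (v j) = ‖v j‖ ^ 2 := by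
          rw [EuclideanSpace.real_norm_sq_eq]; simp [dotProduct, sq]
        rw [this, hv]; norm_num
      refine (gaussVec_real_abs_dotProduct_gt_le _ _ h1 hl).trans (le_of_eq ?_)
      congr 2
      push_cast
      rcases Nat.eq_zero_or_pos n with rfl | hn
      · simp
      · field_simp
    refine (Finset.sum_le_card_nsmul _ _ _ fun j _ => this j).trans ?_
    simp
  rw [ENNReal.ofReal_mul (by positivity), ENNReal.ofReal_natCast]
  gcongr

end NoiseContraction

end SpikedTensor

/-! ### The recursion for the overlaps, and its second phase. -/

namespace SpikedTensor

/-- The overlaps `o t j` of the iterates with the spikes: `R t` is the norm before normalization and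
`z t j` the overlap of the noise. -/
structure OverlapOrbit (r d : ℕ) (M : ℝ) where
  β : Fin r → ℝ
  o : ℕ → Fin r → ℝ
  R : ℕ → ℝ
  z : ℕ → Fin r → ℝ
  step : ∀ t j, o (t + 1) j * R t = β j * o t j ^ (d + 1) + z t j
  R_nonneg : ∀ t, 0 ≤ R t
  R_le : ∀ t, R t ≤ ∑ j, |β j| * |o t j| ^ (d + 1) + M
  z_le : ∀ t j, |z t j| ≤ M

namespace OverlapOrbit

variable {r d : ℕ} {M : ℝ} (O : OverlapOrbit r d M) (i : Fin r)

/-- The ratio of the overlaps with spikes `j` and `i`. -/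
noncomputable def y (t : ℕ) (j : Fin r) : ℝ := O.o t j / O.o t i

/-- The ratio of the strengths of spikes `j` and `i`. -/
noncomputable def γ (j : Fin r) : ℝ := O.β j / O.β i

/-- The part of the update due to spike `i`. -/
noncomputable def s (t : ℕ) : ℝ := O.β i * O.o t i ^ (d + 1)

/-- The relative size of spike `j` in the update. -/
noncomputable def ρ (t : ℕ) (j : Fin r) : ℝ := |O.γ i j| * |O.y i t j| ^ d

variable {O i}

lemma beta_ne {t : ℕ} (h : O.s i t ≠ 0) : O.β i ≠ 0 := left_ne_zero_of_mul h

lemma o_ne {t : ℕ} (h : O.s i t ≠ 0) : O.o t i ≠ 0 := by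
  intro h0; apply h; simp [s, h0]

lemma mul_R {t : ℕ} (h : O.s i t ≠ 0) (j : Fin r) :
    O.o (t + 1) j * O.R t = O.s i t * (O.γ i j * O.y i t j ^ (d + 1) + O.z t j / O.s i t) := by
  have h1 := beta_ne h
  have h2 := o_ne h
  rw [O.step, mul_add, mul_div_cancel₀ _ h, γ, y, s, div_pow]
  field_simp

lemma mul_R_self {t : ℕ} (h : O.s i t ≠ 0) :
    O.o (t + 1) i * O.R t = O.s i t * (1 + O.z t i / O.s i t) := by
  rw [mul_R h i, γ, y, div_self (beta_ne h), div_self (o_ne h)]; simp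

/-- Ratios do not see the normalization: the noiseless map is perturbed only by the noise relative
to the signal. -/
lemma y_succ {t : ℕ} (h : O.s i t ≠ 0) (h1 : 1 + O.z t i / O.s i t ≠ 0) (j : Fin r) :
    O.y i (t + 1) j
      = (O.γ i j * O.y i t j ^ (d + 1) + O.z t j / O.s i t) / (1 + O.z t i / O.s i t) := by
  have h2 := mul_R_self h
  have h3 := mul_R h j
  have hR : O.R t ≠ 0 := by
    intro h0; rw [h0, mul_zero] at h2
    exact mul_ne_zero h h1 h2.symm
  rw [y, ← mul_div_mul_right _ _ hR, h2, h3, mul_div_mul_left _ _ h]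

lemma R_le_mul {t : ℕ} (h : O.s i t ≠ 0) :
    O.R t ≤ |O.s i t| * (∑ j, O.ρ i t j * |O.y i t j| + M / |O.s i t|) := by
  refine (O.R_le t).trans (le_of_eq ?_)
  have h1 := beta_ne h
  have h2 := o_ne h
  have h3 : |O.s i t| ≠ 0 := abs_ne_zero.2 h
  rw [mul_add, mul_div_cancel₀ _ h3, Finset.mul_sum]
  congr 1
  refine Finset.sum_congr rfl fun j _ => ?_
  simp only [s, ρ, γ, y, abs_mul, abs_div, abs_pow, div_pow]
  have h1' := abs_ne_zero.2 h1
  have h2' := abs_ne_zero.2 h2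
  field_simp
  ring

lemma le_abs_o_succ (hM : 0 < M) {t : ℕ} (h : O.s i t ≠ 0) :
    |1 + O.z t i / O.s i t| / (∑ j, O.ρ i t j * |O.y i t j| + M / |O.s i t|)
      ≤ |O.o (t + 1) i| ∨ 1 + O.z t i / O.s i t = 0 := by
  by_cases h1 : 1 + O.z t i / O.s i t = 0
  · exact Or.inr h1
  left
  have h2 := mul_R_self h
  have h3 : 0 < |O.s i t| := abs_pos.2 h
  have h4 : 0 ≤ ∑ j, O.ρ i t j * |O.y i t j| := Finset.sum_nonneg fun j _ => by
    unfold ρ; positivity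
  have h5 : 0 < ∑ j, O.ρ i t j * |O.y i t j| + M / |O.s i t| := by positivity
  rw [div_le_iff₀ h5]
  have h6 : |O.o (t + 1) i| * O.R t = |O.s i t| * |1 + O.z t i / O.s i t| := by
    rw [← abs_mul, ← h2, abs_mul, abs_of_nonneg (O.R_nonneg t)]
  have h7 := mul_le_mul_of_nonneg_left (R_le_mul h) (abs_nonneg (O.o (t + 1) i))
  rw [h6] at h7
  nlinarith

lemma sum_rho_mul (h : O.β i ≠ 0) {t : ℕ} (ho : O.o t i ≠ 0) :
    ∑ j, O.ρ i t j * |O.y i t j| = 1 + ∑ j ∈ Finset.univ.erase i, O.ρ i t j * |O.y i t j| := by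
  rw [← Finset.add_sum_erase _ _ (Finset.mem_univ i)]
  congr 1
  simp [ρ, γ, y, div_self h, div_self ho]

/-- The invariant of the second phase of the iteration: spike `i` dominates, and every competing
ratio is below the noise level `A` or decays at the noiseless rate. -/
def Dominates (O : OverlapOrbit r d M) (i : Fin r) (A Q : ℝ) (t : ℕ) : Prop :=
  1 / 2 ≤ |O.o t i| ∧ ∀ j, j ≠ i → |O.y i t j| ≤ 1 ∧
    (|O.y i t j| ≤ A ∨ 3 * O.ρ i t j ≤ Q ^ ((d + 1) ^ t))

/-- Quantitative requirements under which `Dominates` propagates. -/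
structure PhaseTwo (O : OverlapOrbit r d M) (i : Fin r) (A K Q : ℝ) (t₁ : ℕ) : Prop where
  M_pos : 0 < M
  d_pos : 0 < d
  K_one : 1 ≤ K
  beta_ne' : O.β i ≠ 0
  A_eq : A = 8 * (M * 2 ^ (d + 1)) / |O.β i|
  gamma_le : ∀ j, |O.γ i j| ≤ K
  KA_le : K * A ≤ 1 / (8 * r)
  Q_nonneg : 0 ≤ Q
  Q_one : Q ≤ 1
  Q_le : Q ^ ((d + 1) ^ t₁) ≤ 1 / (8 * r)

variable {A K Q : ℝ} {t₁ : ℕ}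

lemma PhaseTwo.A_pos (P : PhaseTwo O i A K Q t₁) : 0 < A := by
  rw [P.A_eq]
  have := P.M_pos
  have := abs_pos.2 P.beta_ne'
  positivity

lemma PhaseTwo.r_one (_ : PhaseTwo O i A K Q t₁) : (1 : ℝ) ≤ r := by
  exact_mod_cast Nat.one_le_iff_ne_zero.2 fun h => by subst h; exact i.elim0

lemma PhaseTwo.A_le (P : PhaseTwo O i A K Q t₁) : A ≤ 1 / 8 := by
  have h1 := P.KA_le
  have h2 := P.A_pos
  have h3 := P.K_one
  have h4 : 1 / (8 * (r : ℝ)) ≤ 1 / 8 := by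
    have := P.r_one
    gcongr; linarith
  nlinarith

/-- Both alternatives of the invariant lead here: below the noise level through `KA_le`, where `d >
0` turns `|y| ^ d` into at most `|y|`; otherwise through the decay accumulated since time `t₁`. -/
lemma PhaseTwo.rho_le (P : PhaseTwo O i A K Q t₁) {t : ℕ} (ht : t₁ ≤ t) (h : Dominates O i A Q t)
    {j : Fin r} (hj : j ≠ i) : O.ρ i t j ≤ 1 / (8 * r) := by
  rcases (h.2 j hj).2 with h1 | h1
  · refine le_trans ?_ P.KA_le
    have h2 : |O.y i t j| ^ d ≤ |O.y i t j| ^ 1 :=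
      pow_le_pow_of_le_one (abs_nonneg _) (h.2 j hj).1 P.d_pos
    rw [pow_one] at h2
    have := P.gamma_le j
    have := P.K_one
    unfold ρ
    gcongr
    exact h2.trans h1
  · have h2 : Q ^ ((d + 1) ^ t) ≤ Q ^ ((d + 1) ^ t₁) :=
      pow_le_pow_of_le_one P.Q_nonneg P.Q_one (Nat.pow_le_pow_right (Nat.succ_pos d) ht)
    have h3 : 0 ≤ O.ρ i t j := by unfold ρ; positivity
    linarith [P.Q_le]

/-- Explains the choice of `A`: an overlap of at least `1 / 2` makes the signal at least `|β i| / 2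
^ (d + 1)`, and `A` is eight times the resulting noise-to-signal ratio. -/
lemma PhaseTwo.s_bound (P : PhaseTwo O i A K Q t₁) {t : ℕ} (h : Dominates O i A Q t) :
    O.s i t ≠ 0 ∧ M / |O.s i t| ≤ A / 8 := by
  have h0 : O.o t i ≠ 0 := by
    intro h0; have := h.1; rw [h0] at this; norm_num at this
  have hs : O.s i t ≠ 0 := mul_ne_zero P.beta_ne' (pow_ne_zero _ h0)
  refine ⟨hs, ?_⟩
  have hb := abs_pos.2 P.beta_ne'
  rw [P.A_eq]
  have h1 : (1 / 2 : ℝ) ^ (d + 1) ≤ |O.o t i| ^ (d + 1) := by gcongr; exact h.1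
  have h2 : |O.s i t| = |O.β i| * |O.o t i| ^ (d + 1) := by rw [s, abs_mul, abs_pow]
  have h3 : |O.β i| * (1 / 2 : ℝ) ^ (d + 1) ≤ |O.s i t| := by rw [h2]; gcongr
  have hM := P.M_pos
  calc M / |O.s i t| ≤ M / (|O.β i| * (1 / 2 : ℝ) ^ (d + 1)) := by gcongr
    _ = _ := by rw [one_div, inv_pow]; field_simp

lemma PhaseTwo.zeta_le (P : PhaseTwo O i A K Q t₁) {t : ℕ} (h : Dominates O i A Q t) (j : Fin r) :
    |O.z t j / O.s i t| ≤ A / 8 := by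
  rw [abs_div]
  exact (div_le_div_of_nonneg_right (O.z_le t j) (abs_nonneg _)).trans (P.s_bound h).2

lemma PhaseTwo.one_add_ne (P : PhaseTwo O i A K Q t₁) {t : ℕ} (h : Dominates O i A Q t) :
    63 / 64 ≤ 1 + O.z t i / O.s i t := by
  have h1 := neg_le_of_abs_le (P.zeta_le h i)
  linarith [P.A_le]

lemma PhaseTwo.y_succ_le (P : PhaseTwo O i A K Q t₁) {t : ℕ} (h : Dominates O i A Q t)
    (j : Fin r) : |O.y i (t + 1) j| ≤ 2 * (O.ρ i t j * |O.y i t j| + A / 8) := by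
  have h1 := P.one_add_ne h
  rw [y_succ (P.s_bound h).1 (by linarith) j, abs_div, abs_of_pos (lt_of_lt_of_le (by norm_num) h1),
    div_le_iff₀ (by linarith)]
  have h2 : |O.γ i j * O.y i t j ^ (d + 1) + O.z t j / O.s i t|
      ≤ O.ρ i t j * |O.y i t j| + A / 8 := by
    refine (abs_add_le _ _).trans ?_
    gcongr
    · rw [abs_mul, abs_pow, ρ]; exact le_of_eq (by ring)
    · exact P.zeta_le h j
  have h3 : 0 ≤ O.ρ i t j * |O.y i t j| + A / 8 := (abs_nonneg _).trans h2
  nlinarith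

/-- The invariant has room to spare. The competitors take at most `1 / 8` of the update and the
relative noise is at most `A / 8`, so the overlap with spike `i` stays large and a ratio of at most
`A` returns below `A / 2`. A ratio that remains above `A` is not driven by noise, so it obeys the
noiseless bound up to a factor `3`; this factor is built into the invariant, which reproduces itself
as `3 ρ' ≤ (3 ρ) ^ (d + 1)`. -/
lemma PhaseTwo.succ (P : PhaseTwo O i A K Q t₁) {t : ℕ} (ht : t₁ ≤ t) (h : Dominates O i A Q t) :
    Dominates O i A Q (t + 1) := by
  have hA := P.A_pos
  have hA8 := P.A_le
  have hr := P.r_one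
  have hr8 : 1 / (8 * (r : ℝ)) ≤ 1 / 8 := by gcongr; linarith
  have hs := P.s_bound h
  have ho := o_ne hs.1
  have h1 := P.one_add_ne h
  have hρ : ∀ j, j ≠ i → O.ρ i t j * |O.y i t j| ≤ 1 / (8 * r) := fun j hj => by
    have h2 := P.rho_le ht h hj
    have h3 := (h.2 j hj).1
    have h4 : 0 ≤ O.ρ i t j := by unfold ρ; positivity
    have h5 := abs_nonneg (O.y i t j)
    nlinarith
  refine ⟨?_, fun j hj => ⟨?_, ?_⟩⟩
  · rcases le_abs_o_succ P.M_pos hs.1 with h2 | h2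
    · refine le_trans ?_ h2
      have h3 : ∑ j ∈ Finset.univ.erase i, O.ρ i t j * |O.y i t j| ≤ 1 / 8 := by
        calc _ ≤ (Finset.univ.erase i).card • (1 / (8 * (r : ℝ))) :=
              Finset.sum_le_card_nsmul _ _ _ fun j hj => hρ j (Finset.ne_of_mem_erase hj)
          _ ≤ (r : ℝ) * (1 / (8 * (r : ℝ))) := by
              rw [nsmul_eq_mul]
              gcongr
              exact (Finset.card_le_univ _).trans_eq (Fintype.card_fin r)
          _ = 1 / 8 := by field_simp
      have h4 : 0 ≤ ∑ j ∈ Finset.univ.erase i, O.ρ i t j * |O.y i t j| :=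
        Finset.sum_nonneg fun j _ => by unfold ρ; positivity
      have h5 : 0 ≤ M / |O.s i t| := by have := P.M_pos; positivity
      rw [sum_rho_mul P.beta_ne' ho, abs_of_pos (by linarith : 0 < 1 + O.z t i / O.s i t),
        le_div_iff₀ (by linarith)]
      linarith [hs.2]
    · linarith
  · have := P.y_succ_le h j
    linarith [hρ j hj]
  · have h2 := P.y_succ_le h j
    have h4 : 0 ≤ O.ρ i t j := by unfold ρ; positivity
    rcases (h.2 j hj).2 with h3 | h3
    · left
      have h5 : O.ρ i t j * |O.y i t j| ≤ 1 / 8 * A := by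
        have := P.rho_le ht h hj
        gcongr
        linarith
      linarith
    · by_cases h5 : |O.y i (t + 1) j| ≤ A
      · exact Or.inl h5
      right
      push Not at h5
      -- The noise contributes `A / 4`, less than a quarter of the left side.
      have h6 : |O.y i (t + 1) j| ≤ 3 * (O.ρ i t j * |O.y i t j|) := by
        have : 0 ≤ O.ρ i t j * |O.y i t j| := by positivity
        linarith
      calc 3 * O.ρ i (t + 1) j = 3 * (|O.γ i j| * |O.y i (t + 1) j| ^ d) := rfl
        _ ≤ 3 * (|O.γ i j| * (3 * (O.ρ i t j * |O.y i t j|)) ^ d) := by gcongr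
        _ = (3 * O.ρ i t j) ^ (d + 1) := by
            simp only [mul_pow, pow_succ (3 : ℝ), pow_succ (O.ρ i t j)]
            conv_rhs => rw [show O.ρ i t j ^ d * O.ρ i t j
              = O.ρ i t j ^ d * (|O.γ i j| * |O.y i t j| ^ d) from rfl]
            ring
        _ ≤ (Q ^ ((d + 1) ^ t)) ^ (d + 1) := by gcongr
        _ = Q ^ ((d + 1) ^ (t + 1)) := by rw [← pow_mul, pow_succ (d + 1)]

lemma PhaseTwo.dominates (P : PhaseTwo O i A K Q t₁) (h : Dominates O i A Q t₁) {t : ℕ}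
    (ht : t₁ ≤ t) : Dominates O i A Q t := by
  induction t, ht using Nat.le_induction with
  | base => exact h
  | succ t ht ih => exact P.succ ht ih

lemma PhaseTwo.rho_mul_y_le (P : PhaseTwo O i A K Q t₁) {t : ℕ} (ht : t₁ ≤ t)
    (h : Dominates O i A Q t) {j : Fin r} (hj : j ≠ i) :
    O.ρ i t j * |O.y i t j| ≤ A + Q ^ ((d + 1) ^ t) := by
  have h4 : 0 ≤ O.ρ i t j := by unfold ρ; positivity
  have h5 : 0 ≤ Q ^ ((d + 1) ^ t) := pow_nonneg P.Q_nonneg _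
  have h6 := (h.2 j hj).1
  have h7 := abs_nonneg (O.y i t j)
  rcases (h.2 j hj).2 with h3 | h3
  · have h8 := P.rho_le ht h hj
    have hr8 : 1 / (8 * (r : ℝ)) ≤ 1 / 8 := by have := P.r_one; gcongr; linarith
    nlinarith
  · have := P.A_pos
    nlinarith

/-- One step after time `t`, the competing spikes contribute only at second order. -/
lemma PhaseTwo.rho_mul_y_succ_le (P : PhaseTwo O i A K Q t₁) {t : ℕ} (ht : t₁ ≤ t)
    (h : Dominates O i A Q t) {j : Fin r} (hj : j ≠ i) :
    O.ρ i (t + 1) j * |O.y i (t + 1) j|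
      ≤ K * A ^ 2 + (Q ^ ((d + 1) ^ t)) ^ (d + 1) * (4 * A + 2 * Q ^ ((d + 1) ^ t)) := by
  have h' := P.succ ht h
  have hA := P.A_pos
  have h4 : 0 ≤ O.ρ i (t + 1) j := by unfold ρ; positivity
  have h5 : 0 ≤ Q ^ ((d + 1) ^ t) := pow_nonneg P.Q_nonneg _
  have h7 := abs_nonneg (O.y i (t + 1) j)
  have hK := P.K_one
  rcases (h'.2 j hj).2 with h3 | h3
  · have h8 : O.ρ i (t + 1) j ≤ K * A := by
      have h2 : |O.y i (t + 1) j| ^ d ≤ |O.y i (t + 1) j| ^ 1 :=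
        pow_le_pow_of_le_one (abs_nonneg _) (h'.2 j hj).1 P.d_pos
      rw [pow_one] at h2
      have := P.gamma_le j
      unfold ρ
      gcongr
      exact h2.trans h3
    have : O.ρ i (t + 1) j * |O.y i (t + 1) j| ≤ K * A * A := by gcongr
    have h9 : 0 ≤ (Q ^ ((d + 1) ^ t)) ^ (d + 1) * (4 * A + 2 * Q ^ ((d + 1) ^ t)) := by positivity
    nlinarith
  · have h8 : |O.y i (t + 1) j| ≤ 4 * A + 2 * Q ^ ((d + 1) ^ t) := by
      linarith [P.y_succ_le h j, P.rho_mul_y_le ht h hj]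
    rw [pow_succ (d + 1), pow_mul] at h3
    have h9 : O.ρ i (t + 1) j ≤ (Q ^ ((d + 1) ^ t)) ^ (d + 1) := by linarith
    have : O.ρ i (t + 1) j * |O.y i (t + 1) j|
      ≤ (Q ^ ((d + 1) ^ t)) ^ (d + 1) * (4 * A + 2 * Q ^ ((d + 1) ^ t)) := by gcongr
    nlinarith [sq_nonneg A]

end OverlapOrbit

end SpikedTensor

/-! ### The first phase: growth from random overlaps, by compactness. -/

namespace SpikedTensor

namespace OverlapOrbit

variable {r d : ℕ} {M : ℝ} {i : Fin r} {ι : Type*} {l : Filter ι} {N : ι → ℝ}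
  {O : ι → OverlapOrbit r d M}

/-- The signal beats the overlap of the noise by a factor of order `N ^ (ε / 2)`. -/
lemma tendsto_zeta {ε c : ℝ} (hε : 0 < ε) (hc : 0 < c) (hN : Tendsto N l atTop) {t : ℕ}
    {j : Fin r} (hs : ∀ᶠ p in l, c * N p ^ (-1 / 2 + ε) ≤ |(O p).s i t|)
    (hz : ∀ᶠ p in l, |(O p).z t j| ≤ N p ^ (-1 / 2 + ε / 2)) :
    Tendsto (fun p => (O p).z t j / (O p).s i t) l (𝓝 0) := by
  have h1 : Tendsto (fun p => c⁻¹ * N p ^ (-(ε / 2))) l (𝓝 0) := by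
    simpa using ((tendsto_rpow_neg_atTop (by positivity : 0 < ε / 2)).comp hN).const_mul c⁻¹
  refine squeeze_zero_norm' ?_ h1
  filter_upwards [hs, hz, hN.eventually_gt_atTop 0] with p h2 h3 h4
  have h5 : 0 < N p ^ (-1 / 2 + ε) := Real.rpow_pos_of_pos h4 _
  rw [Real.norm_eq_abs, abs_div]
  calc _ ≤ N p ^ (-1 / 2 + ε / 2) / (c * N p ^ (-1 / 2 + ε)) := by gcongr
    _ = c⁻¹ * (N p ^ (-1 / 2 + ε / 2) / N p ^ (-1 / 2 + ε)) := by field_simp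
    _ = _ := by rw [← Real.rpow_sub h4]; ring_nf

lemma tendsto_y_succ {t : ℕ} {Y Γ : Fin r → ℝ} (hs : ∀ᶠ p in l, (O p).s i t ≠ 0)
    (hζ : ∀ j, Tendsto (fun p => (O p).z t j / (O p).s i t) l (𝓝 0))
    (hγ : ∀ j, Tendsto (fun p => (O p).γ i j) l (𝓝 (Γ j)))
    (hy : ∀ j, Tendsto (fun p => (O p).y i t j) l (𝓝 (Y j))) (j : Fin r) :
    Tendsto (fun p => (O p).y i (t + 1) j) l (𝓝 (Γ j * Y j ^ (d + 1))) := by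
  have h1 : Tendsto (fun p => 1 + (O p).z t i / (O p).s i t) l (𝓝 1) := by
    simpa using (hζ i).const_add 1
  have h2 := (((hγ j).mul ((hy j).pow (d + 1))).add (hζ j)).div h1 one_ne_zero
  simp only [add_zero, div_one] at h2
  refine h2.congr' ?_
  filter_upwards [hs, h1.eventually_ne one_ne_zero] with p h3 h4
  exact (y_succ h3 h4 j).symm

/-- The norm before normalization is at most `C |s| + M`, so the next overlap has at least the order
of the signal, as long as that order does not exceed one. -/
lemma exists_le_abs_o_succ (hM : 0 < M) {t : ℕ} {c e C : ℝ} (hc : 0 < c) (he : e ≤ 0)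
    (hN : Tendsto N l atTop) (hs : ∀ᶠ p in l, c * N p ^ e ≤ |(O p).s i t|)
    (hζ : Tendsto (fun p => (O p).z t i / (O p).s i t) l (𝓝 0)) (hC : 0 < C)
    (hsum : ∀ᶠ p in l, ∑ j, (O p).ρ i t j * |(O p).y i t j| ≤ C) :
    ∃ c' > 0, ∀ᶠ p in l, c' * N p ^ e ≤ |(O p).o (t + 1) i| := by
  refine ⟨1 / 2 / (C + M / c), by positivity, ?_⟩
  have h1 : Tendsto (fun p => |1 + (O p).z t i / (O p).s i t|) l (𝓝 1) := by
    simpa using (hζ.const_add 1).abs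
  filter_upwards [hs, hsum, h1.eventually_const_lt (show (1 / 2 : ℝ) < 1 by norm_num),
    hN.eventually_ge_atTop 1] with p h2 h3 h4 h5
  have hNe : 0 < N p ^ e := Real.rpow_pos_of_pos (by linarith) _
  have hNe1 : N p ^ e ≤ 1 := Real.rpow_le_one_of_one_le_of_nonpos h5 he
  have hs0 : (O p).s i t ≠ 0 := by
    rw [← abs_pos]; exact lt_of_lt_of_le (by positivity) h2
  rcases le_abs_o_succ hM hs0 with h6 | h6
  · refine le_trans ?_ h6
    have h7 : 0 ≤ ∑ j, (O p).ρ i t j * |(O p).y i t j| := Finset.sum_nonneg fun j _ => by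
      unfold ρ; positivity
    have h8 : 0 < M / |(O p).s i t| := by have := abs_pos.2 hs0; positivity
    have h9 : M / |(O p).s i t| ≤ M / (c * N p ^ e) := by gcongr
    rw [le_div_iff₀ (by positivity)]
    calc 1 / 2 / (C + M / c) * N p ^ e * (∑ j, (O p).ρ i t j * |(O p).y i t j| + M / |(O p).s i t|)
        ≤ 1 / 2 / (C + M / c) * N p ^ e * (C + M / (c * N p ^ e)) := by gcongr
      _ = 1 / 2 / (C + M / c) * (N p ^ e * C + M / c) := by field_simp
      _ ≤ 1 / 2 / (C + M / c) * (1 * C + M / c) := by gcongr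
      _ = 1 / 2 := by field_simp
      _ ≤ _ := h4.le
  · rw [h6] at h4; norm_num at h4

lemma exists_le_abs_s_of_le_abs_o {t : ℕ} {c e ε K : ℝ} (hc : 0 < c) (hK : 0 < K)
    (hN : Tendsto N l atTop) (ho : ∀ᶠ p in l, c * N p ^ e ≤ |(O p).o t i|)
    (hβ : ∀ᶠ p in l, N p ^ ((d : ℝ) / 2 + ε) ≤ K * |(O p).β i|) :
    ∃ c' > 0, ∀ᶠ p in l, c' * N p ^ ((d : ℝ) / 2 + ε + e * (d + 1)) ≤ |(O p).s i t| := by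
  refine ⟨c ^ (d + 1) / K, by positivity, ?_⟩
  filter_upwards [ho, hβ, hN.eventually_gt_atTop 0] with p h1 h2 h3
  have h4 : (c * N p ^ e) ^ (d + 1) ≤ |(O p).o t i| ^ (d + 1) := by gcongr
  rw [s, abs_mul, abs_pow]
  have h5 : (N p ^ e) ^ (d + 1) = N p ^ (e * (d + 1)) := by
    rw [← Real.rpow_natCast, ← Real.rpow_mul h3.le]; push_cast; ring_nf
  calc _ = N p ^ ((d : ℝ) / 2 + ε) / K * (c * N p ^ e) ^ (d + 1) := by
        rw [mul_pow, h5, Real.rpow_add h3 ((d : ℝ) / 2 + ε)]; ring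
    _ ≤ |(O p).β i| * |(O p).o t i| ^ (d + 1) := by
        gcongr
        rw [div_le_iff₀ hK]; linarith

/-- Along an ultrafilter bounded quantities converge, so no subsequences need to be extracted. -/
lemma exists_tendsto_of_bounded (g : Ultrafilter ι) {f : ι → ℝ} {C : ℝ}
    (h : ∀ᶠ p in (g : Filter ι), |f p| ≤ C) : ∃ x, |x| ≤ C ∧ Tendsto f g (𝓝 x) := by
  have h1 : ((g.map f : Ultrafilter ℝ) : Filter ℝ) ≤ 𝓟 (Set.Icc (-C) C) := by
    rw [le_principal_iff]
    exact h.mono fun p hp => ⟨by linarith [neg_le_of_abs_le hp], le_of_abs_le hp⟩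
  obtain ⟨x, hx, hx'⟩ := isCompact_Icc.ultrafilter_le_nhds _ h1
  exact ⟨x, abs_le.2 hx, hx'⟩

/-- The growth exponent of the overlap with the selected spike. -/
noncomputable def growthExp (ε : ℝ) (t : ℕ) : ℝ := min (-1 / 2 + ε * (t + 1)) 0

/-- The noiseless limit of the overlap ratios. -/
def limitRatio (d : ℕ) (Γ Y : Fin r → ℝ) : ℕ → Fin r → ℝ
  | 0 => Y
  | t + 1 => fun j => Γ j * limitRatio d Γ Y t j ^ (d + 1)

/-- In the noiseless recursion `|Γ| |Y| ^ d` is raised to the power `d + 1` at each step, which is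
the source of the doubly exponential selection. -/
lemma limitRatio_bound {κ q : ℝ} (hq : 0 ≤ q) (hq1 : q ≤ 1) {Γ Y : Fin r → ℝ}
    {j : Fin r} (hY : |Y j| ≤ κ) (h : |Γ j| * |Y j| ^ d ≤ q) (t : ℕ) :
    |limitRatio d Γ Y t j| ≤ κ ∧ |Γ j| * |limitRatio d Γ Y t j| ^ d ≤ q ^ ((d + 1) ^ t) ∧
      |limitRatio d Γ Y (t + 1) j| ≤ q ^ ((d + 1) ^ t) * κ := by
  have key : ∀ t, |limitRatio d Γ Y t j| ≤ κ → |Γ j| * |limitRatio d Γ Y t j| ^ d ≤ q ^ ((d + 1) ^ t)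
      → |limitRatio d Γ Y (t + 1) j| ≤ q ^ ((d + 1) ^ t) * κ := by
    intro t h1 h2
    rw [limitRatio, abs_mul, abs_pow, pow_succ, ← mul_assoc]
    gcongr
  induction t with
  | zero =>
    have h0 : |Γ j| * |limitRatio d Γ Y 0 j| ^ d ≤ q ^ ((d + 1) ^ 0) := by
      simpa [limitRatio] using h
    exact ⟨hY, h0, key 0 hY h0⟩
  | succ t ih =>
    have h1 : |limitRatio d Γ Y (t + 1) j| ≤ κ := by
      refine ih.2.2.trans ?_
      have := pow_le_one₀ (n := (d + 1) ^ t) hq hq1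
      have := (abs_nonneg _).trans hY
      nlinarith
    have h2 : |Γ j| * |limitRatio d Γ Y (t + 1) j| ^ d ≤ q ^ ((d + 1) ^ (t + 1)) := by
      calc _ = (|Γ j| * |limitRatio d Γ Y t j| ^ d) ^ (d + 1) := by
            rw [limitRatio, abs_mul, abs_pow, mul_pow]; ring
        _ ≤ (q ^ ((d + 1) ^ t)) ^ (d + 1) := pow_le_pow_left₀ (by positivity) ih.2.1 _
        _ = _ := by rw [← pow_mul, pow_succ (d + 1)]
    exact ⟨h1, h2, key _ h1 h2⟩

/-- Assumptions on the first phase of the iteration, up to time `t₁`. -/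
structure PhaseOne (l : Filter ι) (O : ι → OverlapOrbit r d M) (i : Fin r) (N : ι → ℝ)
    (κ ε : ℝ) (t₁ : ℕ) : Prop where
  M_pos : 0 < M
  N_atTop : Tendsto N l atTop
  beta_ge : ∀ᶠ p in l, N p ^ ((d : ℝ) / 2 + ε) ≤ κ ^ d * |(O p).β i|
  gamma_le : ∀ᶠ p in l, ∀ j, |(O p).γ i j| ≤ κ ^ d
  o_ge : ∀ᶠ p in l, 1 / √(κ * N p) ≤ |(O p).o 0 i|
  y_le : ∀ᶠ p in l, ∀ j, |(O p).y i 0 j| ≤ κ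
  rho_le : ∀ᶠ p in l, ∀ j, j ≠ i → (O p).ρ i 0 j ≤ 1 - 1 / κ
  z_le' : ∀ᶠ p in l, ∀ t < t₁, ∀ j, |(O p).z t j| ≤ N p ^ (-1 / 2 + ε / 2)

variable {κ ε : ℝ} {t₁ : ℕ}

/-- From signal exponent `e` the next one is `d / 2 + ε + e (d + 1)`, which is at least `e + ε`
because `e ≥ -1 / 2`; it starts at `-1 / 2 + ε` and is capped at `0`. The noise stays negligible
relative to the signal, so the ratios follow the noiseless recursion in the limit. -/
lemma PhaseOne.growth (P : PhaseOne l O i N κ ε t₁) (hκ : 1 ≤ κ) (hε : 0 < ε)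
    (hε2 : ε ≤ 1 / 2) {Γ Y : Fin r → ℝ}
    (hγ : ∀ j, Tendsto (fun p => (O p).γ i j) l (𝓝 (Γ j)))
    (hy : ∀ j, Tendsto (fun p => (O p).y i 0 j) l (𝓝 (Y j))) {t : ℕ} (ht : t ≤ t₁) :
    (∃ c > 0, ∀ᶠ p in l, c * N p ^ growthExp ε t ≤ |(O p).s i t|) ∧
      (t = 0 ∨ ∃ c > 0, ∀ᶠ p in l, c * N p ^ growthExp ε (t - 1) ≤ |(O p).o t i|) ∧
      ∀ j, Tendsto (fun p => (O p).y i t j) l (𝓝 (limitRatio d Γ Y t j)) := by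
  have hK : 0 < κ ^ d := by positivity
  have mono : ∀ {a b c : ℝ} {f : ι → ℝ}, 0 < c → b ≤ a → (∀ᶠ p in l, c * N p ^ a ≤ f p) →
      ∀ᶠ p in l, c * N p ^ b ≤ f p := by
    intro a b c f hc hab h
    filter_upwards [h, P.N_atTop.eventually_ge_atTop 1] with p h1 h2
    refine le_trans ?_ h1
    gcongr
  induction t with
  | zero =>
    refine ⟨?_, Or.inl rfl, hy⟩
    have h0 : ∀ᶠ p in l, (√κ)⁻¹ * N p ^ (-1 / 2 : ℝ) ≤ |(O p).o 0 i| := by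
      filter_upwards [P.o_ge, P.N_atTop.eventually_gt_atTop 0] with p h1 h2
      refine le_trans (le_of_eq ?_) h1
      rw [Real.sqrt_mul (by linarith), one_div, mul_inv, Real.sqrt_eq_rpow (N p),
        ← Real.rpow_neg h2.le]
      norm_num
    obtain ⟨c, hc, h⟩ := exists_le_abs_s_of_le_abs_o (by positivity) hK P.N_atTop h0 P.beta_ge
    refine ⟨c, hc, mono hc ?_ h⟩
    refine (min_le_left _ _).trans (le_of_eq ?_)
    push_cast; ring
  | succ t ih =>
    obtain ⟨⟨c, hc, hs⟩, -, hyt⟩ := ih (by omega)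
    have he : growthExp ε t ≤ 0 := min_le_right _ _
    have hsε : ∀ᶠ p in l, c * N p ^ (-1 / 2 + ε) ≤ |(O p).s i t| := by
      refine mono hc (le_min ?_ (by linarith)) hs
      have : (0 : ℝ) ≤ ε * t := by positivity
      linarith
    have hζ : ∀ j, Tendsto (fun p => (O p).z t j / (O p).s i t) l (𝓝 0) := fun j =>
      tendsto_zeta hε hc P.N_atTop hsε (P.z_le'.mono fun p h => h t (by omega) j)
    have hs0 : ∀ᶠ p in l, (O p).s i t ≠ 0 := by
      filter_upwards [hs, P.N_atTop.eventually_gt_atTop 0] with p h1 h2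
      rw [← abs_pos]
      exact lt_of_lt_of_le (mul_pos hc (Real.rpow_pos_of_pos h2 _)) h1
    have hsum : Tendsto (fun p => ∑ j, (O p).ρ i t j * |(O p).y i t j|) l
        (𝓝 (∑ j, |Γ j| * |limitRatio d Γ Y t j| ^ d * |limitRatio d Γ Y t j|)) :=
      tendsto_finsetSum _ fun j _ => ((hγ j).abs.mul ((hyt j).abs.pow d)).mul (hyt j).abs
    set C := ∑ j, |Γ j| * |limitRatio d Γ Y t j| ^ d * |limitRatio d Γ Y t j|
    have hC : 0 ≤ C := Finset.sum_nonneg fun j _ => by positivity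
    obtain ⟨c₁, hc₁, ho⟩ := exists_le_abs_o_succ P.M_pos hc he P.N_atTop hs (hζ i)
      (by positivity : 0 < C + 1) (hsum.eventually_le_const (lt_add_one C))
    obtain ⟨c₂, hc₂, hs'⟩ := exists_le_abs_s_of_le_abs_o hc₁ hK P.N_atTop ho P.beta_ge
    refine ⟨⟨c₂, hc₂, mono hc₂ ?_ hs'⟩, Or.inr ⟨c₁, hc₁, by simpa using ho⟩,
      tendsto_y_succ hs0 hζ hγ hyt⟩
    have h1 : growthExp ε (t + 1) ≤ growthExp ε t + ε := by
      unfold growthExp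
      rw [← min_add_add_right]
      refine min_le_min (le_of_eq ?_) (by linarith)
      push_cast; ring
    have h2 : -1 / 2 ≤ growthExp ε t :=
      le_min (by have : (0 : ℝ) ≤ ε * (t + 1) := by positivity
                 linarith) (by norm_num)
    have : 0 ≤ d * (growthExp ε t + 1 / 2) := mul_nonneg (Nat.cast_nonneg d) (by linarith)
    linarith

/-- At the end of the first phase, spike `i` dominates. -/
lemma PhaseOne.eventually_ultrafilter {g : Ultrafilter ι} (P : PhaseOne g O i N κ ε t₁)
    (hκ : 1 ≤ κ) (hε : 0 < ε) (hε2 : ε ≤ 1 / 2) {Q : ℝ}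
    (h1 : 1 / 2 ≤ ε * ((t₁ : ℝ) - 1)) (h2 : 2 ≤ t₁)
    (h3 : r * (κ * (1 - 1 / κ) ^ ((d + 1) ^ (t₁ - 1))) < 1)
    (h4 : 3 * (1 - 1 / κ) ^ ((d + 1) ^ t₁) < Q ^ ((d + 1) ^ t₁)) :
    ∀ᶠ p in (g : Filter ι), 1 / 2 ≤ |(O p).o t₁ i| ∧ ∀ j, j ≠ i → |(O p).y i t₁ j| ≤ 1 ∧
      3 * (O p).ρ i t₁ j ≤ Q ^ ((d + 1) ^ t₁) := by
  have hK : 0 < κ ^ d := by positivity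
  have hq0 : 0 ≤ 1 - 1 / κ := by
    rw [sub_nonneg, div_le_one (by linarith)]; exact hκ
  have hq1 : 1 - 1 / κ ≤ 1 := by
    have : 0 ≤ 1 / κ := by positivity
    linarith
  have hr : (1 : ℝ) ≤ r := by
    exact_mod_cast Nat.one_le_iff_ne_zero.2 fun h => by subst h; exact i.elim0
  choose Γ _ hγ using fun j => exists_tendsto_of_bounded g (P.gamma_le.mono fun p h => h j)
  choose Y hY hy using fun j => exists_tendsto_of_bounded g (P.y_le.mono fun p h => h j)
  have hρ0 : ∀ j, j ≠ i → |Γ j| * |Y j| ^ d ≤ 1 - 1 / κ := fun j hj =>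
    le_of_tendsto ((hγ j).abs.mul ((hy j).abs.pow d)) (P.rho_le.mono fun p h => h j hj)
  have hb := fun j (hj : j ≠ i) => limitRatio_bound (d := d) hq0 hq1 (hY j) (hρ0 j hj)
  -- At time `t + 1` the overlap is bounded below, so the signal diverges and even the crude bound
  -- `M` makes the noise negligible. At time `t + 2` the overlap is then asymptotically at least `1
  -- / (1 + S)`, where `S < 1` is the limiting contribution of the competitors.
  obtain ⟨t, rfl⟩ : ∃ t, t₁ = t + 2 := ⟨t₁ - 2, by omega⟩
  push_cast at h1
  have ht1 : (t + 2 - 1 : ℕ) = t + 1 := rfl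
  rw [ht1] at h3
  obtain ⟨⟨c, hc, hs⟩, ho', hyt⟩ := P.growth hκ hε hε2 hγ hy (t := t + 1) (by omega)
  obtain ⟨-, -, hyt'⟩ := P.growth hκ hε hε2 hγ hy (t := t + 2) le_rfl
  obtain ⟨c₁, hc₁, ho⟩ := ho'.resolve_left (by omega)
  have hexp : growthExp ε (t + 1 : ℕ) = 0 := by
    refine min_eq_right ?_
    push_cast; linarith
  rw [hexp] at hs
  have hexp' : growthExp ε t = 0 := by
    refine min_eq_right ?_
    linarith
  simp only [Nat.add_sub_cancel] at ho
  rw [hexp'] at ho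
  obtain ⟨c₂, hc₂, hs₂⟩ := exists_le_abs_s_of_le_abs_o hc₁ hK P.N_atTop ho P.beta_ge
  have hs_atTop : Tendsto (fun p => |(O p).s i (t + 1)|) g atTop := by
    refine tendsto_atTop_mono' _ hs₂ ?_
    refine Tendsto.const_mul_atTop hc₂ ((tendsto_rpow_atTop ?_).comp P.N_atTop)
    have : (0 : ℝ) ≤ d := Nat.cast_nonneg d
    linarith
  have hs0 : ∀ᶠ p in (g : Filter ι), (O p).s i (t + 1) ≠ 0 := by
    filter_upwards [hs_atTop.eventually_gt_atTop 0] with p h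
    exact abs_pos.1 h
  have hζ : Tendsto (fun p => (O p).z (t + 1) i / (O p).s i (t + 1)) g (𝓝 0) := by
    refine squeeze_zero_norm (a := fun p => M / |(O p).s i (t + 1)|) (fun p => ?_)
      (hs_atTop.const_div_atTop M)
    rw [Real.norm_eq_abs, abs_div]
    gcongr
    exact (O p).z_le _ _
  set S := ∑ j ∈ Finset.univ.erase i, |Γ j| * |limitRatio d Γ Y (t + 1) j| ^ d
        * |limitRatio d Γ Y (t + 1) j| with hS
  have hS0 : 0 ≤ S := Finset.sum_nonneg fun j _ => by positivity
  have hS1 : S < 1 := by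
    refine lt_of_le_of_lt ?_ h3
    calc S ≤ (Finset.univ.erase i).card • (κ * (1 - 1 / κ) ^ ((d + 1) ^ (t + 1))) := by
          refine Finset.sum_le_card_nsmul _ _ _ fun j hj => ?_
          have h := hb j (Finset.ne_of_mem_erase hj) (t + 1)
          rw [mul_comm κ]
          gcongr
          · exact h.2.1
          · exact h.1
      _ ≤ _ := by
          rw [nsmul_eq_mul]
          gcongr
          exact (Finset.card_le_univ _).trans_eq (Fintype.card_fin r)
  have hlim : Tendsto (fun p => |1 + (O p).z (t + 1) i / (O p).s i (t + 1)|
      / (1 + ∑ j ∈ Finset.univ.erase i, (O p).ρ i (t + 1) j * |(O p).y i (t + 1) j|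
        + M / |(O p).s i (t + 1)|)) g (𝓝 (|1 + 0| / (1 + S + 0))) := by
    refine Tendsto.div (hζ.const_add 1).abs (Tendsto.add (Tendsto.const_add _
      (tendsto_finsetSum _ fun j _ => ((hγ j).abs.mul ((hyt j).abs.pow d)).mul (hyt j).abs))
      (hs_atTop.const_div_atTop M)) ?_
    positivity
  have hhalf : (1 / 2 : ℝ) < |1 + 0| / (1 + S + 0) := by
    rw [add_zero, abs_one, add_zero]
    gcongr
    linarith
  have hone : ∀ᶠ p in (g : Filter ι), 1 + (O p).z (t + 1) i / (O p).s i (t + 1) ≠ 0 := by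
    have : Tendsto (fun p => 1 + (O p).z (t + 1) i / (O p).s i (t + 1)) g (𝓝 1) := by
      simpa using hζ.const_add 1
    exact this.eventually_ne one_ne_zero
  have hj : ∀ᶠ p in (g : Filter ι), ∀ j, j ≠ i → |(O p).y i (t + 2) j| ≤ 1 ∧
      3 * (O p).ρ i (t + 2) j ≤ Q ^ ((d + 1) ^ (t + 2)) := by
    rw [eventually_all]
    intro j
    by_cases hji : j = i
    · exact Eventually.of_forall fun p h => absurd hji h
    have h5 := hb j hji (t + 1)
    have h6 := hb j hji (t + 2)
    have h7 : |limitRatio d Γ Y (t + 2) j| < 1 := by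
      refine h5.2.2.trans_lt (lt_of_le_of_lt ?_ h3)
      have : 0 ≤ κ * (1 - 1 / κ) ^ ((d + 1) ^ (t + 1)) := by positivity
      nlinarith
    have h8 : 3 * (|Γ j| * |limitRatio d Γ Y (t + 2) j| ^ d) < Q ^ ((d + 1) ^ (t + 2)) := by
      linarith [h6.2.1]
    filter_upwards [(hyt' j).abs.eventually_lt_const h7,
      (((hγ j).abs.mul ((hyt' j).abs.pow d)).const_mul 3).eventually_lt_const h8]
      with p h9 h10 _
    exact ⟨h9.le, h10.le⟩
  filter_upwards [hj, hlim.eventually_const_lt hhalf, hs0, hone] with p h5 h6 h7 h8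
  refine ⟨?_, h5⟩
  rcases le_abs_o_succ P.M_pos h7 with h9 | h9
  · rw [sum_rho_mul (beta_ne h7) (o_ne h7)] at h9
    exact h6.le.trans h9
  · exact absurd h9 h8

/-- Every requirement holds for large `t₁`, which does not depend on the dimension. The factor `3`
of the invariant is absorbed by a high power of the strict inequality `1 - 1 / κ < exp (-1 / κ)`. -/
lemma exists_phaseOne_time (r : ℕ) {d : ℕ} (hd : 0 < d) {κ ε : ℝ} (hκ : 1 ≤ κ) (hε : 0 < ε) :
    ∃ t₁ : ℕ, 1 / 2 ≤ ε * ((t₁ : ℝ) - 1) ∧ 2 ≤ t₁ ∧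
      r * (κ * (1 - 1 / κ) ^ ((d + 1) ^ (t₁ - 1))) < 1 ∧
      3 * (1 - 1 / κ) ^ ((d + 1) ^ t₁) < Real.exp (-1 / κ) ^ ((d + 1) ^ t₁) ∧
      Real.exp (-1 / κ) ^ ((d + 1) ^ t₁) * (8 * r) ≤ 1 := by
  have hκ0 : 0 < κ := by linarith
  have hq0 : 0 ≤ 1 - 1 / κ := by
    rw [sub_nonneg, div_le_one hκ0]; exact hκ
  have hq1 : 1 - 1 / κ < 1 := by
    have : 0 < 1 / κ := by positivity
    linarith
  have hQ : Real.exp (-1 / κ) < 1 := by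
    rw [Real.exp_lt_one_iff]; exact div_neg_of_neg_of_pos (by norm_num) hκ0
  have hqQ : (1 - 1 / κ) / Real.exp (-1 / κ) < 1 := by
    rw [div_lt_one (Real.exp_pos _)]
    have := Real.add_one_lt_exp (x := -1 / κ) (by
      have : 0 < 1 / κ := by positivity
      rw [neg_div]; linarith)
    rw [neg_div] at this ⊢
    linarith
  have hpow : Tendsto (fun t : ℕ => (d + 1) ^ t) atTop atTop :=
    tendsto_pow_atTop_atTop_of_one_lt (by omega)
  have hpow' : Tendsto (fun t : ℕ => (d + 1) ^ (t - 1)) atTop atTop :=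
    hpow.comp (tendsto_sub_atTop_nat 1)
  have e1 : ∀ᶠ t : ℕ in atTop, 1 / 2 ≤ ε * ((t : ℝ) - 1) := by
    have : Tendsto (fun t : ℕ => ε * ((t : ℝ) - 1)) atTop atTop :=
      (tendsto_atTop_add_const_right _ (-1 : ℝ) tendsto_natCast_atTop_atTop).const_mul_atTop hε
    exact this.eventually_ge_atTop _
  have e3 : ∀ᶠ t : ℕ in atTop, r * (κ * (1 - 1 / κ) ^ ((d + 1) ^ (t - 1))) < 1 := by
    have : Tendsto (fun t : ℕ => r * (κ * (1 - 1 / κ) ^ ((d + 1) ^ (t - 1)))) atTop (𝓝 0) := by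
      simpa using (((tendsto_pow_atTop_nhds_zero_of_lt_one hq0 hq1).comp hpow').const_mul
        κ).const_mul (r : ℝ)
    exact this.eventually_lt_const one_pos
  have e4 : ∀ᶠ t : ℕ in atTop,
      3 * (1 - 1 / κ) ^ ((d + 1) ^ t) < Real.exp (-1 / κ) ^ ((d + 1) ^ t) := by
    have : Tendsto (fun t : ℕ => 3 * ((1 - 1 / κ) / Real.exp (-1 / κ)) ^ ((d + 1) ^ t)) atTop
        (𝓝 0) := by
      simpa using ((tendsto_pow_atTop_nhds_zero_of_lt_one
        (div_nonneg hq0 (Real.exp_pos _).le) hqQ).comp hpow).const_mul 3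
    filter_upwards [this.eventually_lt_const one_pos] with t ht
    rwa [div_pow, ← mul_div_assoc, div_lt_one (pow_pos (Real.exp_pos _) _)] at ht
  have e5 : ∀ᶠ t : ℕ in atTop, Real.exp (-1 / κ) ^ ((d + 1) ^ t) * (8 * r) ≤ 1 := by
    have : Tendsto (fun t : ℕ => Real.exp (-1 / κ) ^ ((d + 1) ^ t) * (8 * r)) atTop (𝓝 0) := by
      simpa using ((tendsto_pow_atTop_nhds_zero_of_lt_one (Real.exp_pos _).le hQ).comp
        hpow).mul_const (8 * (r : ℝ))
    exact this.eventually_le_const one_pos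
  obtain ⟨t, h1, h2, h3, h4, h5⟩ :=
    (e1.and ((eventually_ge_atTop 2).and (e3.and (e4.and e5)))).exists
  exact ⟨t, h1, h2, h3, h4, h5⟩

lemma PhaseOne.mono {l' : Filter ι} (P : PhaseOne l O i N κ ε t₁) (h : l' ≤ l) :
    PhaseOne l' O i N κ ε t₁ :=
  ⟨P.M_pos, P.N_atTop.mono_left h, P.beta_ge.filter_mono h, P.gamma_le.filter_mono h,
    P.o_ge.filter_mono h, P.y_le.filter_mono h, P.rho_le.filter_mono h, P.z_le'.filter_mono h⟩

/-- What holds along every finer ultrafilter holds eventually. The level `A` is arbitrary because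
the second alternative of the invariant holds. -/
lemma PhaseOne.eventually_dominates (P : PhaseOne l O i N κ ε t₁)
    (hκ : 1 ≤ κ) (hε : 0 < ε) (hε2 : ε ≤ 1 / 2) {Q : ℝ}
    (h1 : 1 / 2 ≤ ε * ((t₁ : ℝ) - 1)) (h2 : 2 ≤ t₁)
    (h3 : r * (κ * (1 - 1 / κ) ^ ((d + 1) ^ (t₁ - 1))) < 1)
    (h4 : 3 * (1 - 1 / κ) ^ ((d + 1) ^ t₁) < Q ^ ((d + 1) ^ t₁)) :
    ∀ᶠ p in l, ∀ A, Dominates (O p) i A Q t₁ := by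
  have : ∀ᶠ p in l, 1 / 2 ≤ |(O p).o t₁ i| ∧ ∀ j, j ≠ i → |(O p).y i t₁ j| ≤ 1 ∧
      3 * (O p).ρ i t₁ j ≤ Q ^ ((d + 1) ^ t₁) :=
    mem_iff_ultrafilter.2 fun g hg =>
      (P.mono hg).eventually_ultrafilter hκ hε hε2 h1 h2 h3 h4
  exact this.mono fun p h A => ⟨h.1, fun j hj => ⟨(h.2 j hj).1, Or.inr (h.2 j hj).2⟩⟩

/-- Serves to track signs: in the first phase the noise never reverses the update of the overlap
with spike `i`. -/
lemma PhaseOne.eventually_one_add_pos (P : PhaseOne l O i N κ ε t₁) (hκ : 1 ≤ κ) (hε : 0 < ε)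
    (hε2 : ε ≤ 1 / 2) :
    ∀ᶠ p in l, ∀ t < t₁, (O p).s i t ≠ 0 ∧ 0 < 1 + (O p).z t i / (O p).s i t := by
  refine mem_iff_ultrafilter.2 fun g hg => ?_
  have P' := P.mono hg
  choose Γ _ hγ using fun j => exists_tendsto_of_bounded g (P'.gamma_le.mono fun p h => h j)
  choose Y hY hy using fun j => exists_tendsto_of_bounded g (P'.y_le.mono fun p h => h j)
  have : ∀ᶠ p in (g : Filter ι), ∀ t ∈ Finset.range t₁,
      (O p).s i t ≠ 0 ∧ 0 < 1 + (O p).z t i / (O p).s i t := by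
    rw [Filter.eventually_all_finset]
    intro t ht
    have ht' : t < t₁ := Finset.mem_range.1 ht
    obtain ⟨c, hc, hs⟩ := (P'.growth hκ hε hε2 hγ hy ht'.le).1
    have hs' : ∀ᶠ p in (g : Filter ι), c * N p ^ (-1 / 2 + ε) ≤ |(O p).s i t| := by
      filter_upwards [hs, P'.N_atTop.eventually_ge_atTop 1] with p h1 h2
      refine le_trans ?_ h1
      have : -1 / 2 + ε ≤ growthExp ε t := by
        refine le_min ?_ (by linarith)
        have : (0 : ℝ) ≤ ε * t := by positivity
        linarith
      gcongr
    have hζ := tendsto_zeta (j := i) hε hc P'.N_atTop hs' (P'.z_le'.mono fun p h => h t ht' i)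
    filter_upwards [hs', hζ.eventually_const_lt (show (-1 : ℝ) < 0 by norm_num),
      P'.N_atTop.eventually_gt_atTop 0] with p h1 h2 h3
    refine ⟨?_, by linarith⟩
    rw [← abs_pos]
    exact lt_of_lt_of_le (mul_pos hc (Real.rpow_pos_of_pos h3 _)) h1
  exact this.mono fun p h t ht => h t (Finset.mem_range.2 ht)

end OverlapOrbit

end SpikedTensor

/-! ### Realizations of the model: iterates as perturbed spikes, and their signs. -/

namespace SpikedTensor

/-- A realization of the model, with noise of injective norm at most `M`. -/
structure Sample (r d : ℕ) (M : ℝ) where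
  n : ℕ
  β : Fin r → ℝ
  v : Fin r → EuclideanSpace ℝ (Fin n)
  Z : Tensor (d + 2) n
  u : EuclideanSpace ℝ (Fin n)
  ortho : Orthonormal ℝ v
  norm_u : ‖u‖ = 1
  op : OpBound M Z
  M_pos : 0 < M

namespace Sample

variable {r d : ℕ} {M : ℝ} (S : Sample r d M)

/-- The observed tensor. -/
noncomputable def X : Tensor (d + 2) S.n := signal (d + 2) S.β S.v + S.Z

/-- The iterates. -/
noncomputable def U (t : ℕ) : EuclideanSpace ℝ (Fin S.n) := powerIter S.X S.u t

lemma norm_U_le (t : ℕ) : ‖S.U t‖ ≤ 1 := norm_powerIter_le _ S.norm_u.le t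

lemma contract_X (w : EuclideanSpace ℝ (Fin S.n)) :
    contract S.X w = ∑ j, (S.β j * inner ℝ w (S.v j) ^ (d + 1)) • S.v j + contract S.Z w := by
  rw [X, contract_add, contract_signal]

/-- The overlaps along the iteration. -/
noncomputable def orbit : OverlapOrbit r d M where
  β := S.β
  o t j := inner ℝ (S.U t) (S.v j)
  R t := ‖contract S.X (S.U t)‖
  z t j := inner ℝ (S.v j) (contract S.Z (S.U t))
  step t j := by
    have h1 : inner ℝ (S.U (t + 1)) (S.v j) * ‖contract S.X (S.U t)‖
        = (inner ℝ (S.v j) (contract S.X (S.U t)) : ℝ) := by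
      rw [U, powerIter, inner_smul_left, real_inner_comm]
      rcases eq_or_ne (contract S.X (S.U t)) 0 with h | h
      · simp only [U] at h; simp [h, U]
      · have := norm_ne_zero_iff.2 h
        simp only [U] at this ⊢
        simp; field_simp
    rw [h1, contract_X, inner_add_right]
    congr 1
    rw [inner_sum, Finset.sum_eq_single j]
    · rw [inner_smul_right, real_inner_self_eq_norm_sq, S.ortho.1 j]; simp
    · intro l _ hl
      rw [inner_smul_right, S.ortho.2 hl.symm, mul_zero]
    · simp
  R_nonneg t := norm_nonneg _
  R_le t := by
    rw [contract_X]
    refine (norm_add_le _ _).trans (add_le_add ?_ (S.op.norm_contract_le S.M_pos.le (S.norm_U_le t)))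
    refine (norm_sum_le _ _).trans (Finset.sum_le_sum fun j _ => ?_)
    rw [norm_smul, S.ortho.1 j, mul_one, Real.norm_eq_abs, abs_mul, abs_pow]
  z_le t j := by
    refine (abs_real_inner_le_norm _ _).trans ?_
    rw [S.ortho.1 j, one_mul]
    exact S.op.norm_contract_le S.M_pos.le (S.norm_U_le t)

/-- The relative perturbation of spike `i` in the update at time `t`. -/
noncomputable def e (i : Fin r) (t : ℕ) : EuclideanSpace ℝ (Fin S.n) :=
  ∑ j ∈ Finset.univ.erase i, (S.orbit.γ i j * S.orbit.y i t j ^ (d + 1)) • S.v j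
    + (S.orbit.s i t)⁻¹ • contract S.Z (S.U t)

variable {S} {i : Fin r} {t : ℕ}

lemma contract_X_U (h : S.orbit.s i t ≠ 0) :
    contract S.X (S.U t) = S.orbit.s i t • (S.v i + S.e i t) := by
  rw [contract_X, e, smul_add, smul_add, smul_smul, mul_inv_cancel₀ h, one_smul, ← add_assoc]
  congr 1
  rw [← Finset.add_sum_erase _ _ (Finset.mem_univ i), Finset.smul_sum]
  congr 1
  refine Finset.sum_congr rfl fun j _ => ?_
  rw [smul_smul]
  congr 1
  have h1 := OverlapOrbit.beta_ne h
  have h2 := OverlapOrbit.o_ne h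
  simp only [OverlapOrbit.s, OverlapOrbit.γ, OverlapOrbit.y, div_pow, orbit] at h1 h2 ⊢
  field_simp

lemma norm_sum_le_rho : ‖∑ j ∈ Finset.univ.erase i,
      (S.orbit.γ i j * S.orbit.y i t j ^ (d + 1)) • S.v j‖
    ≤ ∑ j ∈ Finset.univ.erase i, S.orbit.ρ i t j * |S.orbit.y i t j| := by
  refine (norm_sum_le _ _).trans (Finset.sum_le_sum fun j _ => ?_)
  rw [norm_smul, S.ortho.1 j, mul_one, Real.norm_eq_abs, abs_mul, abs_pow, OverlapOrbit.ρ,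
    pow_succ, mul_assoc]

lemma norm_e_le : ‖S.e i t‖ ≤ ∑ j ∈ Finset.univ.erase i, S.orbit.ρ i t j * |S.orbit.y i t j|
    + M / |S.orbit.s i t| := by
  refine (norm_add_le _ _).trans (add_le_add norm_sum_le_rho ?_)
  rw [norm_smul, norm_inv, Real.norm_eq_abs, div_eq_inv_mul]
  gcongr
  exact S.op.norm_contract_le S.M_pos.le (S.norm_U_le t)

lemma U_succ (h : S.orbit.s i t ≠ 0) :
    S.U (t + 1) = Real.sign (S.orbit.s i t) • (‖S.v i + S.e i t‖⁻¹ • (S.v i + S.e i t)) := by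
  have h1 : S.U (t + 1) = ‖contract S.X (S.U t)‖⁻¹ • contract S.X (S.U t) := rfl
  rw [h1, contract_X_U h, norm_smul, smul_smul, smul_smul, Real.norm_eq_abs]
  congr 1
  rcases lt_or_gt_of_ne h with h | h
  · rw [Real.sign_of_neg h, abs_of_neg h, mul_inv]
    field_simp
  · rw [Real.sign_of_pos h, abs_of_pos h, mul_inv]
    field_simp

end Sample

lemma norm_normalize_add_sub_le {E : Type*} [NormedAddCommGroup E] [NormedSpace ℝ E] {v e : E}
    (hv : ‖v‖ = 1) (he : ‖e‖ < 1) : ‖‖v + e‖⁻¹ • (v + e) - v‖ ≤ 2 * ‖e‖ := by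
  have h1 : |‖v + e‖ - 1| ≤ ‖e‖ := by
    rw [← hv]
    refine (abs_norm_sub_norm_le _ _).trans ?_
    simp
  have h2 : ‖v + e‖ ≠ 0 := by
    have := neg_le_of_abs_le h1
    linarith
  have h3 : ‖‖v + e‖⁻¹ • (v + e) - (v + e)‖ ≤ ‖e‖ := by
    have : ‖v + e‖⁻¹ • (v + e) - (v + e) = ((1 - ‖v + e‖) * ‖v + e‖⁻¹) • (v + e) := by
      rw [sub_mul, one_mul, mul_inv_cancel₀ h2, sub_smul, one_smul]
    rw [this, norm_smul, norm_mul, norm_inv, norm_norm, mul_assoc, inv_mul_cancel₀ h2, mul_one,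
      Real.norm_eq_abs, abs_sub_comm]
    exact h1
  calc _ = ‖(‖v + e‖⁻¹ • (v + e) - (v + e)) + e‖ := by congr 1; abel
    _ ≤ _ := (norm_add_le _ _).trans (by linarith)

lemma norm_normalize {E : Type*} [NormedAddCommGroup E] [NormedSpace ℝ E] {w : E} (h : w ≠ 0) :
    ‖‖w‖⁻¹ • w‖ = 1 := by
  rw [norm_smul, norm_inv, norm_norm, inv_mul_cancel₀ (norm_ne_zero_iff.2 h)]

lemma sign_sq {x : ℝ} (h : x ≠ 0) : Real.sign x * Real.sign x = 1 := by
  rcases lt_or_gt_of_ne h with h | h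
  · rw [Real.sign_of_neg h]; norm_num
  · rw [Real.sign_of_pos h]; norm_num

lemma sign_mul_of_pos {x y : ℝ} (h : 0 < y) : Real.sign (x * y) = Real.sign x := by
  rcases lt_trichotomy x 0 with hx | rfl | hx
  · rw [Real.sign_of_neg hx, Real.sign_of_neg (mul_neg_of_neg_of_pos hx h)]
  · simp
  · rw [Real.sign_of_pos hx, Real.sign_of_pos (mul_pos hx h)]

lemma sign_mul' (x y : ℝ) : Real.sign (x * y) = Real.sign x * Real.sign y := by
  rcases lt_trichotomy y 0 with hy | rfl | hy
  · rw [Real.sign_of_neg hy, show x * y = (-x) * (-y) by ring,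
      sign_mul_of_pos (by linarith), Real.sign_neg]
    ring
  · simp
  · rw [sign_mul_of_pos hy, Real.sign_of_pos hy, mul_one]

lemma sign_pow' (x : ℝ) (m : ℕ) : Real.sign (x ^ m) = Real.sign x ^ m := by
  induction m with
  | zero => simp
  | succ m ih => rw [pow_succ, sign_mul', ih, pow_succ]

namespace OverlapOrbit

variable {r d : ℕ} {M : ℝ} {O : OverlapOrbit r d M} {i : Fin r}

lemma sign_o_succ {t : ℕ} (h : O.s i t ≠ 0) (h1 : 0 < 1 + O.z t i / O.s i t) :
    Real.sign (O.o (t + 1) i) = Real.sign (O.s i t) := by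
  have h2 := mul_R_self h
  have hR : 0 < O.R t := lt_of_le_of_ne (O.R_nonneg t) fun h0 => by
    rw [← h0, mul_zero] at h2
    exact mul_ne_zero h h1.ne' h2.symm
  rw [← sign_mul_of_pos hR, h2, sign_mul_of_pos h1]

/-- The sign of the update agrees with the predicted sign of the limit. -/
lemma sign_s_eq_limitSign {t : ℕ} (h : ∀ t' ≤ t, O.s i t' ≠ 0)
    (h1 : ∀ t' < t, 0 < 1 + O.z t' i / O.s i t') :
    Real.sign (O.s i t) = limitSign (d + 2) (O.β i) (t + 1) (O.o 0 i) := by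
  have hb := sign_sq (beta_ne (h 0 (Nat.zero_le t)))
  have hs : ∀ t, Real.sign (O.s i t) = Real.sign (O.β i) * Real.sign (O.o t i) ^ (d + 1) :=
    fun t => by rw [s, sign_mul', sign_pow']
  have ho : ∀ t' ≤ t, Real.sign (O.o t' i) * Real.sign (O.o t' i) = 1 := fun t' ht =>
    sign_sq (o_ne (h t' ht))
  unfold limitSign
  split_ifs with hd
  -- For odd `k` the signal is `β i` times an even power of the overlap, so its sign does not depend
  -- on the history.
  · have : Even (d + 1) := by
      rcases Nat.even_or_odd d with hd' | hd'
      · exact absurd hd (by simpa using hd'.add (by decide : Even 2))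
      · exact hd'.add_one
    obtain ⟨m, hm⟩ := this
    rw [hs, hm, ← two_mul, pow_mul, pow_two, ho t le_rfl, one_pow, mul_one]
  -- For even `k` each step multiplies the sign of the overlap by that of `β i`.
  · have : Even d := by
      rcases Nat.even_or_odd d with hd' | hd'
      · exact hd'
      · exact absurd (hd'.add_even (by decide : Even 2)) hd
    obtain ⟨m, hm⟩ := this
    have hp : ∀ x : ℝ, x * x = 1 → x ^ d = 1 := fun x hx => by
      rw [hm, ← two_mul, pow_mul, pow_two, hx, one_pow]
    have hstep : ∀ t' ≤ t, Real.sign (O.s i t') = Real.sign (O.β i) * Real.sign (O.o t' i) := by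
      intro t' ht'
      rw [hs, pow_succ, hp _ (ho t' ht'), one_mul]
    have : ∀ t' ≤ t, Real.sign (O.o t' i) = Real.sign (O.β i) ^ t' * Real.sign (O.o 0 i) := by
      intro t'
      induction t' with
      | zero => intro _; simp
      | succ t' ih =>
        intro ht'
        rw [sign_o_succ (h t' (by omega)) (h1 t' (by omega)), hstep t' (by omega),
          ih (by omega)]
        ring
    rw [hstep t le_rfl, this t le_rfl]
    ring

end OverlapOrbit

namespace Sample

open OverlapOrbit

variable {r d : ℕ} {M : ℝ} {S : Sample r d M} {i : Fin r} {t : ℕ}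

/-- The deviation of the scaled perturbation from the contracted noise in direction `v i`. -/
noncomputable def δ (S : Sample r d M) (i : Fin r) (t : ℕ) : EuclideanSpace ℝ (Fin S.n) :=
  S.β i • S.e i t - contract S.Z (S.v i)

lemma e_eq (hβ : S.β i ≠ 0) :
    S.e i t = (S.β i)⁻¹ • (contract S.Z (S.v i) + S.δ i t) := by
  rw [δ, add_sub_cancel, smul_smul, inv_mul_cancel₀ hβ, one_smul]

/-- Bernoulli's inequality gives `x ^ m ≥ 1 - m η ≥ 1 / 2`. -/
lemma abs_inv_pow_sub_one_le {x η : ℝ} (m : ℕ) (h1 : 1 - η ≤ x) (h2 : x ≤ 1) (hx : 0 < x)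
    (hη : m * η ≤ 1 / 2) (hη0 : η ≤ 1) : |(x ^ m)⁻¹ - 1| ≤ 2 * (m * η) := by
  have h3 : 1 - m * η ≤ x ^ m := by
    have := one_add_mul_le_pow (a := -η) (by linarith) m
    calc 1 - m * η = 1 + m * (-η) := by ring
      _ ≤ (1 + -η) ^ m := this
      _ ≤ x ^ m := pow_le_pow_left₀ (by linarith) (by linarith) m
  have h4 : x ^ m ≤ 1 := pow_le_one₀ hx.le h2
  have h5 : 0 < x ^ m := by positivity
  rw [abs_of_nonneg (by rw [sub_nonneg]; exact one_le_inv₀ h5 |>.2 h4), sub_le_iff_le_add,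
    inv_le_iff_one_le_mul₀ h5]
  nlinarith

/-- One step after a time at which the perturbation is small, the perturbation is the contracted
noise up to smaller terms. -/
lemma norm_delta_succ_le (h : S.orbit.s i t ≠ 0) {η : ℝ}
    (he : ‖S.e i t‖ ≤ η) (hη : (d + 1) * (4 * η) ≤ 1 / 2) :
    ‖S.δ i (t + 1)‖ ≤ |S.β i| * ∑ j ∈ Finset.univ.erase i,
      S.orbit.ρ i (t + 1) j * |S.orbit.y i (t + 1) j| + M * (d + 2) * (10 * η) := by
  have hη0 : 0 ≤ η := (norm_nonneg _).trans he
  have hη1 : η ≤ 1 / 8 := by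
    have : (0 : ℝ) ≤ d := Nat.cast_nonneg d
    nlinarith
  have hv := S.ortho.1 i
  set w := ‖S.v i + S.e i t‖⁻¹ • (S.v i + S.e i t) with hw
  set τ := Real.sign (S.orbit.s i t) with hτ
  have hττ : τ * τ = 1 := sign_sq h
  have hU : S.U (t + 1) = τ • w := U_succ h
  have hwv : ‖w - S.v i‖ ≤ 2 * η :=
    (norm_normalize_add_sub_le hv (by linarith)).trans (by linarith)
  have hne : S.v i + S.e i t ≠ 0 := by
    intro h0
    have : ‖S.v i‖ ≤ ‖S.v i + S.e i t‖ + ‖S.e i t‖ := by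
      simpa using norm_sub_le (S.v i + S.e i t) (S.e i t)
    rw [h0, norm_zero, hv] at this
    linarith
  have hw1 : ‖w‖ = 1 := norm_normalize hne
  set x : ℝ := inner ℝ w (S.v i) with hx
  have hx1 : x ≤ 1 := by
    have := real_inner_le_norm w (S.v i)
    rwa [hw1, hv, mul_one] at this
  have hx2 : 1 - 4 * η ≤ x := by
    have h1 := norm_sub_sq_real w (S.v i)
    rw [hw1, hv] at h1
    have h2 : ‖w - S.v i‖ ^ 2 ≤ (2 * η) ^ 2 := by gcongr
    nlinarith
  have hx0 : 0 < x := by linarith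
  have hs : S.orbit.s i (t + 1) = S.β i * (τ ^ (d + 1) * x ^ (d + 1)) := by
    rw [← mul_pow, OverlapOrbit.s]
    congr 2
    change inner ℝ (S.U (t + 1)) (S.v i) = _
    rw [hU, inner_smul_left]; rfl
  have hβ : S.β i ≠ 0 := OverlapOrbit.beta_ne h
  have hτ0 : τ ^ (d + 1) * τ ^ (d + 1) = 1 := by rw [← mul_pow, hττ, one_pow]
  have hτn : τ ^ (d + 1) ≠ 0 := left_ne_zero_of_mul_eq_one hτ0
  -- The sign `τ` enters the contraction and the signal with the same power and cancels.
  have hZ : S.β i • (S.orbit.s i (t + 1))⁻¹ • contract S.Z (S.U (t + 1))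
      = (x ^ (d + 1))⁻¹ • contract S.Z w := by
    rw [hU, contract_smul, smul_smul, smul_smul, hs]
    congr 1
    have : x ^ (d + 1) ≠ 0 := by positivity
    field_simp
  -- Three errors: the competing spikes, the deficit `x < 1` of the overlap in the signal, and the
  -- displacement from `v i` to `w` of the direction of contraction.
  have hδ : S.δ i (t + 1) = S.β i • ∑ j ∈ Finset.univ.erase i,
        (S.orbit.γ i j * S.orbit.y i (t + 1) j ^ (d + 1)) • S.v j
      + (((x ^ (d + 1))⁻¹ - 1) • contract S.Z w + (contract S.Z w - contract S.Z (S.v i))) := by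
    rw [δ, e, smul_add, hZ, sub_smul, one_smul]
    abel
  have hM := S.M_pos
  rw [hδ]
  refine (norm_add_le _ _).trans (add_le_add ?_ ?_)
  · rw [norm_smul, Real.norm_eq_abs]
    gcongr
    exact norm_sum_le_rho
  · refine (norm_add_le _ _).trans ?_
    have h1 : ‖((x ^ (d + 1))⁻¹ - 1) • contract S.Z w‖ ≤ 2 * ((d + 1) * (4 * η)) * M := by
      rw [norm_smul, Real.norm_eq_abs]
      have := abs_inv_pow_sub_one_le (η := 4 * η) (d + 1) hx2 hx1 hx0 (by exact_mod_cast hη)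
        (by linarith)
      push_cast at this
      gcongr
      exact S.op.norm_contract_le S.M_pos.le hw1.le
    have h2 : ‖contract S.Z w - contract S.Z (S.v i)‖ ≤ M * (d + 2) * (2 * η) := by
      refine (S.op.norm_contract_sub_le S.M_pos.le hw1.le hv.le).trans ?_
      push_cast
      have : M * ((d : ℝ) + 1 + 1) = M * (d + 2) := by ring
      rw [this]
      gcongr
    have h3 : 0 ≤ M * η := by positivity
    nlinarith

end Sample

end SpikedTensor

/-! ### Selection of a spike, from a good initialization to the final iterate. -/

namespace SpikedTensor

namespace Sample

open OverlapOrbit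

variable {r d : ℕ} {M : ℝ} {i : Fin r} {κ ε : ℝ}

section Init

variable {S : Sample r d M}

/-- All overlaps lie in one interval `[a, κ a]`. This bounds their ratios, and cancelling `a ^ d` in
the argmax inequality shows that the selected spike is not much weaker than any other. -/
lemma init_bounds (hκ : 1 ≤ κ) (hn : 0 < S.n) (hβ : ∃ j, S.β j ≠ 0)
    (h : GoodInit (d + 2) κ S.β S.v i S.u) :
    (∀ j, |S.β j| ≤ κ ^ d * |S.β i|) ∧ S.β i ≠ 0 ∧ (∀ j, |S.orbit.y i 0 j| ≤ κ) ∧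
      ∀ j, j ≠ i → S.orbit.ρ i 0 j ≤ 1 - 1 / κ := by
  have hκ0 : 0 < κ := by linarith
  have hn' : (0 : ℝ) < S.n := by exact_mod_cast hn
  set a : ℝ := 1 / √(κ * S.n) with ha
  have ha0 : 0 < a := by positivity
  have hup : √(κ / S.n) = κ * a := by
    rw [ha, Real.sqrt_div hκ0.le, Real.sqrt_mul hκ0.le]
    have := Real.mul_self_sqrt hκ0.le
    have h1 : √κ ≠ 0 := by positivity
    have h2 : √(S.n : ℝ) ≠ 0 := by positivity
    field_simp
    nlinarith
  have hlo : ∀ j, a ≤ |(inner ℝ S.u (S.v j) : ℝ)| := fun j => (h.1 j).1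
  have hhi : ∀ j, |(inner ℝ S.u (S.v j) : ℝ)| ≤ κ * a := fun j => hup ▸ (h.1 j).2
  have hpow : ∀ j, j ≠ i → |S.β j| * |(inner ℝ S.u (S.v j) : ℝ)| ^ d
      ≤ (1 - 1 / κ) * (|S.β i| * |(inner ℝ S.u (S.v i) : ℝ)| ^ d) := fun j hj => by
    simpa [abs_mul, abs_pow] using h.2 j hj
  have hK : ∀ j, |S.β j| ≤ κ ^ d * |S.β i| := by
    intro j
    by_cases hj : j = i
    · subst hj
      have : 1 ≤ κ ^ d := one_le_pow₀ hκ
      nlinarith [abs_nonneg (S.β j)]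
    · have h1 : |S.β j| * a ^ d ≤ |S.β i| * (κ * a) ^ d := by
        calc _ ≤ |S.β j| * |(inner ℝ S.u (S.v j) : ℝ)| ^ d := by gcongr; exact hlo j
          _ ≤ (1 - 1 / κ) * (|S.β i| * |(inner ℝ S.u (S.v i) : ℝ)| ^ d) := hpow j hj
          _ ≤ 1 * (|S.β i| * |(inner ℝ S.u (S.v i) : ℝ)| ^ d) := by
              gcongr
              have : 0 ≤ 1 / κ := by positivity
              linarith
          _ ≤ _ := by rw [one_mul]; gcongr; exact hhi i
      rw [mul_pow, ← mul_assoc] at h1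
      have := le_of_mul_le_mul_right h1 (pow_pos ha0 d)
      linarith
  have hβi : S.β i ≠ 0 := by
    intro h0
    obtain ⟨j, hj⟩ := hβ
    have := hK j
    rw [h0, abs_zero, mul_zero] at this
    exact hj (abs_nonpos_iff.1 this)
  have hoi : 0 < |(inner ℝ S.u (S.v i) : ℝ)| := ha0.trans_le (hlo i)
  refine ⟨hK, hβi, fun j => ?_, fun j hj => ?_⟩
  · change |(inner ℝ S.u (S.v j) : ℝ) / inner ℝ S.u (S.v i)| ≤ κ
    rw [abs_div, div_le_iff₀ hoi]
    exact (hhi j).trans (by gcongr; exact hlo i)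
  · change |S.β j / S.β i| * |(inner ℝ S.u (S.v j) : ℝ) / inner ℝ S.u (S.v i)| ^ d ≤ _
    have hb : 0 < |S.β i| := abs_pos.2 hβi
    rw [abs_div, abs_div, div_pow, div_mul_div_comm, div_le_iff₀ (by positivity)]
    exact hpow j hj

end Init

variable [NeZero r] {ι : Type*}

/-- The assumptions on a family of realizations along which the iteration selects spike `i`. -/
structure Selects (l : Filter ι) (P : ι → Sample r d M) (T : ι → ℕ) (i : Fin r) (κ ε : ℝ) (t₁ : ℕ) :
    Prop where
  one_le_kappa : 1 ≤ κ
  eps_pos : 0 < ε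
  eps_le : ε ≤ 1 / 2
  d_pos : 0 < d
  n_atTop : Tendsto (fun p => ((P p).n : ℝ)) l atTop
  beta_ge : ∀ᶠ p in l, ((P p).n : ℝ) ^ ((d : ℝ) / 2 + ε) ≤ |(P p).β 0|
  beta_le : ∀ᶠ p in l, ∀ j, |(P p).β j| ≤ |(P p).β 0|
  good : ∀ᶠ p in l, GoodInit (d + 2) κ (P p).β (P p).v i (P p).u
  noise : ∀ᶠ p in l, ∀ t < t₁, ∀ j,
    |(inner ℝ ((P p).v j) (contract (P p).Z ((P p).U t)) : ℝ)| ≤ ((P p).n : ℝ) ^ (-1 / 2 + ε / 2)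
  time : ∀ᶠ p in l, κ * Real.log (√(P p).n * |(P p).β 0|) ≤ ((d : ℝ) + 1) ^ (T p - 1)

variable {l : Filter ι} {P : ι → Sample r d M} {T : ι → ℕ} {t₁ : ℕ}

lemma Selects.init (H : Selects l P T i κ ε t₁) : ∀ᶠ p in l,
    (∀ j, |(P p).β j| ≤ κ ^ d * |(P p).β i|) ∧ (P p).β i ≠ 0 ∧
      (∀ j, |(P p).orbit.y i 0 j| ≤ κ) ∧ ∀ j, j ≠ i → (P p).orbit.ρ i 0 j ≤ 1 - 1 / κ := by
  filter_upwards [H.good, H.n_atTop.eventually_gt_atTop 0, H.beta_ge] with p h1 h2 h3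
  refine init_bounds H.one_le_kappa (by exact_mod_cast h2) ⟨0, ?_⟩ h1
  exact abs_pos.1 (lt_of_lt_of_le (Real.rpow_pos_of_pos h2 _) h3)

lemma Selects.beta_ge' (H : Selects l P T i κ ε t₁) : ∀ᶠ p in l,
    ((P p).n : ℝ) ^ ((d : ℝ) / 2 + ε) ≤ κ ^ d * |(P p).β i| := by
  filter_upwards [H.init, H.beta_ge] with p h1 h2
  exact h2.trans (h1.1 0)

/-- Here `d ≥ 1` enters: up to a constant, `|β i|` is at least `n ^ (1 / 2 + ε)`. -/
lemma Selects.sqrt_div_tendsto (H : Selects l P T i κ ε t₁) :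
    Tendsto (fun p => √(P p).n / |(P p).β i|) l (𝓝 0) := by
  have h1 : Tendsto (fun p => κ ^ d * ((P p).n : ℝ) ^ (-ε)) l (𝓝 0) := by
    simpa using ((tendsto_rpow_neg_atTop H.eps_pos).comp H.n_atTop).const_mul (κ ^ d)
  have hκ := H.one_le_kappa
  refine squeeze_zero' (Eventually.of_forall fun p => by positivity) ?_ h1
  filter_upwards [H.beta_ge', H.n_atTop.eventually_ge_atTop 1, H.init] with p h2 h3 h4
  have hb : 0 < |(P p).β i| := abs_pos.2 h4.2.1
  have hn : (0 : ℝ) < (P p).n := by linarith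
  rw [div_le_iff₀ hb]
  have h5 : ((P p).n : ℝ) ^ (1 / 2 + ε) ≤ ((P p).n : ℝ) ^ ((d : ℝ) / 2 + ε) := by
    have : (1 : ℝ) ≤ d := by exact_mod_cast H.d_pos
    gcongr
  calc √((P p).n : ℝ) = ((P p).n : ℝ) ^ (-ε) * ((P p).n : ℝ) ^ (1 / 2 + ε) := by
        rw [← Real.rpow_add hn, Real.sqrt_eq_rpow]; ring_nf
    _ ≤ ((P p).n : ℝ) ^ (-ε) * (κ ^ d * |(P p).β i|) := by
        gcongr
        exact h5.trans h2
    _ = _ := by ring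

lemma Selects.beta_atTop (H : Selects l P T i κ ε t₁) :
    Tendsto (fun p => |(P p).β i|) l atTop := by
  have hκ := H.one_le_kappa
  have h1 : Tendsto (fun p => (κ ^ d)⁻¹ * ((P p).n : ℝ) ^ ((d : ℝ) / 2 + ε)) l atTop := by
    refine Tendsto.const_mul_atTop (by positivity) ((tendsto_rpow_atTop ?_).comp H.n_atTop)
    have := H.eps_pos
    positivity
  refine tendsto_atTop_mono' _ ?_ h1
  filter_upwards [H.beta_ge'] with p h
  rw [inv_mul_le_iff₀ (by positivity)]
  exact h

lemma Selects.phaseOne (H : Selects l P T i κ ε t₁) (hM : 0 < M) :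
    PhaseOne l (fun p => (P p).orbit) i (fun p => ((P p).n : ℝ)) κ ε t₁ where
  M_pos := hM
  N_atTop := H.n_atTop
  beta_ge := H.beta_ge'
  gamma_le := by
    filter_upwards [H.init] with p h j
    change |(P p).β j / (P p).β i| ≤ _
    rw [abs_div, div_le_iff₀ (abs_pos.2 h.2.1)]
    exact h.1 j
  o_ge := H.good.mono fun p h => (h.1 i).1
  y_le := H.init.mono fun p h => h.2.2.1
  rho_le := H.init.mono fun p h => h.2.2.2
  z_le' := H.noise

lemma Selects.time_atTop (H : Selects l P T i κ ε t₁) : Tendsto T l atTop := by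
  have h0 : Tendsto (fun p => κ * Real.log (√(P p).n * |(P p).β 0|)) l atTop := by
    have hκ := H.one_le_kappa
    refine Tendsto.const_mul_atTop (by linarith) (Real.tendsto_log_atTop.comp ?_)
    refine tendsto_atTop_mono' _ ?_ ((Real.tendsto_sqrt_atTop).comp H.n_atTop)
    filter_upwards [H.beta_ge, H.n_atTop.eventually_ge_atTop 1] with p h1 h2
    have : (1 : ℝ) ≤ ((P p).n : ℝ) ^ ((d : ℝ) / 2 + ε) :=
      Real.one_le_rpow h2 (by have := H.eps_pos; positivity)
    have h3 := Real.sqrt_nonneg ((P p).n : ℝ)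
    change √((P p).n : ℝ) ≤ _
    nlinarith
  rw [tendsto_atTop]
  intro m
  filter_upwards [h0.eventually_gt_atTop (((d : ℝ) + 1) ^ m), H.time] with p h1 h2
  have h3 := h1.trans_le h2
  have hd : (1 : ℝ) < d + 1 := by
    have : (0 : ℝ) < d := by exact_mod_cast H.d_pos
    linarith
  have := (pow_lt_pow_iff_right₀ hd).1 h3
  omega

/-- The decay of the noiseless overlap ratios, two steps before the end. -/
noncomputable def decay (d : ℕ) (κ : ℝ) (T : ℕ) : ℝ := Real.exp (-1 / κ) ^ ((d + 1) ^ (T - 2))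

/-- This is the time condition: the power `d + 1` is one more iteration, leading from `T - 2` to
`exp (-(d + 1) ^ (T - 1) / κ)`. -/
lemma Selects.decay_pow_le (H : Selects l P T i κ ε t₁) : ∀ᶠ p in l,
    decay d κ (T p) ^ (d + 1) ≤ 1 / (√(P p).n * |(P p).β 0|) := by
  filter_upwards [H.time, H.time_atTop.eventually_ge_atTop 2, H.beta_ge,
    H.n_atTop.eventually_gt_atTop 0] with p h1 h2 h3 h4
  have hκ := H.one_le_kappa
  have hb : 0 < |(P p).β 0| := lt_of_lt_of_le (Real.rpow_pos_of_pos h4 _) h3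
  obtain ⟨m, hm⟩ : ∃ m, T p = m + 2 := ⟨T p - 2, by omega⟩
  have h5 : (m + 2 - 1 : ℕ) = m + 1 := rfl
  rw [hm, h5] at h1
  rw [decay, hm]
  rw [show m + 2 - 2 = m from rfl, ← pow_mul, ← pow_succ, ← Real.exp_nat_mul, one_div,
    ← Real.exp_log (show 0 < √((P p).n : ℝ) * |(P p).β 0| by positivity), ← Real.exp_neg]
  apply Real.exp_le_exp.2
  push_cast
  have : κ * (((d : ℝ) + 1) ^ (m + 1) * (-1 / κ)) = -((d : ℝ) + 1) ^ (m + 1) := by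
    field_simp
  nlinarith

/-- By the time condition its power `d + 1` is at most `n ^ (d / 2) / |β 0| ≤ n ^ (-ε)`. -/
lemma Selects.sqrt_mul_decay (H : Selects l P T i κ ε t₁) :
    Tendsto (fun p => √(P p).n * decay d κ (T p)) l (𝓝 0) := by
  have h1 : Tendsto (fun p => (√(P p).n * decay d κ (T p)) ^ (d + 1)) l (𝓝 0) := by
    refine squeeze_zero' (Eventually.of_forall fun p => ?_) ?_
      ((tendsto_rpow_neg_atTop H.eps_pos).comp H.n_atTop)
    · unfold decay; positivity
    filter_upwards [H.decay_pow_le, H.beta_ge, H.n_atTop.eventually_gt_atTop 0] with p h1 h2 h3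
    have hb : 0 < |(P p).β 0| := lt_of_lt_of_le (Real.rpow_pos_of_pos h3 _) h2
    have h4 : √((P p).n : ℝ) ^ d = ((P p).n : ℝ) ^ ((d : ℝ) / 2) := by
      rw [Real.sqrt_eq_rpow, ← Real.rpow_natCast, ← Real.rpow_mul h3.le]
      ring_nf
    calc (√((P p).n : ℝ) * decay d κ (T p)) ^ (d + 1)
        ≤ √((P p).n : ℝ) ^ (d + 1) * (1 / (√(P p).n * |(P p).β 0|)) := by
          rw [mul_pow]; gcongr
      _ = ((P p).n : ℝ) ^ ((d : ℝ) / 2) / |(P p).β 0| := by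
          rw [pow_succ, h4]; field_simp
      _ ≤ ((P p).n : ℝ) ^ ((d : ℝ) / 2) / ((P p).n : ℝ) ^ ((d : ℝ) / 2 + ε) := by gcongr
      _ = _ := by rw [← Real.rpow_sub h3]; simp
  have h2 := h1.rpow_const (p := ((d + 1 : ℕ) : ℝ)⁻¹) (Or.inr (by positivity))
  rw [Real.zero_rpow (by positivity)] at h2
  refine h2.congr fun p => ?_
  exact Real.pow_rpow_inv_natCast (by unfold decay; positivity) (by omega)

/-- Selection of spike `i`: the final iterate is the normalization of `v i + e`, up to the
predicted sign, where `β i • e` is the contracted noise up to `o(1 / √n)`. -/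
theorem Selects.limit (H : Selects l P T i κ ε t₁) (hM : 0 < M)
    (h1 : 1 / 2 ≤ ε * ((t₁ : ℝ) - 1)) (h2 : 2 ≤ t₁)
    (h3 : r * (κ * (1 - 1 / κ) ^ ((d + 1) ^ (t₁ - 1))) < 1)
    (h4 : 3 * (1 - 1 / κ) ^ ((d + 1) ^ t₁) < Real.exp (-1 / κ) ^ ((d + 1) ^ t₁))
    (h5 : Real.exp (-1 / κ) ^ ((d + 1) ^ t₁) * (8 * r) ≤ 1) :
    Tendsto (fun p => √(P p).n * ‖(P p).δ i (T p - 1)‖) l (𝓝 0) ∧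
    ∀ᶠ p in l, (P p).U (T p)
      = limitSign (d + 2) ((P p).β i) (T p) (inner ℝ (P p).u ((P p).v i)) •
        (‖(P p).v i + (P p).e i (T p - 1)‖⁻¹ • ((P p).v i + (P p).e i (T p - 1))) := by
  set Q := Real.exp (-1 / κ) with hQ
  have hκ := H.one_le_kappa
  have hQ0 : 0 ≤ Q := (Real.exp_pos _).le
  have hQ1 : Q ≤ 1 := by
    rw [hQ, Real.exp_le_one_iff]
    exact div_nonpos_of_nonpos_of_nonneg (by norm_num) (by linarith)
  set C : ℝ := 8 * (M * 2 ^ (d + 1)) with hC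
  set A : ι → ℝ := fun p => C / |(P p).β i| with hA
  have hC0 : 0 < C := by positivity
  have hr : (0 : ℝ) < r := by exact_mod_cast Nat.pos_of_ne_zero (NeZero.ne r)
  have hA0 : Tendsto A l (𝓝 0) := H.beta_atTop.const_div_atTop C
  have P1 := H.phaseOne hM
  have hdom := P1.eventually_dominates hκ H.eps_pos H.eps_le h1 h2 h3 h4
  have hpos := P1.eventually_one_add_pos hκ H.eps_pos H.eps_le
  have hP2 : ∀ᶠ p in l, PhaseTwo (P p).orbit i (A p) (κ ^ d) Q t₁ := by
    have hKA : Tendsto (fun p => κ ^ d * A p) l (𝓝 0) := by simpa using hA0.const_mul (κ ^ d)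
    filter_upwards [H.init, P1.gamma_le,
      hKA.eventually_le_const (show (0 : ℝ) < 1 / (8 * r) by positivity)] with p h6 h7 h8
    refine ⟨hM, H.d_pos, one_le_pow₀ hκ, h6.2.1, rfl, h7, h8, hQ0, hQ1, ?_⟩
    rw [le_div_iff₀ (by positivity)]; exact h5
  have hTt : ∀ᶠ p in l, t₁ + 2 ≤ T p := H.time_atTop.eventually_ge_atTop _
  have hh : Tendsto (fun p => √(P p).n * decay d κ (T p)) l (𝓝 0) := H.sqrt_mul_decay
  have hsA : Tendsto (fun p => √(P p).n * A p) l (𝓝 0) := by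
    have := H.sqrt_div_tendsto.const_mul C
    rw [mul_zero] at this
    refine this.congr fun p => ?_
    simp only [hA]; ring
  -- The quantity multiplied by `√n` dominates the perturbation at time `T - 2`.
  have hη : Tendsto (fun p => √(P p).n * (r * (A p + decay d κ (T p)) + A p)) l (𝓝 0) := by
    have := ((hsA.add hh).const_mul (r : ℝ)).add hsA
    simp only [add_zero, mul_zero] at this
    exact this.congr fun p => by ring
  have hdec0 : ∀ T, 0 ≤ decay d κ T := fun T => pow_nonneg hQ0 _
  have hApos : ∀ p, 0 ≤ A p := fun p => by simp only [hA]; positivity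
  have hη' : ∀ᶠ p in l, (d + 1) * (4 * (r * (A p + decay d κ (T p)) + A p)) ≤ 1 / 2 := by
    filter_upwards [hη.eventually_le_const (show (0 : ℝ) < 1 / 2 / (4 * (d + 1)) by positivity),
      H.n_atTop.eventually_ge_atTop 1] with p h6 h7
    have h8 : 1 ≤ √((P p).n : ℝ) := Real.one_le_sqrt.2 h7
    have h9 : 0 ≤ r * (A p + decay d κ (T p)) + A p := by
      have := hApos p; have := hdec0 (T p); positivity
    have h10 : r * (A p + decay d κ (T p)) + A p ≤ 1 / 2 / (4 * (d + 1)) := by nlinarith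
    rw [le_div_iff₀ (by positivity)] at h10
    linarith
  -- The perturbation at `T - 2` fixes the direction in which the noise is contracted next. One
  -- further step makes the competitors of second order, which compensates for the factor `|β i|`.
  have main : ∀ᶠ p in l, ‖(P p).δ i (T p - 1)‖ ≤ |(P p).β i| * (r * (κ ^ d * A p ^ 2
      + decay d κ (T p) ^ (d + 1) * (4 * A p + 2 * decay d κ (T p))))
      + M * (d + 2) * (10 * (r * (A p + decay d κ (T p)) + A p)) := by
    filter_upwards [hdom, hP2, hTt, hη'] with p hd hP hT hη'
    have hdt : ∀ t, t₁ ≤ t → Dominates (P p).orbit i (A p) Q t := fun t ht =>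
      hP.dominates (hd (A p)) ht
    obtain ⟨m, hm⟩ : ∃ m, T p = m + 2 := ⟨T p - 2, by omega⟩
    have hm' : T p - 1 = m + 1 := by omega
    have hdm : decay d κ (T p) = Q ^ ((d + 1) ^ m) := by
      rw [decay, hm]; rfl
    have hs := hP.s_bound (hdt m (by omega))
    rw [hm'] at *
    have hsum : ∀ (t : ℕ) (B : ℝ), 0 ≤ B →
        (∀ j, j ≠ i → (P p).orbit.ρ i t j * |(P p).orbit.y i t j| ≤ B) →
        ∑ j ∈ Finset.univ.erase i, (P p).orbit.ρ i t j * |(P p).orbit.y i t j| ≤ r * B := by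
      intro t B hB h
      calc _ ≤ (Finset.univ.erase i).card • B :=
            Finset.sum_le_card_nsmul _ _ _ fun j hj => h j (Finset.ne_of_mem_erase hj)
        _ ≤ r * B := by
            rw [nsmul_eq_mul]
            gcongr
            exact (Finset.card_le_univ _).trans_eq (Fintype.card_fin r)
    have hAp := hApos p
    have hdp := hdec0 (T p)
    refine (norm_delta_succ_le (η := r * (A p + decay d κ (T p)) + A p) hs.1 ?_ hη').trans ?_
    · refine norm_e_le.trans (add_le_add (hsum m _ (by positivity) fun j hj => ?_) ?_)
      · rw [hdm]; exact hP.rho_mul_y_le (by omega) (hdt m (by omega)) hj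
      · linarith [hs.2]
    · gcongr
      refine hsum (m + 1) _ (by positivity) fun j hj => ?_
      rw [hdm]
      exact hP.rho_mul_y_succ_le (by omega) (hdt m (by omega)) hj
  constructor
  · have hlim : Tendsto (fun p => r * (κ ^ d * C ^ 2 * (√(P p).n / |(P p).β i|) + (4 * (√(P p).n * A p)
        + 2 * (√(P p).n * decay d κ (T p)))) + M * (d + 2) * (10 *
        (√(P p).n * (r * (A p + decay d κ (T p)) + A p)))) l (𝓝 0) := by
      have := (((H.sqrt_div_tendsto.const_mul (κ ^ d * C ^ 2)).add ((hsA.const_mul 4).add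
        (hh.const_mul 2))).const_mul (r : ℝ)).add ((hη.const_mul 10).const_mul (M * (d + 2)))
      simpa using this
    refine squeeze_zero' (Eventually.of_forall fun p => by positivity) ?_ hlim
    filter_upwards [main, H.decay_pow_le, H.init, H.n_atTop.eventually_ge_atTop 1, H.beta_le]
      with p h6 h7 h8 h9 hle
    have hb : 0 < |(P p).β i| := abs_pos.2 h8.2.1
    have hsn : 1 ≤ √((P p).n : ℝ) := Real.one_le_sqrt.2 h9
    have hAp := hApos p
    have hdp := hdec0 (T p)
    -- The time condition is stated for the largest strength, which dominates `|β i|`.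
    have h10 : √((P p).n : ℝ) * |(P p).β i| * decay d κ (T p) ^ (d + 1) ≤ 1 := by
      have hb0 : |(P p).β i| ≤ |(P p).β 0| := hle i
      have hb1 := hb.trans_le hb0
      rw [le_div_iff₀ (by positivity)] at h7
      refine le_trans ?_ h7
      rw [mul_comm]
      gcongr
    have h11 : √((P p).n : ℝ) * |(P p).β i| * A p ^ 2 = C ^ 2 * (√(P p).n / |(P p).β i|) := by
      simp only [hA]; field_simp
    have hsA' : A p ≤ √((P p).n : ℝ) * A p := le_mul_of_one_le_left hAp hsn
    have hsD' : decay d κ (T p) ≤ √((P p).n : ℝ) * decay d κ (T p) :=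
      le_mul_of_one_le_left hdp hsn
    calc √((P p).n : ℝ) * ‖(P p).δ i (T p - 1)‖ ≤ √((P p).n : ℝ) * (|(P p).β i| * (r * (κ ^ d * A p ^ 2
          + decay d κ (T p) ^ (d + 1) * (4 * A p + 2 * decay d κ (T p))))
          + M * (d + 2) * (10 * (r * (A p + decay d κ (T p)) + A p))) := by gcongr
      _ = r * (κ ^ d * (√((P p).n : ℝ) * |(P p).β i| * A p ^ 2)
          + √((P p).n : ℝ) * |(P p).β i| * decay d κ (T p) ^ (d + 1)
            * (4 * A p + 2 * decay d κ (T p)))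
          + M * (d + 2) * (10 * (√((P p).n : ℝ) * (r * (A p + decay d κ (T p)) + A p))) := by ring
      _ ≤ r * (κ ^ d * (C ^ 2 * (√(P p).n / |(P p).β i|)) + 1 * (4 * (√((P p).n : ℝ) * A p)
            + 2 * (√((P p).n : ℝ) * decay d κ (T p))))
          + M * (d + 2) * (10 * (√((P p).n : ℝ) * (r * (A p + decay d κ (T p)) + A p))) := by
          rw [h11]
          gcongr
      _ = _ := by ring
  · filter_upwards [hdom, hP2, hTt, hpos] with p hd hP hT hpos
    have hdt : ∀ t, t₁ ≤ t → Dominates (P p).orbit i (A p) Q t := fun t ht =>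
      hP.dominates (hd (A p)) ht
    obtain ⟨m, hm⟩ : ∃ m, T p = m + 1 := ⟨T p - 1, by omega⟩
    have hne : ∀ t, (P p).orbit.s i t ≠ 0 := fun t => by
      rcases lt_or_ge t t₁ with ht | ht
      · exact (hpos t ht).1
      · exact (hP.s_bound (hdt t ht)).1
    have hpos' : ∀ t, 0 < 1 + (P p).orbit.z t i / (P p).orbit.s i t := fun t => by
      rcases lt_or_ge t t₁ with ht | ht
      · exact (hpos t ht).2
      · linarith [hP.one_add_ne (hdt t ht)]
    rw [hm, Nat.add_sub_cancel, U_succ (hne m),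
      sign_s_eq_limitSign (fun t _ => hne t) (fun t _ => hpos' t)]
    rfl

end Sample

end SpikedTensor

namespace SpikedTensor

/-! ### Second order expansion of a normalized perturbation. -/

section Normalize

variable {E : Type*} [NormedAddCommGroup E] [InnerProductSpace ℝ E] {v e a : E}

lemma norm_normalize_add (hv : ‖v‖ = 1) (he : ‖e‖ ≤ 1 / 2) : ‖‖v + e‖⁻¹ • (v + e)‖ = 1 := by
  refine norm_normalize fun h0 => ?_
  have : ‖v‖ ≤ ‖v + e‖ + ‖e‖ := by simpa using norm_sub_le (v + e) e
  rw [h0, norm_zero, hv] at this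
  linarith

lemma one_sub_inner_normalize (hv : ‖v‖ = 1) (he : ‖e‖ ≤ 1 / 2) :
    0 ≤ 1 - inner ℝ (‖v + e‖⁻¹ • (v + e)) v ∧
      1 - inner ℝ (‖v + e‖⁻¹ • (v + e)) v ≤ 2 * ‖e‖ ^ 2 := by
  have hw := norm_normalize_add hv he
  have h1 := norm_normalize_add_sub_le hv (he.trans_lt (by norm_num))
  set w := ‖v + e‖⁻¹ • (v + e)
  have h2 := norm_sub_sq_real w v
  rw [hw, hv] at h2
  have h3 : ‖w - v‖ ^ 2 ≤ (2 * ‖e‖) ^ 2 := by gcongr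
  have h4 := sq_nonneg ‖w - v‖
  constructor <;> nlinarith

/-- Second order expansion of the overlap of `v` with the normalization of `v + e`. -/
lemma abs_one_sub_inner_normalize_sub_le (hv : ‖v‖ = 1) (he : ‖e‖ ≤ 1 / 2) :
    |(1 - inner ℝ (‖v + e‖⁻¹ • (v + e)) v) - (‖e‖ ^ 2 - inner ℝ v e ^ 2) / 2| ≤ 8 * ‖e‖ ^ 3 := by
  obtain ⟨h1, h2⟩ := one_sub_inner_normalize hv he
  have h3 : |‖v + e‖ - 1| ≤ ‖e‖ := by
    rw [← hv]
    refine (abs_norm_sub_norm_le _ _).trans ?_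
    simp
  have h4 := abs_le.1 h3
  have h5 : 0 < ‖v + e‖ := by linarith [h4.1]
  have h6 : inner ℝ (‖v + e‖⁻¹ • (v + e)) v * ‖v + e‖ = 1 + inner ℝ v e := by
    rw [inner_smul_left, inner_add_left, real_inner_self_eq_norm_sq, hv, real_inner_comm]
    simp; field_simp
  have h7 := norm_add_sq_real v e
  rw [hv] at h7
  set x : ℝ := inner ℝ (‖v + e‖⁻¹ • (v + e)) v
  set N := ‖v + e‖
  set q := ‖e‖ ^ 2 - (inner ℝ v e : ℝ) ^ 2 with hq
  -- Both sides are the squared length of the component of `v + e` orthogonal to `v`.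
  have h8 : q = N ^ 2 * (1 - x) * (1 + x) := by
    have : (x * N) ^ 2 = (1 + inner ℝ v e) ^ 2 := by rw [h6]
    rw [hq]; nlinarith
  have h9 : (1 - x) - q / 2 = (1 - x) * ((1 - N ^ 2) + N ^ 2 * (1 - x) / 2) := by
    rw [h8]; ring
  have hN : N ≤ 3 / 2 := by linarith
  have he0 := norm_nonneg e
  have h10 : |1 - N ^ 2| ≤ 5 / 2 * ‖e‖ := by
    rw [abs_le]; constructor <;> nlinarith
  have h11 : 0 ≤ N ^ 2 * (1 - x) / 2 := by positivity
  have h12 : N ^ 2 * (1 - x) / 2 ≤ 3 / 2 * ‖e‖ := by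
    have : N ^ 2 ≤ 9 / 4 := by nlinarith
    have h13 : 1 - x ≤ ‖e‖ := by nlinarith
    nlinarith
  rw [h9, abs_mul, abs_of_nonneg h1]
  calc (1 - x) * |1 - N ^ 2 + N ^ 2 * (1 - x) / 2| ≤ (2 * ‖e‖ ^ 2) * (4 * ‖e‖) := by
        gcongr
        refine (abs_add_le _ _).trans ?_
        rw [abs_of_nonneg h11]
        linarith
    _ = _ := by ring

lemma norm_sub_inner_smul_sq (hv : ‖v‖ = 1) (ha : ‖a‖ = 1) :
    ‖a - (inner ℝ a v : ℝ) • v‖ ^ 2 = 1 - inner ℝ a v ^ 2 := by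
  rw [norm_sub_sq_real, norm_smul, inner_smul_right, hv, ha, Real.norm_eq_abs, mul_one, sq_abs]
  ring

lemma norm_sub_inner_smul (hv : ‖v‖ = 1) (ha : ‖a‖ = 1) :
    ‖a - (inner ℝ a v : ℝ) • v‖ = √(1 - inner ℝ a v ^ 2) := by
  rw [← norm_sub_inner_smul_sq hv ha, Real.sqrt_sq (norm_nonneg _)]

lemma inner_sub_inner_smul_self (hv : ‖v‖ = 1) : inner ℝ (a - (inner ℝ a v : ℝ) • v) v = 0 := by
  rw [inner_sub_left, inner_smul_left, real_inner_self_eq_norm_sq, hv]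
  simp

/-- The component of the contracted noise orthogonal to `v` has squared length close to one; this is
where the constant in the bias `1 / (2 β ^ 2)` comes from. -/
lemma abs_perturbed_norm_sq_le {g δ : E} {M : ℝ} (hv : ‖v‖ = 1) (hg : ‖g‖ ≤ M)
    (hδ : ‖δ‖ ≤ 1) : |‖g + δ‖ ^ 2 - inner ℝ v (g + δ) ^ 2 - 1|
      ≤ |‖g‖ ^ 2 - 1| + 2 * inner ℝ v g ^ 2 + (2 * M + 3) * ‖δ‖ := by
  have e2 : |2 * (inner ℝ g δ : ℝ) + ‖δ‖ ^ 2| ≤ (2 * M + 1) * ‖δ‖ := by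
    have i1 : |(inner ℝ g δ : ℝ)| ≤ M * ‖δ‖ :=
      (abs_real_inner_le_norm _ _).trans (by gcongr)
    have i2 := abs_le.1 i1
    have i3 := norm_nonneg δ
    rw [abs_le]; constructor <;> nlinarith
  have e3 : (inner ℝ v g + inner ℝ v δ : ℝ) ^ 2 ≤ 2 * inner ℝ v g ^ 2 + 2 * ‖δ‖ := by
    have i1 : |(inner ℝ v δ : ℝ)| ≤ ‖δ‖ := by simpa [hv] using abs_real_inner_le_norm v δ
    have i2 : (inner ℝ v δ : ℝ) ^ 2 ≤ ‖δ‖ := by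
      rw [← sq_abs]
      have := abs_nonneg (inner ℝ v δ : ℝ)
      nlinarith
    nlinarith [sq_nonneg ((inner ℝ v g : ℝ) - inner ℝ v δ)]
  rw [norm_add_sq_real, inner_add_right]
  have i2 := abs_le.1 e2
  have i3 := neg_abs_le (‖g‖ ^ 2 - 1)
  have i4 := le_abs_self (‖g‖ ^ 2 - 1)
  have i5 := sq_nonneg (inner ℝ v g + inner ℝ v δ : ℝ)
  have i6 := sq_nonneg (inner ℝ v g : ℝ)
  have i7 := norm_nonneg δ
  rw [abs_le]
  constructor <;> linarith

/-- The fluctuation of a linear functional of the normalization of `v + β⁻¹ (g + δ)`. -/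
lemma abs_linear_fluctuation_le {g δ : E} {β M N A : ℝ} (hv : ‖v‖ = 1) (ha : ‖a‖ = 1)
    (hA : A = √(1 - inner ℝ a v ^ 2)) (hA0 : 0 < A) (hM : 0 ≤ M) (hN : 0 ≤ N) (hβ : 0 < |β|)
    (hg : ‖g‖ ≤ M) (hδ : ‖δ‖ ≤ 1) (he : e = β⁻¹ • (g + δ)) (he2 : ‖e‖ ≤ 1 / 2) :
    |N * β / A * (inner ℝ a (‖v + e‖⁻¹ • (v + e)) - (1 - 1 / (2 * β ^ 2)) * inner ℝ a v)
        - N * inner ℝ (a - (inner ℝ a v : ℝ) • v) g / A|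
      ≤ N / (A * |β|) * (8 * (M + 1) ^ 3 / |β| + |‖g‖ ^ 2 - 1| + 2 * inner ℝ v g ^ 2
          + (2 * M + 3) * ‖δ‖) + (2 * (N * ‖δ‖) + 2 * M * (M + 1) * (N / |β|)) := by
  have hβ0 : β ≠ 0 := abs_pos.1 hβ
  have hα : |(inner ℝ a v : ℝ)| ≤ 1 := by
    simpa [hv, ha] using abs_real_inner_le_norm a v
  have hperp := norm_sub_inner_smul hv ha
  have horth := inner_sub_inner_smul_self (a := a) hv
  rw [← hA] at hperp
  have hexp := abs_one_sub_inner_normalize_sub_le hv he2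
  set α : ℝ := inner ℝ a v with hαd
  set p := a - α • v with hp
  have hen : ‖e‖ ≤ (M + 1) / |β| := by
    rw [he, norm_smul, norm_inv, Real.norm_eq_abs, inv_mul_eq_div]
    gcongr
    exact (norm_add_le _ _).trans (add_le_add hg hδ)
  have h3 : |‖v + e‖ - 1| ≤ ‖e‖ := by
    rw [← hv]
    refine (abs_norm_sub_norm_le _ _).trans ?_
    simp
  have h4 := abs_le.1 h3
  have h5 : 1 / 2 ≤ ‖v + e‖ := by linarith [h4.1]
  set x : ℝ := inner ℝ (‖v + e‖⁻¹ • (v + e)) v with hx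
  have hpe : inner ℝ p (‖v + e‖⁻¹ • (v + e)) = ‖v + e‖⁻¹ * (β⁻¹ * (inner ℝ p g + inner ℝ p δ)) := by
    rw [inner_smul_right, inner_add_right, horth, he, inner_smul_right, inner_add_right]
    ring
  have hsplit : inner ℝ a (‖v + e‖⁻¹ • (v + e))
      = α * x + ‖v + e‖⁻¹ * (β⁻¹ * (inner ℝ p g + inner ℝ p δ)) := by
    rw [← hpe, hp, inner_sub_left, inner_smul_left, hx, real_inner_comm v]
    simp
  have hpg : |(inner ℝ p g : ℝ)| ≤ A * M := (abs_real_inner_le_norm _ _).trans (by rw [hperp]; gcongr)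
  have hpδ : |(inner ℝ p δ : ℝ)| ≤ A * ‖δ‖ := (abs_real_inner_le_norm _ _).trans (by rw [hperp])
  have hinv : |‖v + e‖⁻¹ - 1| ≤ 2 * ‖e‖ := by
    have : ‖v + e‖⁻¹ - 1 = ‖v + e‖⁻¹ * (1 - ‖v + e‖) := by field_simp
    rw [this, abs_mul, abs_sub_comm, abs_of_pos (by positivity)]
    have : ‖v + e‖⁻¹ ≤ 2 := by
      rw [inv_le_comm₀ (by linarith) (by norm_num)]; linarith
    gcongr
  have hinv2 : |‖v + e‖⁻¹| ≤ 2 := by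
    rw [abs_of_pos (by positivity), inv_le_comm₀ (by linarith) (by norm_num)]; linarith
  have hq : β ^ 2 * (‖e‖ ^ 2 - inner ℝ v e ^ 2) = ‖g + δ‖ ^ 2 - inner ℝ v (g + δ) ^ 2 := by
    rw [he, norm_smul, inner_smul_right, norm_inv, Real.norm_eq_abs, mul_pow, mul_pow, inv_pow,
      sq_abs]
    field_simp
  have hβx : |β ^ 2 * (1 - x) - 1 / 2| ≤ 8 * (M + 1) ^ 3 / |β| + |‖g‖ ^ 2 - 1|
      + 2 * inner ℝ v g ^ 2 + (2 * M + 3) * ‖δ‖ := by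
    have e1 : |β ^ 2 * ((1 - x) - (‖e‖ ^ 2 - inner ℝ v e ^ 2) / 2)| ≤ 8 * (M + 1) ^ 3 / |β| := by
      rw [abs_mul, abs_pow]
      calc |β| ^ 2 * _ ≤ |β| ^ 2 * (8 * ((M + 1) / |β|) ^ 3) := by
            gcongr
            exact hexp.trans (by gcongr)
        _ = _ := by field_simp
    have e2 := abs_perturbed_norm_sq_le hv hg hδ
    have e4 : β ^ 2 * (1 - x) - 1 / 2 = β ^ 2 * ((1 - x) - (‖e‖ ^ 2 - inner ℝ v e ^ 2) / 2)
        + (‖g + δ‖ ^ 2 - inner ℝ v (g + δ) ^ 2 - 1) / 2 := by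
      linear_combination hq / 2
    have i1 := abs_le.1 e1
    have i2 := abs_le.1 e2
    have i3 : 0 ≤ |‖g‖ ^ 2 - 1| := abs_nonneg _
    have i6 := sq_nonneg (inner ℝ v g : ℝ)
    have i7 : 0 ≤ (2 * M + 3) * ‖δ‖ := by positivity
    rw [e4, abs_le]
    constructor <;> linarith
  -- With `a = α v + p`, the part along `v` leaves only the error of the bias, and `p` gives the
  -- Gaussian term with its remainders. The prefactor `N / (A β)` need not be small, so the bias has
  -- to be resolved to this precision.
  have key : N * β / A * (inner ℝ a (‖v + e‖⁻¹ • (v + e)) - (1 - 1 / (2 * β ^ 2)) * α)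
        - N * inner ℝ p g / A
      = N / (A * β) * (-(α * (β ^ 2 * (1 - x) - 1 / 2)))
        + (‖v + e‖⁻¹ * (N * (inner ℝ p δ / A)) + (‖v + e‖⁻¹ - 1) * (N * (inner ℝ p g / A))) := by
    rw [hsplit]
    have : ‖v + e‖ ≠ 0 := by linarith
    field_simp
    ring
  have j1 : |(inner ℝ p δ : ℝ) / A| ≤ ‖δ‖ := by
    rw [abs_div, abs_of_pos hA0, div_le_iff₀ hA0]; linarith
  have j2 : |(inner ℝ p g : ℝ) / A| ≤ M := by
    rw [abs_div, abs_of_pos hA0, div_le_iff₀ hA0]; linarith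
  rw [key]
  refine (abs_add_le _ _).trans (add_le_add ?_ ((abs_add_le _ _).trans (add_le_add ?_ ?_)))
  · rw [abs_mul, abs_div, abs_neg, abs_mul A, abs_of_nonneg hN, abs_of_pos hA0, abs_mul α]
    gcongr
    refine le_trans ?_ hβx
    exact mul_le_of_le_one_left (abs_nonneg _) hα
  · rw [abs_mul, abs_mul, abs_of_nonneg hN]
    gcongr
  · rw [abs_mul, abs_mul, abs_of_nonneg hN]
    calc |‖v + e‖⁻¹ - 1| * (N * |inner ℝ p g / A|) ≤ (2 * ((M + 1) / |β|)) * (N * M) := by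
          gcongr
          exact hinv.trans (by gcongr)
      _ = _ := by ring

/-- Serves to replace the true normalization by the estimated one. As `⟨p, v⟩ = 0`, the orthogonal
part contributes at most `2 A ‖e‖`, so the relative error is governed by `‖e‖ / A`; smallness of
this ratio is what non-alignment provides. -/
lemma abs_one_sub_inner_sq_div_sub_one_le {A h : ℝ} (hv : ‖v‖ = 1) (ha : ‖a‖ = 1)
    (hA : A = √(1 - inner ℝ a v ^ 2)) (hA0 : 0 < A) (he : ‖e‖ ≤ 1 / 2) (hh : ‖e‖ / A ≤ h) :
    |(1 - inner ℝ a (‖v + e‖⁻¹ • (v + e)) ^ 2) / A ^ 2 - 1| ≤ 8 * h ^ 2 + 4 * h := by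
  have hα : |(inner ℝ a v : ℝ)| ≤ 1 := by
    simpa [hv, ha] using abs_real_inner_le_norm a v
  have hAsq : A ^ 2 = 1 - inner ℝ a v ^ 2 := by
    rw [hA, Real.sq_sqrt]
    have := (sq_le_one_iff_abs_le_one _).2 hα
    linarith
  have hperp := norm_sub_inner_smul hv ha
  have horth := inner_sub_inner_smul_self (a := a) hv
  rw [← hA] at hperp
  obtain ⟨h1, h2⟩ := one_sub_inner_normalize hv he
  have h3 := norm_normalize_add_sub_le hv (he.trans_lt (by norm_num))
  set w := ‖v + e‖⁻¹ • (v + e) with hw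
  set α : ℝ := inner ℝ a v with hαd
  set p := a - α • v with hp
  set x : ℝ := inner ℝ w v with hx
  have hsplit : inner ℝ a w = α * x + inner ℝ p w := by
    rw [hp, inner_sub_left, inner_smul_left, hx, real_inner_comm v w]; simp
  have hpw : |(inner ℝ p w : ℝ)| ≤ A * (2 * ‖e‖) := by
    have : (inner ℝ p w : ℝ) = inner ℝ p (w - v) := by rw [inner_sub_right, horth, sub_zero]
    rw [this]
    refine (abs_real_inner_le_norm _ _).trans ?_
    rw [hperp]; gcongr
  have hA1 : A ≤ 1 := by nlinarith [sq_nonneg α]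
  have he0 := norm_nonneg e
  have hee : ‖e‖ ≤ h * A := by rwa [div_le_iff₀ hA0] at hh
  have hh0 : 0 ≤ h := le_trans (by positivity) hh
  have hpw' : |(inner ℝ p w : ℝ)| ≤ 2 * h * A ^ 2 := hpw.trans (by nlinarith)
  have hx1 : |x| ≤ 1 := by
    rw [abs_le]; constructor <;> nlinarith
  have hb : |(1 - inner ℝ a w ^ 2) - A ^ 2| ≤ (8 * h ^ 2 + 4 * h) * A ^ 2 := by
    rw [hsplit, hAsq]
    have k1 : (1 - (α * x + inner ℝ p w) ^ 2) - (1 - α ^ 2)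
        = α ^ 2 * ((1 - x) * (1 + x)) + (-(2 * (α * x) * inner ℝ p w) + -(inner ℝ p w ^ 2)) := by ring
    rw [k1]
    have k2 : |α ^ 2 * ((1 - x) * (1 + x))| ≤ 4 * h ^ 2 * A ^ 2 := by
      have : α ^ 2 ≤ 1 := (sq_le_one_iff_abs_le_one _).2 hα
      have hx2 := abs_le.1 hx1
      have : (1 - x) * (1 + x) ≤ 4 * ‖e‖ ^ 2 := by nlinarith
      have h6 : 0 ≤ (1 - x) * (1 + x) := mul_nonneg h1 (by linarith)
      have h7 : ‖e‖ ^ 2 ≤ h ^ 2 * A ^ 2 := by rw [← mul_pow]; gcongr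
      rw [abs_of_nonneg (by positivity)]
      nlinarith
    have k3 : |2 * (α * x) * inner ℝ p w| ≤ 4 * h * A ^ 2 := by
      rw [abs_mul, abs_mul, abs_mul, abs_two]
      have : |α| * |x| ≤ 1 := mul_le_one₀ hα (abs_nonneg _) hx1
      have := abs_nonneg (inner ℝ p w : ℝ)
      nlinarith
    have k4 : |(inner ℝ p w : ℝ) ^ 2| ≤ 4 * h ^ 2 * A ^ 2 := by
      rw [abs_pow]
      calc _ ≤ (2 * h * A ^ 2) ^ 2 := by gcongr
        _ = 4 * h ^ 2 * A ^ 2 * A ^ 2 := by ring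
        _ ≤ _ := mul_le_of_le_one_right (by positivity) (by nlinarith)
    rw [← hAsq]
    refine (abs_add_le _ _).trans ((add_le_add k2 ((abs_add_le _ _).trans (add_le_add
      ((abs_neg _).trans_le k3) ((abs_neg _).trans_le k4)))).trans (by linarith))
  have : (1 - inner ℝ a w ^ 2) / A ^ 2 - 1 = ((1 - inner ℝ a w ^ 2) - A ^ 2) / A ^ 2 := by
    field_simp
  rw [this, abs_div, abs_of_pos (show 0 < A ^ 2 by positivity), div_le_iff₀ (by positivity)]
  exact hb

end Normalize

/-! ### Expansion of the estimated strength. -/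

namespace Sample

variable {r d : ℕ} {M : ℝ} {S : Sample r d M} {i : Fin r}

/-- The strength of the observation in the direction of the normalization of `v i + e`. -/
lemma abs_strength_fluctuation_le {e : EuclideanSpace ℝ (Fin S.n)} {K : ℝ} (hβ : 0 < |S.β i|)
    (hK : ∀ j, |S.β j| ≤ K * |S.β i|)
    (he : ‖e‖ ≤ (M + 1) / |S.β i|) (he2 : ‖e‖ ≤ 1 / 2) :
    |tinner S.X (tpow (d + 2) (‖S.v i + e‖⁻¹ • (S.v i + e))) - S.β i
        - tinner S.Z (tpow (d + 2) (S.v i))|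
      ≤ ((d + 2) * (2 * (M + 1) ^ 2) + r * (K * (4 * (M + 1) ^ 2))
          + M * (d + 2) * (2 * (M + 1))) / |S.β i| := by
  have hv := S.ortho.1 i
  have hM := S.M_pos
  have hw := norm_normalize_add hv he2
  obtain ⟨h1, h2⟩ := one_sub_inner_normalize hv he2
  have h3 := norm_normalize_add_sub_le hv (he2.trans_lt (by norm_num))
  set w := ‖S.v i + e‖⁻¹ • (S.v i + e) with hwd
  set x : ℝ := inner ℝ w (S.v i) with hx
  have he0 := norm_nonneg e
  have hK0 : 0 ≤ K := by
    have := (abs_nonneg _).trans (hK i)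
    exact nonneg_of_mul_nonneg_left this hβ
  have hsq : |S.β i| * ‖e‖ ^ 2 ≤ (M + 1) ^ 2 / |S.β i| := by
    calc _ ≤ |S.β i| * ((M + 1) / |S.β i|) ^ 2 := by gcongr
      _ = _ := by field_simp
  have hx0 : 1 / 2 ≤ x := by nlinarith
  have hxk : |S.β i * x ^ (d + 2) - S.β i| ≤ (d + 2) * (2 * (M + 1) ^ 2) / |S.β i| := by
    have h4 : 1 - (d + 2) * (1 - x) ≤ x ^ (d + 2) := by
      have := one_add_mul_le_pow (a := x - 1) (by linarith) (d + 2)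
      push_cast at this
      calc _ = 1 + ((d : ℝ) + 2) * (x - 1) := by ring
        _ ≤ (1 + (x - 1)) ^ (d + 2) := this
        _ = _ := by ring_nf
    have h5 : x ^ (d + 2) ≤ 1 := pow_le_one₀ (by linarith) (by linarith)
    have h6 : |x ^ (d + 2) - 1| ≤ (d + 2) * (2 * ‖e‖ ^ 2) := by
      rw [abs_sub_comm, abs_of_nonneg (by linarith)]
      have : ((d : ℝ) + 2) * (1 - x) ≤ (d + 2) * (2 * ‖e‖ ^ 2) := by gcongr
      linarith
    calc _ = |S.β i| * |x ^ (d + 2) - 1| := by rw [← abs_mul]; ring_nf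
      _ ≤ |S.β i| * ((d + 2) * (2 * ‖e‖ ^ 2)) := by gcongr
      _ = (d + 2) * 2 * (|S.β i| * ‖e‖ ^ 2) := by ring
      _ ≤ (d + 2) * 2 * ((M + 1) ^ 2 / |S.β i|) := by gcongr
      _ = _ := by ring
  -- By orthogonality `⟨w, v j⟩` is of the order of `e`, and it enters with exponent at least two.
  have hj : ∀ j ∈ Finset.univ.erase i, |S.β j * inner ℝ w (S.v j) ^ (d + 2)|
      ≤ K * (4 * (M + 1) ^ 2) / |S.β i| := by
    intro j hj
    have hji : i ≠ j := (Finset.ne_of_mem_erase hj).symm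
    have h4 : |(inner ℝ w (S.v j) : ℝ)| ≤ 2 * ‖e‖ := by
      have : (inner ℝ w (S.v j) : ℝ) = inner ℝ (w - S.v i) (S.v j) := by
        rw [inner_sub_left, S.ortho.2 hji, sub_zero]
      rw [this]
      refine (abs_real_inner_le_norm _ _).trans ?_
      rw [S.ortho.1 j, mul_one]; exact h3
    have h5 : |(inner ℝ w (S.v j) : ℝ)| ^ (d + 2) ≤ 4 * ‖e‖ ^ 2 := by
      calc _ ≤ (2 * ‖e‖) ^ (d + 2) := by gcongr
        _ ≤ (2 * ‖e‖) ^ 2 := pow_le_pow_of_le_one (by positivity) (by linarith) (by omega)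
        _ = _ := by ring
    rw [abs_mul, abs_pow]
    calc _ ≤ (K * |S.β i|) * (4 * ‖e‖ ^ 2) := by gcongr; exact hK j
      _ = K * 4 * (|S.β i| * ‖e‖ ^ 2) := by ring
      _ ≤ K * 4 * ((M + 1) ^ 2 / |S.β i|) := by gcongr
      _ = _ := by ring
  have hsum : |∑ j ∈ Finset.univ.erase i, S.β j * inner ℝ w (S.v j) ^ (d + 2)|
      ≤ r * (K * (4 * (M + 1) ^ 2)) / |S.β i| := by
    refine (Finset.abs_sum_le_sum_abs _ _).trans ?_
    refine (Finset.sum_le_card_nsmul _ _ _ hj).trans ?_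
    rw [nsmul_eq_mul, mul_div_assoc (r : ℝ)]
    gcongr
    exact (Finset.card_le_univ _).trans_eq (Fintype.card_fin r)
  have hZ := S.op.abs_tinner_tpow_sub_le hM.le hw.le hv.le
  have hZ' : M * ((d + 2 : ℕ) : ℝ) * ‖w - S.v i‖ ≤ M * (d + 2) * (2 * (M + 1)) / |S.β i| := by
    push_cast
    calc _ ≤ M * (d + 2) * (2 * ((M + 1) / |S.β i|)) := by gcongr; linarith
      _ = _ := by ring
  have hdec : tinner S.X (tpow (d + 2) w) - S.β i - tinner S.Z (tpow (d + 2) (S.v i))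
      = (S.β i * x ^ (d + 2) - S.β i) + ((∑ j ∈ Finset.univ.erase i,
          S.β j * inner ℝ w (S.v j) ^ (d + 2))
        + (tinner S.Z (tpow (d + 2) w) - tinner S.Z (tpow (d + 2) (S.v i)))) := by
    rw [X, tinner_add_left, tinner_signal_tpow, ← Finset.add_sum_erase _ _ (Finset.mem_univ i)]
    ring
  rw [hdec]
  refine (abs_add_le _ _).trans ((add_le_add hxk ((abs_add_le _ _).trans
    (add_le_add hsum (hZ.trans hZ')))).trans_eq ?_)
  ring

end Sample

end SpikedTensor

/-! ### Limits of the two statistics once a spike has been selected. -/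

namespace SpikedTensor

lemma abs_inv_sqrt_sub_one_le {q : ℝ} (hq : 1 / 2 ≤ q) : |(√q)⁻¹ - 1| ≤ |q - 1| := by
  have h0 : 0 ≤ q := by linarith
  have h1 := Real.sq_sqrt h0
  have h2 : 0 < √q := Real.sqrt_pos.2 (by linarith)
  have h3 : 1 ≤ √q * (1 + √q) := by
    rcases le_total 1 q with h | h
    · nlinarith
    · have : q ≤ √q := by nlinarith [Real.sqrt_le_one.2 h]
      nlinarith
  have h4 : (√q)⁻¹ - 1 = (1 - q) / (√q * (1 + √q)) := by
    rw [eq_div_iff (by positivity)]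
    field_simp
    nlinarith
  rw [h4, abs_div, abs_of_pos (show 0 < √q * (1 + √q) by positivity), div_le_iff₀ (by positivity),
    abs_sub_comm]
  exact le_mul_of_one_le_right (abs_nonneg _) h3

lemma abs_inv_sq_sub_inv_sq_le {b β η : ℝ} (hβ : β ≠ 0) (h : |b / β - 1| ≤ η) (hη : η ≤ 1 / 2) :
    |1 / (2 * b ^ 2) - 1 / (2 * β ^ 2)| ≤ 5 * η / β ^ 2 := by
  set c := b / β with hc
  have hb : b = c * β := by rw [hc]; field_simp
  have h1 := abs_le.1 h
  have hc0 : 1 / 2 ≤ c := by linarith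
  have hc1 : c ≤ 3 / 2 := by linarith
  have h2 : 1 / (2 * b ^ 2) - 1 / (2 * β ^ 2) = ((1 - c) * (1 + c) / (2 * c ^ 2)) / β ^ 2 := by
    rw [hb]
    have : c ≠ 0 := by linarith
    field_simp
    ring
  rw [h2, abs_div, abs_of_pos (show 0 < β ^ 2 by positivity)]
  gcongr
  rw [abs_div, abs_mul, abs_sub_comm 1 c, abs_of_pos (show 0 < 1 + c by linarith),
    abs_of_pos (show 0 < 2 * c ^ 2 by positivity), div_le_iff₀ (by positivity)]
  have h0 := abs_nonneg (c - 1)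
  have h3 : |c - 1| * (1 + c) ≤ η * (5 / 2) :=
    mul_le_mul h (by linarith) (by linarith) (h0.trans h)
  have h4 : 1 / 4 ≤ c ^ 2 := by nlinarith
  nlinarith [mul_le_mul_of_nonneg_left h4 (h0.trans h)]

namespace Sample

variable {r d : ℕ} {M : ℝ} {i : Fin r} {ι : Type*} {l : Filter ι} {P : ι → Sample r d M}
  {V : (p : ι) → EuclideanSpace ℝ (Fin (P p).n)}
  {δ : (p : ι) → EuclideanSpace ℝ (Fin (P p).n)} {s K : ℝ}

/-- The unit vectors `V` are the normalizations of `s (v i + (β i)⁻¹ (g + δ))`, where `g` is the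
contracted noise and `δ = o(1 / √n)`. -/
structure Recovers (l : Filter ι) (P : ι → Sample r d M) (i : Fin r)
    (V δ : (p : ι) → EuclideanSpace ℝ (Fin (P p).n)) (s K : ℝ) : Prop where
  sign_sq : s * s = 1
  n_ge : ∀ᶠ p in l, 1 ≤ √((P p).n : ℝ)
  beta_le : ∀ᶠ p in l, ∀ j, |(P p).β j| ≤ K * |(P p).β i|
  beta_atTop : Tendsto (fun p => |(P p).β i|) l atTop
  sqrt_div : Tendsto (fun p => √(P p).n / |(P p).β i|) l (𝓝 0)
  delta : Tendsto (fun p => √(P p).n * ‖δ p‖) l (𝓝 0)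
  eq : ∀ᶠ p in l, V p = s •
    (‖(P p).v i + ((P p).β i)⁻¹ • (contract (P p).Z ((P p).v i) + δ p)‖⁻¹ •
      ((P p).v i + ((P p).β i)⁻¹ • (contract (P p).Z ((P p).v i) + δ p)))

namespace Recovers

lemma eventually_small (H : Recovers l P i V δ s K) (hM : 0 < M) : ∀ᶠ p in l, 0 < |(P p).β i| ∧ ‖δ p‖ ≤ 1 ∧
    ‖((P p).β i)⁻¹ • (contract (P p).Z ((P p).v i) + δ p)‖ ≤ (M + 1) / |(P p).β i| ∧
    ‖((P p).β i)⁻¹ • (contract (P p).Z ((P p).v i) + δ p)‖ ≤ 1 / 2 := by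
  filter_upwards [H.beta_atTop.eventually_ge_atTop (2 * (M + 1)), H.n_ge,
    H.delta.eventually_le_const zero_lt_one] with p h1 h2 h3
  have hb : 0 < |(P p).β i| := by linarith
  have hδ : ‖δ p‖ ≤ 1 := by nlinarith [norm_nonneg (δ p)]
  have he : ‖((P p).β i)⁻¹ • (contract (P p).Z ((P p).v i) + δ p)‖ ≤ (M + 1) / |(P p).β i| := by
    rw [norm_smul, norm_inv, Real.norm_eq_abs, inv_mul_eq_div]
    gcongr
    exact (norm_add_le _ _).trans (add_le_add
      ((P p).op.norm_contract_le hM.le ((P p).ortho.1 i).le) hδ)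
  refine ⟨hb, hδ, he, he.trans ?_⟩
  rw [div_le_iff₀ hb]
  linarith

lemma eventually_norm_eq_one (H : Recovers l P i V δ s K) (hM : 0 < M) : ∀ᶠ p in l, ‖V p‖ = 1 := by
  filter_upwards [H.eventually_small hM, H.eq] with p ⟨_, _, _, he2⟩ hV
  have hs1 : |s| = 1 := by
    rw [← sq_eq_sq₀ (abs_nonneg _) zero_le_one, sq_abs, sq, H.sign_sq, one_pow]
  rw [hV, norm_smul, Real.norm_eq_abs, hs1, one_mul, norm_normalize_add ((P p).ortho.1 i) he2]

/-- The constant of the expansion of the estimated strength. -/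
noncomputable def strengthConst (r d : ℕ) (M K : ℝ) : ℝ :=
  (d + 2) * (2 * (M + 1) ^ 2) + r * (K * (4 * (M + 1) ^ 2)) + M * (d + 2) * (2 * (M + 1))

lemma sign_pow_abs (H : Recovers l P i V δ s K) (m : ℕ) : |s ^ m| = 1 := by
  have : |s| = 1 := by
    rw [← sq_eq_sq₀ (abs_nonneg _) zero_le_one, sq_abs, sq, H.sign_sq, one_pow]
  rw [abs_pow, this, one_pow]

lemma abs_strength_sub_le (H : Recovers l P i V δ s K) (hM : 0 < M) : ∀ᶠ p in l,
    |tinner (P p).X (tpow (d + 2) (V p)) - s ^ (d + 2) * (P p).β i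
      - s ^ (d + 2) * tinner (P p).Z (tpow (d + 2) ((P p).v i))|
      ≤ strengthConst r d M K / |(P p).β i| := by
  filter_upwards [H.eventually_small hM, H.eq, H.beta_le] with p ⟨hb, _, he, he2⟩ hV hK
  have := abs_strength_fluctuation_le hb hK he he2
  rw [hV, tinner_tpow_smul, ← mul_sub, ← mul_sub, abs_mul, H.sign_pow_abs, one_mul]
  exact this

theorem tendsto_strength (H : Recovers l P i V δ s K) (hM : 0 < M) :
    Tendsto (fun p => √(P p).n * (tinner (P p).X (tpow (d + 2) (V p)) - s ^ (d + 2) * (P p).β i)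
      - s ^ (d + 2) * (√(P p).n * tinner (P p).Z (tpow (d + 2) ((P p).v i)))) l (𝓝 0) := by
  refine squeeze_zero_norm' ?_
    (by simpa using H.sqrt_div.const_mul (strengthConst r d M K))
  filter_upwards [H.abs_strength_sub_le hM] with p h
  rw [Real.norm_eq_abs]
  calc _ = √(P p).n * |tinner (P p).X (tpow (d + 2) (V p)) - s ^ (d + 2) * (P p).β i
        - s ^ (d + 2) * tinner (P p).Z (tpow (d + 2) ((P p).v i))| := by
        rw [← abs_of_nonneg (Real.sqrt_nonneg ((P p).n : ℝ)), ← abs_mul,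
          abs_of_nonneg (Real.sqrt_nonneg ((P p).n : ℝ))]
        ring_nf
    _ ≤ √(P p).n * (strengthConst r d M K / |(P p).β i|) := by gcongr
    _ = _ := by ring

/-- The noise term `⟨Z, v i ^ ⊗k⟩` is at most `M`, and the remainder is eventually at most `1`. -/
lemma abs_ratio_sub_one_le (H : Recovers l P i V δ s K) (hM : 0 < M) : ∀ᶠ p in l,
    |s ^ (d + 2) * tinner (P p).X (tpow (d + 2) (V p)) / (P p).β i - 1|
      ≤ (M + 1) / |(P p).β i| := by
  filter_upwards [H.eventually_small hM, H.abs_strength_sub_le hM,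
    H.beta_atTop.eventually_ge_atTop (strengthConst r d M K)] with p ⟨hb, _⟩ h1 h2
  have hs : s ^ (d + 2) * s ^ (d + 2) = 1 := by rw [← mul_pow, H.sign_sq, one_pow]
  have hZ : |tinner (P p).Z (tpow (d + 2) ((P p).v i))| ≤ M := by
    refine ((P p).op fun _ => (P p).v i).trans ?_
    simp [(P p).ortho.1 i]
  have h3 : strengthConst r d M K / |(P p).β i| ≤ 1 := (div_le_one hb).2 h2
  have hβ : (P p).β i ≠ 0 := abs_pos.1 hb
  have h4 : s ^ (d + 2) * tinner (P p).X (tpow (d + 2) (V p)) / (P p).β i - 1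
      = s ^ (d + 2) * ((tinner (P p).X (tpow (d + 2) (V p)) - s ^ (d + 2) * (P p).β i
      - s ^ (d + 2) * tinner (P p).Z (tpow (d + 2) ((P p).v i)))
      + s ^ (d + 2) * tinner (P p).Z (tpow (d + 2) ((P p).v i))) / (P p).β i := by
    field_simp
    linear_combination (P p).β i * hs
  rw [h4, abs_div, abs_mul, H.sign_pow_abs, one_mul]
  gcongr
  refine (abs_add_le _ _).trans ?_
  rw [abs_mul, H.sign_pow_abs, one_mul]
  linarith

lemma tendsto_ratio (H : Recovers l P i V δ s K) (hM : 0 < M) :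
    Tendsto (fun p => s ^ (d + 2) * tinner (P p).X (tpow (d + 2) (V p)) / (P p).β i) l (𝓝 1) := by
  have := squeeze_zero_norm' (f := fun p =>
    s ^ (d + 2) * tinner (P p).X (tpow (d + 2) (V p)) / (P p).β i - 1)
    (H.abs_ratio_sub_one_le hM) (H.beta_atTop.const_div_atTop (M + 1))
  simpa using this.add_const 1

/-- The correction `(k / 2 - 1) / β̂` is negligible after multiplication by `√n`, since `√n / |β i|
→ 0`; only the Gaussian `⟨Z, v i ^ ⊗k⟩` remains. -/
theorem tendsto_strengthStat (H : Recovers l P i V δ s K) (hM : 0 < M) :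
    Tendsto (fun p => strengthStat (d + 2) (P p).n (s ^ (d + 2) * (P p).β i)
        (tinner (P p).X (tpow (d + 2) (V p)))
      + s ^ (d + 2) * (√(P p).n * tinner (P p).Z (tpow (d + 2) ((P p).v i)))) l (𝓝 0) := by
  have h1 : Tendsto (fun p => √(P p).n / tinner (P p).X (tpow (d + 2) (V p))) l (𝓝 0) := by
    have h2 : Tendsto (fun p => √(P p).n / |(P p).β i|
        * |(s ^ (d + 2) * tinner (P p).X (tpow (d + 2) (V p)) / (P p).β i)|⁻¹) l (𝓝 0) := by
      simpa using H.sqrt_div.mul ((H.tendsto_ratio hM).abs.inv₀ (by norm_num))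
    refine squeeze_zero_norm' ?_ h2
    filter_upwards [H.eventually_small hM] with p ⟨hb, _⟩
    rw [abs_div, abs_mul, H.sign_pow_abs, one_mul, Real.norm_eq_abs, abs_div,
      abs_of_nonneg (Real.sqrt_nonneg _)]
    apply le_of_eq
    field_simp
  have := ((H.tendsto_strength hM).neg).sub (h1.const_mul (((d + 2 : ℕ) : ℝ) / 2 - 1))
  simp only [mul_zero, neg_zero, sub_zero] at this
  refine this.congr fun p => ?_
  rw [strengthStat]
  ring

theorem tendsto_strength_mixture (H : Recovers l P i V δ s K) (hM : 0 < M) :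
    Tendsto (fun p => √(P p).n * (tinner (P p).X (tpow (d + 2) (V p))
        - (s ^ (d + 2) * (P p).β i
          - (((d + 2 : ℕ) : ℝ) / 2 - 1) / (s ^ (d + 2) * (P p).β i)))
      - s ^ (d + 2) * (√(P p).n * tinner (P p).Z (tpow (d + 2) ((P p).v i)))) l (𝓝 0) := by
  have h1 : Tendsto (fun p => √(P p).n / (s ^ (d + 2) * (P p).β i)) l (𝓝 0) := by
    refine squeeze_zero_norm' (Eventually.of_forall fun p => ?_) H.sqrt_div
    rw [Real.norm_eq_abs, abs_div, abs_mul, H.sign_pow_abs, one_mul,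
      abs_of_nonneg (Real.sqrt_nonneg _)]
  have := (H.tendsto_strength hM).add (h1.const_mul (((d + 2 : ℕ) : ℝ) / 2 - 1))
  simp only [mul_zero, add_zero] at this
  refine this.congr fun p => ?_
  ring

section Linear

variable {a : (p : ι) → EuclideanSpace ℝ (Fin (P p).n)} {L : ι → ℝ}

/-- The norm of the component of `a` orthogonal to `v i`. -/
noncomputable def perpNorm (P : ι → Sample r d M) (i : Fin r)
    (a : (p : ι) → EuclideanSpace ℝ (Fin (P p).n)) (p : ι) : ℝ :=
  √(1 - inner ℝ (a p) ((P p).v i) ^ 2)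

/-- The Gaussian main term of the linear statistic. -/
noncomputable def linearNoise (P : ι → Sample r d M) (i : Fin r)
    (a : (p : ι) → EuclideanSpace ℝ (Fin (P p).n)) (p : ι) : ℝ :=
  √(P p).n * inner ℝ (a p - (inner ℝ (a p) ((P p).v i) : ℝ) • (P p).v i)
    (contract (P p).Z ((P p).v i)) / perpNorm P i a p

/-- Bounds for the contracted noise on which the linear statistic is controlled. -/
structure LinearBounds (l : Filter ι) (P : ι → Sample r d M) (i : Fin r)
    (a : (p : ι) → EuclideanSpace ℝ (Fin (P p).n)) (L : ι → ℝ) : Prop where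
  norm_a : ∀ᶠ p in l, ‖a p‖ = 1
  perp_pos : ∀ᶠ p in l, 0 < perpNorm P i a p
  one_le_L : ∀ᶠ p in l, 1 ≤ L p
  inv_tendsto : Tendsto (fun p => 1 / (perpNorm P i a p * |(P p).β i|)) l (𝓝 0)
  L_div : Tendsto (fun p => L p / (perpNorm P i a p * |(P p).β i|)) l (𝓝 0)
  norm_sq : ∀ᶠ p in l, √(P p).n * |‖contract (P p).Z ((P p).v i)‖ ^ 2 - 1| ≤ L p
  overlap : ∀ᶠ p in l, √(P p).n * (inner ℝ ((P p).v i) (contract (P p).Z ((P p).v i)) : ℝ) ^ 2 ≤ L p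
  noise : ∀ᶠ p in l, |linearNoise P i a p| ≤ L p

/-- Version with deterministic normalization. The factor `√n / (A |β i|)`, which may diverge, meets
`‖g‖ ^ 2 - 1` and `⟨v i, g⟩ ^ 2`; these are at most `L / √n`, so a multiple of `L / (A |β i|) → 0`
remains. -/
theorem tendsto_linear (H : Recovers l P i V δ s K) (hM : 0 < M) (B : LinearBounds l P i a L) :
    Tendsto (fun p => √(P p).n * (P p).β i / perpNorm P i a p *
        (inner ℝ (a p) (V p) - (1 - 1 / (2 * (P p).β i ^ 2)) *
          (s * inner ℝ (a p) ((P p).v i)))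
      - s * linearNoise P i a p) l (𝓝 0) := by
  have hlim : Tendsto (fun p => 8 * (M + 1) ^ 3 * ((√(P p).n / |(P p).β i|)
        * (1 / (perpNorm P i a p * |(P p).β i|)))
      + 3 * (L p / (perpNorm P i a p * |(P p).β i|))
      + (2 * M + 3) * ((√(P p).n * ‖δ p‖) * (1 / (perpNorm P i a p * |(P p).β i|)))
      + (2 * (√(P p).n * ‖δ p‖) + 2 * M * (M + 1) * (√(P p).n / |(P p).β i|))) l (𝓝 0) := by
    have := ((((H.sqrt_div.mul B.inv_tendsto).const_mul (8 * (M + 1) ^ 3)).add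
      (B.L_div.const_mul 3)).add ((H.delta.mul B.inv_tendsto).const_mul (2 * M + 3))).add
      ((H.delta.const_mul 2).add (H.sqrt_div.const_mul (2 * M * (M + 1))))
    simpa using this
  refine squeeze_zero_norm' ?_ hlim
  filter_upwards [H.eventually_small hM, H.eq, B.norm_a, B.perp_pos, B.norm_sq, B.overlap, H.n_ge]
    with p ⟨hb, hδ, _, he2⟩ hV ha hA hns hov hn
  have hv := (P p).ortho.1 i
  have main := abs_linear_fluctuation_le (N := √((P p).n : ℝ)) hv ha
    (show perpNorm P i a p = _ from rfl) hA hM.le (Real.sqrt_nonneg _) hb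
    ((P p).op.norm_contract_le hM.le hv.le) hδ rfl he2
  have heq : √(P p).n * (P p).β i / perpNorm P i a p *
        (inner ℝ (a p) (V p) - (1 - 1 / (2 * (P p).β i ^ 2)) *
          (s * inner ℝ (a p) ((P p).v i))) - s * linearNoise P i a p
      = s * (√(P p).n * (P p).β i / perpNorm P i a p *
        (inner ℝ (a p) (‖(P p).v i + ((P p).β i)⁻¹ • (contract (P p).Z ((P p).v i) + δ p)‖⁻¹ •
      ((P p).v i + ((P p).β i)⁻¹ • (contract (P p).Z ((P p).v i) + δ p)))
        - (1 - 1 / (2 * (P p).β i ^ 2)) * inner ℝ (a p) ((P p).v i))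
        - √(P p).n * inner ℝ (a p - (inner ℝ (a p) ((P p).v i) : ℝ) • (P p).v i)
            (contract (P p).Z ((P p).v i)) / perpNorm P i a p) := by
    rw [hV, inner_smul_right _ _ s, linearNoise]
    ring
  have hs1 : |s| = 1 := by simpa using H.sign_pow_abs 1
  rw [heq, norm_mul, Real.norm_eq_abs, hs1, one_mul, Real.norm_eq_abs]
  refine main.trans ?_
  have hn0 : 0 < √((P p).n : ℝ) := by linarith
  set A := perpNorm P i a p
  have e1 : √((P p).n : ℝ) / (A * |(P p).β i|) * (8 * (M + 1) ^ 3 / |(P p).β i|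
        + |‖contract (P p).Z ((P p).v i)‖ ^ 2 - 1|
        + 2 * inner ℝ ((P p).v i) (contract (P p).Z ((P p).v i)) ^ 2 + (2 * M + 3) * ‖δ p‖)
      = 8 * (M + 1) ^ 3 * ((√(P p).n / |(P p).β i|) * (1 / (A * |(P p).β i|)))
      + (√(P p).n * |‖contract (P p).Z ((P p).v i)‖ ^ 2 - 1|
        + 2 * (√(P p).n * inner ℝ ((P p).v i) (contract (P p).Z ((P p).v i)) ^ 2))
        / (A * |(P p).β i|)
      + (2 * M + 3) * ((√(P p).n * ‖δ p‖) * (1 / (A * |(P p).β i|))) := by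
    field_simp
    ring
  rw [e1]
  gcongr
  rw [← mul_div_assoc]
  gcongr
  linarith

/-- The factor `L` is included because the relative error will multiply a noise term that is only
known to be at most `L`. -/
lemma tendsto_perpNorm_ratio (H : Recovers l P i V δ s K) (hM : 0 < M)
    (B : LinearBounds l P i a L) :
    Tendsto (fun p => (perpNorm P i a p / √(1 - inner ℝ (a p) (V p) ^ 2) - 1) * L p) l (𝓝 0) := by
  set h : ι → ℝ := fun p => (M + 1) * (1 / (perpNorm P i a p * |(P p).β i|)) with hh
  have h0 : Tendsto h l (𝓝 0) := by
    have := B.inv_tendsto.const_mul (M + 1)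
    rwa [mul_zero] at this
  have hLh : Tendsto (fun p => h p * L p) l (𝓝 0) := by
    have := B.L_div.const_mul (M + 1)
    rw [mul_zero] at this
    exact this.congr fun p => by simp only [hh]; ring
  have hb : Tendsto (fun p => 8 * h p ^ 2 + 4 * h p) l (𝓝 0) := by
    simpa using ((h0.pow 2).const_mul 8).add (h0.const_mul 4)
  have hlim : Tendsto (fun p => 8 * (h p * (h p * L p)) + 4 * (h p * L p)) l (𝓝 0) := by
    simpa using ((h0.mul hLh).const_mul 8).add (hLh.const_mul 4)
  refine squeeze_zero_norm' ?_ hlim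
  filter_upwards [H.eventually_small hM, H.eq, B.norm_a, B.perp_pos, B.one_le_L,
    hb.eventually_le_const (show (0 : ℝ) < 1 / 2 by norm_num)]
    with p ⟨hb, hδ, he, he2⟩ hV ha hA hL hb2
  have hv := (P p).ortho.1 i
  have h1 := abs_one_sub_inner_sq_div_sub_one_le (h := h p) hv ha
    (show perpNorm P i a p = _ from rfl) hA he2 (by
      calc _ ≤ (M + 1) / |(P p).β i| / perpNorm P i a p := by gcongr
        _ = _ := by simp only [hh]; field_simp)
  have hVa : inner ℝ (a p) (V p) ^ 2 = inner ℝ (a p)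
      (‖(P p).v i + ((P p).β i)⁻¹ • (contract (P p).Z ((P p).v i) + δ p)‖⁻¹ •
      ((P p).v i + ((P p).β i)⁻¹ • (contract (P p).Z ((P p).v i) + δ p))) ^ 2 := by
    rw [hV, inner_smul_right _ _ s, mul_pow, sq s, H.sign_sq, one_mul]
  rw [← hVa] at h1
  set q := (1 - inner ℝ (a p) (V p) ^ 2) / perpNorm P i a p ^ 2 with hq
  have hq2 : 1 / 2 ≤ q := by linarith [(abs_le.1 (h1.trans hb2)).1]
  have e1 : perpNorm P i a p / √(1 - inner ℝ (a p) (V p) ^ 2) = (√q)⁻¹ := by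
    rw [hq, Real.sqrt_div' _ (by positivity), Real.sqrt_sq hA.le, inv_div]
  rw [e1, norm_mul, Real.norm_eq_abs, Real.norm_eq_abs, abs_of_nonneg (zero_le_one.trans hL)]
  calc _ ≤ (8 * h p ^ 2 + 4 * h p) * L p := by
        gcongr
        exact (abs_inv_sqrt_sub_one_le hq2).trans h1
    _ = _ := by ring

/-- Passage to estimated quantities: `W` accounts for `β̂` in the bias, and the ratio of the
prefactors tends to one fast enough to be multiplied by `L`. The sign combines `s ^ (d + 2)` from
the estimated strength with `s` from the vector. -/
theorem tendsto_linearStat (H : Recovers l P i V δ s K) (hM : 0 < M) (B : LinearBounds l P i a L) :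
    Tendsto (fun p => linearStat (a p) (V p) (s • (P p).v i) (tinner (P p).X (tpow (d + 2) (V p)))
      - s ^ (d + 3) * linearNoise P i a p) l (𝓝 0) := by
  set b : ι → ℝ := fun p => s ^ (d + 2) * tinner (P p).X (tpow (d + 2) (V p)) with hbdef
  set Y : ι → ℝ := fun p => √(P p).n * (P p).β i / perpNorm P i a p *
        (inner ℝ (a p) (V p) - (1 - 1 / (2 * (P p).β i ^ 2)) *
          (s * inner ℝ (a p) ((P p).v i))) with hY
  set W : ι → ℝ := fun p => √(P p).n * (P p).β i / perpNorm P i a p *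
    ((1 / (2 * b p ^ 2) - 1 / (2 * (P p).β i ^ 2)) * (s * inner ℝ (a p) ((P p).v i))) with hW
  have hs1 : |s| = 1 := by simpa using H.sign_pow_abs 1
  have hss : s ^ (d + 2) * s ^ (d + 2) = 1 := by rw [← mul_pow, H.sign_sq, one_pow]
  have hY0 := H.tendsto_linear hM B
  have hW0 : Tendsto W l (𝓝 0) := by
    have hlim : Tendsto (fun p => 5 * (M + 1) * ((√(P p).n / |(P p).β i|)
        * (1 / (perpNorm P i a p * |(P p).β i|)))) l (𝓝 0) := by
      simpa using (H.sqrt_div.mul B.inv_tendsto).const_mul (5 * (M + 1))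
    refine squeeze_zero_norm' ?_ hlim
    filter_upwards [H.eventually_small hM, H.abs_ratio_sub_one_le hM, B.norm_a, B.perp_pos,
      H.beta_atTop.eventually_ge_atTop (2 * (M + 1))] with p ⟨hb, _⟩ h1 ha hA h2
    have h3 := abs_inv_sq_sub_inv_sq_le (abs_pos.1 hb) h1 (by rw [div_le_iff₀ hb]; linarith)
    have hα : |(inner ℝ (a p) ((P p).v i) : ℝ)| ≤ 1 := by
      simpa [(P p).ortho.1 i, ha] using abs_real_inner_le_norm (a p) ((P p).v i)
    simp only [hW]
    rw [Real.norm_eq_abs, abs_mul, abs_div, abs_mul, abs_mul, abs_mul, hs1, one_mul,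
      abs_of_nonneg (Real.sqrt_nonneg _), abs_of_pos hA]
    calc _ ≤ √(P p).n * |(P p).β i| / perpNorm P i a p
          * (5 * ((M + 1) / |(P p).β i|) / (P p).β i ^ 2 * 1) := by gcongr
      _ = _ := by
        rw [← sq_abs ((P p).β i)]
        field_simp
  have hρ : Tendsto (fun p => (perpNorm P i a p / √(1 - inner ℝ (a p) (V p) ^ 2)
      * (b p / (P p).β i) - 1) * L p) l (𝓝 0) := by
    have h1 : Tendsto (fun p => (b p / (P p).β i - 1) * L p) l (𝓝 0) := by
      have hlim : Tendsto (fun p => (M + 1) * (L p / (perpNorm P i a p * |(P p).β i|))) l (𝓝 0) := by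
        simpa using B.L_div.const_mul (M + 1)
      refine squeeze_zero_norm' ?_ hlim
      filter_upwards [H.eventually_small hM, H.abs_ratio_sub_one_le hM, B.perp_pos, B.one_le_L]
        with p ⟨hb, _⟩ h1 hA hL
      have hA1 : perpNorm P i a p ≤ 1 := by
        refine Real.sqrt_le_one.2 ?_
        linarith [sq_nonneg (inner ℝ (a p) ((P p).v i) : ℝ)]
      rw [norm_mul, Real.norm_eq_abs, Real.norm_eq_abs, abs_of_nonneg (zero_le_one.trans hL)]
      calc _ ≤ (M + 1) / |(P p).β i| * L p := by gcongr
        _ ≤ (M + 1) / (perpNorm P i a p * |(P p).β i|) * L p := by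
          gcongr
          exact mul_le_of_le_one_left hb.le hA1
        _ = _ := by ring
    have h2 := ((H.tendsto_perpNorm_ratio hM B).mul (H.tendsto_ratio hM)).add h1
    simp only [zero_mul, add_zero] at h2
    refine h2.congr fun p => ?_
    simp only [hbdef]
    ring
  have hρL : Tendsto (fun p => (perpNorm P i a p / √(1 - inner ℝ (a p) (V p) ^ 2)
      * (b p / (P p).β i) - 1) * linearNoise P i a p) l (𝓝 0) := by
    refine squeeze_zero_norm' ?_ (by simpa using hρ.norm)
    filter_upwards [B.noise, B.one_le_L] with p h1 h2
    rw [norm_mul]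
    exact mul_le_mul le_rfl (h1.trans (le_abs_self _)) (norm_nonneg _) (abs_nonneg _)
  have hρ1 : Tendsto (fun p => perpNorm P i a p / √(1 - inner ℝ (a p) (V p) ^ 2)
      * (b p / (P p).β i)) l (𝓝 1) := by
    have : Tendsto (fun p => perpNorm P i a p / √(1 - inner ℝ (a p) (V p) ^ 2)
        * (b p / (P p).β i) - 1) l (𝓝 0) := by
      refine squeeze_zero_norm' ?_ (by simpa using hρ.norm)
      filter_upwards [B.one_le_L] with p h2
      exact le_mul_of_one_le_right (norm_nonneg _) (h2.trans (le_abs_self _))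
    simpa using this.add_const 1
  have hfin := ((hρ1.mul (hY0.add hW0)).add (hρL.const_mul s)).const_mul (s ^ (d + 2))
  simp only [mul_zero, add_zero] at hfin
  refine hfin.congr' ?_
  filter_upwards [H.eventually_small hM, H.eventually_norm_eq_one hM, B.norm_a, B.perp_pos]
    with p ⟨hb, _⟩ hV ha hA
  have hβ : (P p).β i ≠ 0 := abs_pos.1 hb
  have hbh : tinner (P p).X (tpow (d + 2) (V p)) = s ^ (d + 2) * b p := by
    simp only [hbdef]
    rw [← mul_assoc, hss, one_mul]
  have hb2 : (s ^ (d + 2) * b p) ^ 2 = b p ^ 2 := by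
    rw [mul_pow, sq (s ^ (d + 2)), hss, one_mul]
  have hin : (inner ℝ (a p) (a p - (inner ℝ (V p) (a p) : ℝ) • V p) : ℝ)
      = 1 - inner ℝ (a p) (V p) ^ 2 := by
    rw [inner_sub_right, inner_smul_right, real_inner_self_eq_norm_sq, ha, real_inner_comm]
    ring
  rw [linearStat, hbh, hb2, hin, inner_smul_right]
  simp only [hW]
  set Q := √(1 - inner ℝ (a p) (V p) ^ 2)
  have e1 : ∀ x : ℝ, perpNorm P i a p / Q * (b p / (P p).β i)
      * (√((P p).n : ℝ) * (P p).β i / perpNorm P i a p * x) = √((P p).n : ℝ) * b p / Q * x := by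
    intro x
    field_simp
  linear_combination (s ^ (d + 2)) * e1 (inner ℝ (a p) (V p) - (1 - 1 / (2 * b p ^ 2)) *
    (s * inner ℝ (a p) ((P p).v i)))

end Linear

end Recovers

theorem Selects.recovers [NeZero r] {T : ι → ℕ} {κ ε : ℝ} {t₁ : ℕ} (H : Selects l P T i κ ε t₁)
    (hM : 0 < M) (h1 : 1 / 2 ≤ ε * ((t₁ : ℝ) - 1)) (h2 : 2 ≤ t₁)
    (h3 : r * (κ * (1 - 1 / κ) ^ ((d + 1) ^ (t₁ - 1))) < 1)
    (h4 : 3 * (1 - 1 / κ) ^ ((d + 1) ^ t₁) < Real.exp (-1 / κ) ^ ((d + 1) ^ t₁))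
    (h5 : Real.exp (-1 / κ) ^ ((d + 1) ^ t₁) * (8 * r) ≤ 1) (hs : s * s = 1)
    (hsign : ∀ᶠ p in l,
      limitSign (d + 2) ((P p).β i) (T p) (inner ℝ (P p).u ((P p).v i)) = s) :
    Recovers l P i (fun p => (P p).U (T p)) (fun p => (P p).δ i (T p - 1)) s (κ ^ d) where
  sign_sq := hs
  n_ge := (H.n_atTop.eventually_ge_atTop 1).mono fun p h => Real.one_le_sqrt.2 h
  beta_le := H.init.mono fun p h => h.1
  beta_atTop := H.beta_atTop
  sqrt_div := H.sqrt_div_tendsto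
  delta := (H.limit hM h1 h2 h3 h4 h5).1
  eq := by
    filter_upwards [(H.limit hM h1 h2 h3 h4 h5).2, hsign, H.init] with p h6 h7 h8
    rw [h6, h7, e_eq h8.2.1]

end Sample

end SpikedTensor

namespace SpikedTensor

/-! ### Polar decomposition of the Gaussian measure. -/

section Sphere

open scoped ENNReal RealInnerProductSpace
open Metric

variable {n : ℕ}

/-- Both characteristic functions agree. The radial density is what polar coordinates for Lebesgue
measure can be applied to. -/
lemma stdGaussian_eq_withDensity (n : ℕ) : stdGaussian (EuclideanSpace ℝ (Fin n))
    = volume.withDensity fun x : EuclideanSpace ℝ (Fin n) =>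
        ENNReal.ofReal (((2 * Real.pi) ^ ((n : ℝ) / 2))⁻¹ * Real.exp (-‖x‖ ^ 2 / 2)) := by
  set E := EuclideanSpace ℝ (Fin n)
  set c : ℝ := ((2 * Real.pi) ^ ((n : ℝ) / 2))⁻¹ with hc
  have hc0 : 0 < c := by positivity
  have hint : Integrable (fun x : E => c * Real.exp (-‖x‖ ^ 2 / 2)) volume := by
    refine Integrable.const_mul ?_ c
    have h := GaussianFourier.integrable_cexp_neg_mul_sq_norm_add (V := E) (b := 1 / 2)
      (by norm_num) 0 0
    refine h.norm.congr (ae_of_all _ fun x => ?_)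
    simp only [Complex.norm_exp]
    congr 1
    simp [← Complex.ofReal_pow]
    ring
  have : IsFiniteMeasure (volume.withDensity fun x : E =>
      ENNReal.ofReal (c * Real.exp (-‖x‖ ^ 2 / 2))) :=
    isFiniteMeasure_withDensity_ofReal hint.2
  apply Measure.ext_of_charFun
  ext t
  rw [charFun_stdGaussian, charFun_apply, integral_withDensity_eq_integral_toReal_smul
    (by fun_prop) (ae_of_all _ fun _ => ENNReal.ofReal_lt_top)]
  have h := GaussianFourier.integral_cexp_neg_mul_sq_norm_add (V := E) (b := 1 / 2)
    (by norm_num) Complex.I t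
  have h1 : ∀ x : E, (ENNReal.ofReal (c * Real.exp (-‖x‖ ^ 2 / 2))).toReal
      • Complex.exp (((inner ℝ x t : ℝ) : ℂ) * Complex.I)
      = c * Complex.exp (-(1 / 2) * ‖x‖ ^ 2 + Complex.I * ((inner ℝ t x : ℝ) : ℂ)) := by
    intro x
    rw [ENNReal.toReal_ofReal (by positivity), Complex.exp_add, real_inner_comm]
    simp only [Complex.real_smul, Complex.ofReal_mul, Complex.ofReal_exp]
    rw [mul_assoc]
    congr 3
    · push_cast; ring
    · ring
  simp_rw [h1]
  rw [integral_const_mul, h, Complex.I_sq, ← mul_assoc]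
  have h2 : (c : ℂ) * (Real.pi / (1 / 2)) ^ (Module.finrank ℝ E / 2 : ℂ) = 1 := by
    have h3 : ((Real.pi / (1 / 2) : ℂ)) = ((2 * Real.pi : ℝ) : ℂ) := by push_cast; ring
    have h4 : (Module.finrank ℝ E / 2 : ℂ) = (((n : ℝ) / 2 : ℝ) : ℂ) := by
      rw [finrank_euclideanSpace_fin]; push_cast; ring
    rw [h3, h4, ← Complex.ofReal_cpow (by positivity), ← Complex.ofReal_mul, hc,
      inv_mul_cancel₀ (by positivity), Complex.ofReal_one]
  rw [h2, one_mul]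
  congr 1
  ring

lemma toSphere_univ_ne_zero (hn : 0 < n) :
    (volume : Measure (EuclideanSpace ℝ (Fin n))).toSphere Set.univ ≠ 0 := by
  have : NeZero n := ⟨hn.ne'⟩
  have : Nonempty (Fin n) := ⟨0⟩
  rw [Measure.measure_univ_ne_zero]
  exact Measure.toSphere_ne_zero _

lemma isProbabilityMeasure_sphereUniform (hn : 0 < n) : IsProbabilityMeasure (sphereUniform n) := by
  constructor
  rw [sphereUniform, Measure.map_apply measurable_subtype_coe MeasurableSet.univ,
    Set.preimage_univ, Measure.smul_apply, smul_eq_mul]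
  exact ENNReal.inv_mul_cancel (toSphere_univ_ne_zero hn) (measure_ne_top _ _)

/-- Polar decomposition of the standard Gaussian: the direction is uniform on the sphere and
independent of the norm. -/
lemma map_polar_stdGaussian (hn : 0 < n) :
    (stdGaussian (EuclideanSpace ℝ (Fin n))).map (fun x => (‖x‖⁻¹ • x, ‖x‖))
      = (sphereUniform n).prod ((stdGaussian (EuclideanSpace ℝ (Fin n))).map fun x => ‖x‖) := by
  set E := EuclideanSpace ℝ (Fin n)
  set γ := stdGaussian E with hγ
  have : IsProbabilityMeasure (sphereUniform n) := isProbabilityMeasure_sphereUniform hn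
  have : NeZero n := ⟨hn.ne'⟩
  have : Nonempty (Fin n) := ⟨0⟩
  set c : ℝ := ((2 * Real.pi) ^ ((n : ℝ) / 2))⁻¹ with hc
  set φ : ℝ → ℝ≥0∞ := fun y => ENNReal.ofReal (c * Real.exp (-y ^ 2 / 2)) with hφ
  have hφm : Measurable φ := by fun_prop
  have hF : Measurable fun x : E => (‖x‖⁻¹ • x, ‖x‖) := by fun_prop
  set σ := (volume : Measure E).toSphere with hσ
  set m : Set ℝ → ℝ≥0∞ := fun B => ∫⁻ y : Set.Ioi (0 : ℝ), B.indicator φ y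
    ∂(Measure.volumeIoiPow (Module.finrank ℝ E - 1)) with hm
  -- The density depends on the norm only, so the measure factors off the null set `{0}`; leaving
  -- the direction free identifies the radial factor.
  have key : ∀ (A : Set E) (B : Set ℝ), MeasurableSet A → MeasurableSet B →
      γ {x | ‖x‖⁻¹ • x ∈ A ∧ ‖x‖ ∈ B} = σ ((↑) ⁻¹' A) * m B := by
    intro A B hA hB
    have hAB : MeasurableSet {x : E | ‖x‖⁻¹ • x ∈ A ∧ ‖x‖ ∈ B} := hF (hA.prod hB)
    have hz : volume {(0 : E)} = 0 := measure_singleton 0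
    rw [hγ, stdGaussian_eq_withDensity, withDensity_apply _ hAB, ← lintegral_indicator hAB]
    have e1 : ∫⁻ x, {x : E | ‖x‖⁻¹ • x ∈ A ∧ ‖x‖ ∈ B}.indicator (fun x => φ ‖x‖) x
        = ∫⁻ x : ({0}ᶜ : Set E), {x : E | ‖x‖⁻¹ • x ∈ A ∧ ‖x‖ ∈ B}.indicator (fun x => φ ‖x‖) x
          ∂(volume.comap Subtype.val) := by
      rw [lintegral_subtype_comap (measurableSet_singleton _).compl]
      have hz' : ∀ᵐ x ∂(volume : Measure E), x ∈ ({0}ᶜ : Set E) := compl_mem_ae_iff.2 hz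
      rw [Measure.restrict_eq_self_of_ae_mem hz']
    have hA' : MeasurableSet ((↑) ⁻¹' A : Set (sphere (0 : E) 1)) := measurable_subtype_coe hA
    have hf1 : Measurable fun q : sphere (0 : E) 1 =>
        ((↑) ⁻¹' A : Set (sphere (0 : E) 1)).indicator (fun _ => (1 : ℝ≥0∞)) q :=
      measurable_const.indicator hA'
    have hf2 : Measurable fun q : Set.Ioi (0 : ℝ) => B.indicator φ (q : ℝ) :=
      (hφm.indicator hB).comp measurable_subtype_coe
    have e2 := (Measure.measurePreserving_homeomorphUnitSphereProd
      (volume : Measure E)).lintegral_comp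
      (f := fun q => ((↑) ⁻¹' A : Set (sphere (0 : E) 1)).indicator (fun _ => (1 : ℝ≥0∞)) q.1
        * B.indicator φ (q.2 : ℝ))
      ((hf1.comp measurable_fst).mul (hf2.comp measurable_snd))
    change ∫⁻ x, {x : E | ‖x‖⁻¹ • x ∈ A ∧ ‖x‖ ∈ B}.indicator (fun x => φ ‖x‖) x = _
    rw [e1]
    calc _ = _ := ?_
      _ = _ := e2
      _ = _ := ?_
    · refine lintegral_congr fun x => ?_
      simp only [homeomorphUnitSphereProd_apply_fst_coe, homeomorphUnitSphereProd_apply_snd_coe,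
        Set.indicator, Set.mem_preimage]
      by_cases h1 : ‖(x : E)‖⁻¹ • (x : E) ∈ A <;> by_cases h2 : ‖(x : E)‖ ∈ B <;> simp [h1, h2]
    · rw [lintegral_prod_mul hf1.aemeasurable hf2.aemeasurable, lintegral_indicator_const hA',
        one_mul]
  have h0 := toSphere_univ_ne_zero hn
  refine (Measure.prod_eq fun A B hA hB => ?_).symm
  have e1 := key A B hA hB
  have e2 := key Set.univ B MeasurableSet.univ hB
  rw [Measure.map_apply hF (hA.prod hB), Measure.map_apply measurable_norm hB, sphereUniform,
    Measure.map_apply measurable_subtype_coe hA, Measure.smul_apply, smul_eq_mul]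
  have e3 : γ ((fun x => ‖x‖) ⁻¹' B) = σ Set.univ * m B := by
    rw [← Set.preimage_univ (f := ((↑) : sphere (0 : E) 1 → E)), ← e2]
    congr 1
    ext x
    simp
  rw [e3, mul_right_comm, ← mul_assoc, ENNReal.inv_mul_cancel h0 (measure_ne_top _ _), one_mul,
    mul_comm]
  exact e1

end Sphere

end SpikedTensor

namespace SpikedTensor

/-! ### Overlaps of a uniform direction with a unit vector. -/

section SphereBounds

open scoped ENNReal

variable {n r : ℕ}

lemma map_overlap_stdGaussian {v : Fin r → EuclideanSpace ℝ (Fin n)} (hv : Orthonormal ℝ v) :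
    (stdGaussian (EuclideanSpace ℝ (Fin n))).map (fun x j => inner ℝ x (v j))
      = gaussVec (Fin r) 1 := by
  have hm : Measurable fun (x : EuclideanSpace ℝ (Fin n)) (j : Fin r) => (inner ℝ x (v j) : ℝ) :=
    Continuous.measurable (by fun_prop)
  have : IsProbabilityMeasure ((stdGaussian (EuclideanSpace ℝ (Fin n))).map
      (fun x j => (inner ℝ x (v j) : ℝ))) := Measure.isProbabilityMeasure_map hm.aemeasurable
  refine eq_gaussVec_of_map_dotProduct fun η => ?_
  rw [Measure.map_map (measurable_dotProduct η) hm, ← map_pi_eq_stdGaussian,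
    Measure.map_map (by fun_prop) (by fun_prop)]
  set w : EuclideanSpace ℝ (Fin n) := ∑ j, η j • v j with hw
  have h1 : ((fun z : Fin r → ℝ => η ⬝ᵥ z) ∘ fun (x : EuclideanSpace ℝ (Fin n)) j =>
      (inner ℝ x (v j) : ℝ)) ∘ WithLp.toLp 2 = fun z : Fin n → ℝ => (WithLp.ofLp w) ⬝ᵥ z := by
    ext z
    have : (inner ℝ (WithLp.toLp 2 z) w : ℝ) = WithLp.ofLp w ⬝ᵥ z := by
      simp [PiLp.inner_apply, dotProduct]
    rw [← this, hw, inner_sum]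
    simp [dotProduct, inner_smul_right]
  have h2 : WithLp.ofLp w ⬝ᵥ WithLp.ofLp w = η ⬝ᵥ η := by
    have h3 : WithLp.ofLp w ⬝ᵥ WithLp.ofLp w = (inner ℝ w w : ℝ) := by
      rw [real_inner_self_eq_norm_sq, EuclideanSpace.real_norm_sq_eq]
      simp [dotProduct, sq]
    rw [h3, hw, hv.inner_sum]
    simp [dotProduct]
  rw [h1, map_dotProduct_gaussVec, h2]

lemma map_inner_stdGaussian {w : EuclideanSpace ℝ (Fin n)} (hw : ‖w‖ = 1) :
    (stdGaussian (EuclideanSpace ℝ (Fin n))).map (fun x => (inner ℝ x w : ℝ))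
      = gaussianReal 0 1 := by
  have hv : Orthonormal ℝ (fun _ : Fin 1 => w) :=
    ⟨fun _ => hw, fun i j h => absurd (Subsingleton.elim i j) h⟩
  have h := congrArg (Measure.map fun z : Fin 1 → ℝ => z 0) (map_overlap_stdGaussian hv)
  rw [Measure.map_map (by fun_prop) (Continuous.measurable (by fun_prop))] at h
  exact h.trans (measurePreserving_eval _ 0).map_eq

lemma map_normalize_stdGaussian (hn : 0 < n) :
    (stdGaussian (EuclideanSpace ℝ (Fin n))).map (fun x => ‖x‖⁻¹ • x) = sphereUniform n := by
  have : IsProbabilityMeasure (sphereUniform n) := isProbabilityMeasure_sphereUniform hn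
  have h1 : IsProbabilityMeasure
      ((stdGaussian (EuclideanSpace ℝ (Fin n))).map fun x => ‖x‖) :=
    Measure.isProbabilityMeasure_map (by fun_prop)
  have h := congrArg (Measure.map Prod.fst) (map_polar_stdGaussian hn)
  rw [Measure.map_map (by fun_prop) (by fun_prop), Measure.map_fst_prod, measure_univ,
    one_smul] at h
  exact h

lemma map_neg_sphereUniform (hn : 0 < n) : (sphereUniform n).map (fun u => -u) = sphereUniform n := by
  rw [← map_normalize_stdGaussian hn, Measure.map_map (by fun_prop) (by fun_prop)]
  have h := stdGaussian_map (LinearIsometryEquiv.neg ℝ (E := EuclideanSpace ℝ (Fin n)))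
  conv_rhs => rw [← h]
  rw [Measure.map_map (by fun_prop) (LinearIsometryEquiv.neg ℝ).continuous.measurable]
  congr 1
  ext x : 1
  simp

lemma gaussianReal_real_Icc_le {a b c : ℝ} (hab : a ≤ b) (hc : 0 ≤ c)
    (h : ∀ y ∈ Set.Icc a b, Real.exp (-y ^ 2 / 2) ≤ c) :
    (gaussianReal 0 1).real (Set.Icc a b) ≤ (b - a) * c / 2 := by
  have hpi : 2 ≤ √(2 * Real.pi) := by
    rw [Real.le_sqrt' (by norm_num)]
    nlinarith [Real.pi_gt_three]
  have h1 : gaussianReal 0 1 (Set.Icc a b) ≤ ENNReal.ofReal ((b - a) * c / 2) := by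
    rw [gaussianReal_apply _ one_ne_zero]
    calc ∫⁻ y in Set.Icc a b, gaussianPDF 0 1 y
        ≤ ∫⁻ y in Set.Icc a b, ENNReal.ofReal (c / 2) := by
          refine setLIntegral_mono measurable_const fun y hy => ?_
          refine ENNReal.ofReal_le_ofReal ?_
          rw [gaussianPDFReal]
          simp only [NNReal.coe_one, mul_one, sub_zero]
          have h2 := h y hy
          have h3 : (√(2 * Real.pi))⁻¹ ≤ 2⁻¹ := by gcongr
          calc _ ≤ 2⁻¹ * c := by gcongr
            _ = _ := by ring
      _ = _ := by
          rw [setLIntegral_const, Real.volume_Icc, ← ENNReal.ofReal_mul (by positivity)]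
          ring_nf
  exact ENNReal.toReal_le_of_le_ofReal (by
    have : 0 ≤ b - a := by linarith
    positivity) h1

lemma gaussianReal_real_abs_le_le {δ : ℝ} (hδ : 0 ≤ δ) :
    (gaussianReal 0 1).real {y | |y| ≤ δ} ≤ δ := by
  have h : {y : ℝ | |y| ≤ δ} = Set.Icc (-δ) δ := by ext y; simp [abs_le]
  rw [h]
  refine (gaussianReal_real_Icc_le (c := 1) (by linarith) zero_le_one fun y _ => ?_).trans_eq
    (by ring)
  rw [Real.exp_le_one_iff]
  nlinarith [sq_nonneg y]

/-- A standard Gaussian rarely falls into a window of small relative width. -/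
lemma gaussianReal_real_window_le {q z : ℝ} (hq : 1 / 2 ≤ q) (hq1 : q ≤ 1) (hz : 0 ≤ z) :
    (gaussianReal 0 1).real {y | q * z ≤ |y| ∧ |y| ≤ z} ≤ 2 * (1 - q) := by
  set c := Real.exp (-(z ^ 2 / 8)) with hc
  -- Boundedness of `z exp (-z ^ 2 / 8)` makes the estimate uniform in the location of the window.
  have hzc : z * c ≤ 2 := by
    have h1 := Real.add_one_le_exp (z ^ 2 / 8)
    have h2 : c * Real.exp (z ^ 2 / 8) = 1 := by rw [hc, ← Real.exp_add]; simp
    have hc0 : 0 < c := Real.exp_pos _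
    have h3 : c * (z ^ 2 / 8 + 1) ≤ 1 := (by gcongr : _ ≤ c * Real.exp (z ^ 2 / 8)).trans_eq h2
    have h4 : z ≤ 2 * (z ^ 2 / 8 + 1) := by nlinarith [sq_nonneg (z - 2)]
    nlinarith
  have hb : ∀ y : ℝ, z / 2 ≤ |y| → Real.exp (-y ^ 2 / 2) ≤ c := fun y hy => by
    refine Real.exp_le_exp.2 ?_
    have : (z / 2) ^ 2 ≤ |y| ^ 2 := by gcongr
    rw [sq_abs] at this
    linarith
  have hc0 : 0 ≤ c := (Real.exp_pos _).le
  have h1 : (gaussianReal 0 1).real (Set.Icc (q * z) z) ≤ (z - q * z) * c / 2 :=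
    gaussianReal_real_Icc_le (by nlinarith) hc0 fun y hy => hb y (by
      rw [abs_of_nonneg (by nlinarith [hy.1])]; nlinarith [hy.1])
  have h2 : (gaussianReal 0 1).real (Set.Icc (-z) (-(q * z))) ≤ (-(q * z) - -z) * c / 2 :=
    gaussianReal_real_Icc_le (by nlinarith) hc0 fun y hy => hb y (by
      rw [abs_of_nonpos (by nlinarith [hy.2])]; nlinarith [hy.2])
  have hsub : {y : ℝ | q * z ≤ |y| ∧ |y| ≤ z} ⊆ Set.Icc (q * z) z ∪ Set.Icc (-z) (-(q * z)) := by
    intro y (hy : q * z ≤ |y| ∧ |y| ≤ z)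
    rcases le_total 0 y with h | h
    · rw [abs_of_nonneg h] at hy; exact Or.inl ⟨hy.1, hy.2⟩
    · rw [abs_of_nonpos h] at hy; exact Or.inr ⟨by linarith, by linarith⟩
  calc _ ≤ _ := measureReal_mono hsub (measure_ne_top _ _)
    _ ≤ _ := measureReal_union_le _ _
    _ ≤ (z - q * z) * c / 2 + (-(q * z) - -z) * c / 2 := add_le_add h1 h2
    _ = (z * c) * (1 - q) := by ring
    _ ≤ _ := by
      have : 0 ≤ 1 - q := by linarith
      gcongr

lemma lintegral_inner_sq_stdGaussian {w : EuclideanSpace ℝ (Fin n)} (hw : ‖w‖ = 1) :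
    ∫⁻ x, ENNReal.ofReal ((inner ℝ x w : ℝ) ^ 2) ∂(stdGaussian (EuclideanSpace ℝ (Fin n))) = 1 := by
  have h2 := map_inner_stdGaussian hw
  have h3 : ∫⁻ y, ENNReal.ofReal (y ^ 2) ∂(gaussianReal 0 1) = 1 := by
    have h4 : ∫ y, y ^ 2 ∂(gaussianReal 0 1) = 1 := by
      have h5 := variance_fun_id_gaussianReal (μ := 0) (v := 1)
      rw [variance_eq_integral (by fun_prop), integral_id_gaussianReal] at h5
      simpa using h5
    rw [← ofReal_integral_eq_lintegral_ofReal _ (ae_of_all _ fun y => sq_nonneg y), h4,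
      ENNReal.ofReal_one]
    exact (memLp_id_gaussianReal (μ := 0) (v := 1) 2).integrable_sq
  rw [← h3, ← h2, lintegral_map (by fun_prop) (by fun_prop)]

lemma lintegral_norm_sq_stdGaussian (n : ℕ) :
    ∫⁻ x, ENNReal.ofReal (‖x‖ ^ 2) ∂(stdGaussian (EuclideanSpace ℝ (Fin n))) = n := by
  have h1 : ∀ i : Fin n, ∫⁻ x, ENNReal.ofReal (x i ^ 2)
      ∂(stdGaussian (EuclideanSpace ℝ (Fin n))) = 1 := fun i => by
    simpa [EuclideanSpace.inner_single_right] using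
      lintegral_inner_sq_stdGaussian (w := EuclideanSpace.single i (1 : ℝ)) (by simp)
  simp_rw [EuclideanSpace.real_norm_sq_eq]
  simp_rw [ENNReal.ofReal_sum_of_nonneg (fun _ _ => sq_nonneg _)]
  rw [lintegral_finsetSum _ (by fun_prop)]
  simp [h1]

/-- Overlaps of a uniform direction are rarely small. -/
lemma sphereUniform_real_overlap_lt_le (hn : 0 < n) {w : EuclideanSpace ℝ (Fin n)} (hw : ‖w‖ = 1)
    {δ : ℝ} (hδ : 0 ≤ δ) :
    (sphereUniform n).real {u | |(inner ℝ u w : ℝ)| < δ / √n} ≤ 3 * δ := by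
  have : IsProbabilityMeasure (sphereUniform n) := isProbabilityMeasure_sphereUniform hn
  set γ := stdGaussian (EuclideanSpace ℝ (Fin n)) with hγ
  set ρ := γ.map fun x => ‖x‖ with hρ
  have hρ1 : IsProbabilityMeasure ρ := Measure.isProbabilityMeasure_map (by fun_prop)
  have hn' : (0 : ℝ) < n := by exact_mod_cast hn
  have hsn : 0 < √(n : ℝ) := Real.sqrt_pos.2 hn'
  set S : Set (EuclideanSpace ℝ (Fin n)) := {u | |(inner ℝ u w : ℝ)| < δ / √n} with hS
  have hSm : MeasurableSet S := measurableSet_lt (by fun_prop) measurable_const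
  -- Direction and norm are independent, and a small overlap together with norm at most `2 √n` makes
  -- the Gaussian overlap at most `2 δ`. The norm condition has probability at least `3 / 4` by
  -- Markov, and `2 δ / (3 / 4) ≤ 3 δ`.
  have h1 : (sphereUniform n).real S * ρ.real (Set.Iic (2 * √n))
      ≤ (gaussianReal 0 1).real {y | |y| ≤ 2 * δ} := by
    rw [← measureReal_prod_prod, hρ, ← map_polar_stdGaussian hn, map_measureReal_apply (by fun_prop)
      (hSm.prod measurableSet_Iic), ← map_inner_stdGaussian hw,
      map_measureReal_apply (by fun_prop) (measurableSet_le (by fun_prop) measurable_const)]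
    refine measureReal_mono ?_ (measure_ne_top _ _)
    rintro x ⟨hx1 : |(inner ℝ (‖x‖⁻¹ • x) w : ℝ)| < δ / √n, hx2 : ‖x‖ ≤ 2 * √n⟩
    change |(inner ℝ x w : ℝ)| ≤ 2 * δ
    rcases eq_or_ne x 0 with rfl | hx
    · simp; positivity
    have hx0 : 0 < ‖x‖ := norm_pos_iff.2 hx
    have h2 : (inner ℝ x w : ℝ) = ‖x‖ * inner ℝ (‖x‖⁻¹ • x) w := by
      rw [inner_smul_left]; simp; field_simp
    rw [h2, abs_mul, abs_norm]
    calc _ ≤ 2 * √n * (δ / √n) := by gcongr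
      _ = _ := by field_simp
  have h3 : 3 / 4 ≤ ρ.real (Set.Iic (2 * √n)) := by
    have h4 : ρ.real (Set.Iic (2 * √n))ᶜ ≤ 1 / 4 := by
      rw [hρ, map_measureReal_apply (by fun_prop) measurableSet_Iic.compl]
      have h5 := mul_meas_ge_le_lintegral₀ (μ := γ) (f := fun x => ENNReal.ofReal (‖x‖ ^ 2))
        (by fun_prop) (ENNReal.ofReal (4 * n))
      rw [hγ, lintegral_norm_sq_stdGaussian, ← hγ] at h5
      have h6 : γ ((fun x => ‖x‖) ⁻¹' (Set.Iic (2 * √n))ᶜ)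
          ≤ γ {x | ENNReal.ofReal (4 * n) ≤ ENNReal.ofReal (‖x‖ ^ 2)} := by
        refine measure_mono fun x hx => ?_
        have hx' : 2 * √n < ‖x‖ := by simpa using hx
        refine ENNReal.ofReal_le_ofReal ?_
        calc 4 * (n : ℝ) = (2 * √n) ^ 2 := by rw [mul_pow, Real.sq_sqrt hn'.le]; norm_num
          _ ≤ _ := by gcongr
      have h7 := (mul_le_mul_right h6 (ENNReal.ofReal (4 * n))).trans h5
      have h8 := ENNReal.toReal_mono (ENNReal.natCast_ne_top n) h7
      rw [ENNReal.toReal_mul, ENNReal.toReal_ofReal (by positivity), ENNReal.toReal_natCast] at h8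
      change 4 * (n : ℝ) * γ.real _ ≤ n at h8
      rw [le_div_iff₀ (by norm_num)]
      nlinarith
    rw [probReal_compl_eq_one_sub measurableSet_Iic] at h4
    linarith
  have h9 := gaussianReal_real_abs_le_le (δ := 2 * δ) (by positivity)
  have h10 : 0 ≤ (sphereUniform n).real S := measureReal_nonneg
  nlinarith

/-- Overlaps of a uniform direction are rarely large. -/
lemma sphereUniform_real_lt_overlap_le (hn : 0 < n) {w : EuclideanSpace ℝ (Fin n)} (hw : ‖w‖ = 1)
    {κ : ℝ} (hκ : 0 < κ) :
    (sphereUniform n).real {u | √(κ / n) < |(inner ℝ u w : ℝ)|} ≤ 1 / κ := by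
  have : IsProbabilityMeasure (sphereUniform n) := isProbabilityMeasure_sphereUniform hn
  set γ := stdGaussian (EuclideanSpace ℝ (Fin n)) with hγ
  have hρ1 : IsProbabilityMeasure (γ.map fun x => ‖x‖) :=
    Measure.isProbabilityMeasure_map (by fun_prop)
  have hn' : (0 : ℝ) < n := by exact_mod_cast hn
  set f : EuclideanSpace ℝ (Fin n) → ℝ≥0∞ := fun u => ENNReal.ofReal ((inner ℝ u w : ℝ) ^ 2) with hf
  have hfm : Measurable f := by fun_prop
  -- By independence the Gaussian second moment `1` is the spherical one times `E ‖x‖ ^ 2 = n`;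
  -- Markov's inequality then concludes.
  have h1 : (∫⁻ u, f u ∂(sphereUniform n)) * n = 1 := by
    have h2 : ∫⁻ p : EuclideanSpace ℝ (Fin n) × ℝ, f p.1 * ENNReal.ofReal (p.2 ^ 2)
        ∂((sphereUniform n).prod (γ.map fun x => ‖x‖)) = _ :=
      lintegral_prod_mul (g := fun y : ℝ => ENNReal.ofReal (y ^ 2)) hfm.aemeasurable (by fun_prop)
    rw [← map_polar_stdGaussian hn, lintegral_map (by fun_prop) (by fun_prop),
      lintegral_map (by fun_prop) (by fun_prop), lintegral_norm_sq_stdGaussian] at h2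
    rw [← h2, ← lintegral_inner_sq_stdGaussian hw]
    refine lintegral_congr fun x => ?_
    simp only [hf]
    rw [← ENNReal.ofReal_mul (sq_nonneg _), ← mul_pow]
    rcases eq_or_ne x 0 with rfl | hx
    · simp
    have hx0 : 0 < ‖x‖ := norm_pos_iff.2 hx
    rw [inner_smul_left]
    congr 2
    simp; field_simp
  have h2 := mul_meas_ge_le_lintegral₀ (μ := sphereUniform n) hfm.aemeasurable
    (ENNReal.ofReal (κ / n))
  have h3 : sphereUniform n {u | √(κ / n) < |(inner ℝ u w : ℝ)|}
      ≤ sphereUniform n {u | ENNReal.ofReal (κ / n) ≤ f u} := by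
    refine measure_mono fun u (hu : √(κ / n) < |(inner ℝ u w : ℝ)|) => ?_
    refine ENNReal.ofReal_le_ofReal ?_
    rw [← sq_abs]
    exact (Real.lt_sq_of_sqrt_lt hu).le
  have h4 := mul_le_mul_left ((mul_le_mul_right h3 (ENNReal.ofReal (κ / n))).trans h2) (n : ℝ≥0∞)
  rw [h1] at h4
  have h5 := ENNReal.toReal_mono ENNReal.one_ne_top h4
  rw [ENNReal.toReal_mul, ENNReal.toReal_mul, ENNReal.toReal_ofReal (by positivity),
    ENNReal.toReal_natCast, ENNReal.toReal_one] at h5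
  change κ / n * (sphereUniform n).real _ * n ≤ 1 at h5
  rw [le_div_iff₀ hκ]
  calc _ = κ / n * (sphereUniform n).real {u | √(κ / n) < |(inner ℝ u w : ℝ)|} * n := by field_simp
    _ ≤ 1 := h5

end SphereBounds

end SpikedTensor

namespace SpikedTensor

/-! ### The mixture weights as Gaussian probabilities. -/

section Weights

open scoped ENNReal

variable {n r d : ℕ}

lemma measureReal_prod_eq_integral {α γ : Type*} [MeasurableSpace α] [MeasurableSpace γ]
    {μ : Measure α} {ν : Measure γ} [IsFiniteMeasure μ] [IsFiniteMeasure ν] {A : Set (α × γ)}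
    (hA : MeasurableSet A) : (μ.prod ν).real A = ∫ x, ν.real (Prod.mk x ⁻¹' A) ∂μ := by
  rw [measureReal_def, Measure.prod_apply hA]
  exact (integral_toReal (measurable_measure_prodMk_left hA).aemeasurable
    (ae_of_all _ fun _ => measure_lt_top _ _)).symm

lemma two_mul_gaussianPDFReal (y : ℝ) :
    2 * gaussianPDFReal 0 1 y = √(2 / Real.pi) * Real.exp (-y ^ 2 / 2) := by
  have h : 2 * (√(2 * Real.pi))⁻¹ = √(2 / Real.pi) := by
    have h2 : 0 < Real.pi := Real.pi_pos
    rw [Real.sqrt_mul (by norm_num), Real.sqrt_div (by norm_num)]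
    have h3 := Real.mul_self_sqrt (show (0 : ℝ) ≤ 2 by norm_num)
    have : 0 < √Real.pi := Real.sqrt_pos.2 h2
    field_simp
    nlinarith
  rw [gaussianPDFReal, ← mul_assoc]
  simp only [NNReal.coe_one, mul_one, sub_zero]
  rw [h]

lemma gaussianPDFReal_abs (y : ℝ) : gaussianPDFReal 0 1 |y| = gaussianPDFReal 0 1 y := by
  simp [gaussianPDFReal, sq_abs]

lemma integral_comp_abs_gaussianReal (F : ℝ → ℝ) : ∫ x, F |x| ∂(gaussianReal 0 1)
    = ∫ x in Set.Ioi (0 : ℝ), √(2 / Real.pi) * Real.exp (-x ^ 2 / 2) * F x := by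
  rw [integral_gaussianReal_eq_integral_smul one_ne_zero]
  have h := integral_comp_abs (f := fun x => gaussianPDFReal 0 1 x * F x)
  simp only [gaussianPDFReal_abs] at h
  simp only [smul_eq_mul]
  rw [h, ← integral_const_mul]
  refine integral_congr_ae (ae_of_all _ fun x => ?_)
  simp only [← two_mul_gaussianPDFReal]
  ring

lemma gaussianReal_real_abs_le {z : ℝ} (hz : 0 ≤ z) : (gaussianReal 0 1).real {y | |y| ≤ z}
    = ∫ y in (0 : ℝ)..z, √(2 / Real.pi) * Real.exp (-y ^ 2 / 2) := by
  have hm : MeasurableSet {y : ℝ | |y| ≤ z} := measurableSet_le (by fun_prop) measurable_const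
  have h := integral_comp_abs_gaussianReal ((Set.Iic z).indicator fun _ => 1)
  have h1 : (fun x : ℝ => (Set.Iic z).indicator (fun _ => (1 : ℝ)) |x|)
      = {y : ℝ | |y| ≤ z}.indicator fun _ => 1 := by
    ext x; simp [Set.indicator]
  rw [h1, integral_indicator_const _ hm] at h
  rw [smul_eq_mul, mul_one] at h
  rw [h, intervalIntegral.integral_of_le hz]
  have h2 : (fun x : ℝ => √(2 / Real.pi) * Real.exp (-x ^ 2 / 2)
        * (Set.Iic z).indicator (fun _ => (1 : ℝ)) x)
      = (Set.Iic z).indicator fun x => √(2 / Real.pi) * Real.exp (-x ^ 2 / 2) := by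
    ext x; by_cases hx : x ≤ z <;> simp [Set.indicator, hx]
  rw [h2, setIntegral_indicator measurableSet_Iic, Set.Ioi_inter_Iic]

/-- Comparing the strengths of two spikes amounts to comparing overlaps. -/
lemma abs_mul_pow_le_iff {b b' x y : ℝ} (hd : 0 < d) (hb : b ≠ 0) :
    |b * x ^ d| ≤ |b' * y ^ d| ↔ |x| ≤ (|b'| / |b|) ^ (1 / (d : ℝ)) * |y| := by
  have hb0 : 0 < |b| := abs_pos.2 hb
  have hc : ((|b'| / |b|) ^ (1 / (d : ℝ))) ^ d = |b'| / |b| := by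
    rw [one_div, Real.rpow_inv_natCast_pow (by positivity) hd.ne']
  rw [← pow_le_pow_iff_left₀ (abs_nonneg x) (by positivity) hd.ne', mul_pow, hc, abs_mul, abs_mul,
    abs_pow, abs_pow, div_mul_eq_mul_div, le_div_iff₀ hb0, mul_comm |b|]

/-- Given the coordinate `i`, the other coordinates are independent and each has to stay below a
fixed multiple of `|x i|`; Fubini yields the product of half-normal integrals. -/
lemma weight_eq_gaussVec (hd : 0 < d) {β : Fin r → ℝ} (hβ : ∀ j, β j ≠ 0) (i : Fin r) :
    (gaussVec (Fin r) 1).real {x | ∀ j, |β j * x j ^ d| ≤ |β i * x i ^ d|}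
      = weight (d + 2) β i := by
  obtain _ | m := r
  · exact i.elim0
  set c : Fin (m + 1) → ℝ := fun j => (|β i| / |β j|) ^ (1 / (d : ℝ)) with hc
  have hc0 : ∀ j, 0 ≤ c j := fun j => by positivity
  have hmp := measurePreserving_piFinSuccAbove (fun _ : Fin (m + 1) => gaussianReal 0 1) i
  set A : Set (ℝ × (Fin m → ℝ)) := {p | ∀ j, |p.2 j| ≤ c (i.succAbove j) * |p.1|} with hA
  have hAm : MeasurableSet A := by
    have : A = ⋂ j, {p | |p.2 j| ≤ c (i.succAbove j) * |p.1|} := by ext; simp [hA]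
    rw [this]
    exact MeasurableSet.iInter fun j => measurableSet_le (by fun_prop) (by fun_prop)
  have hset : {x : Fin (m + 1) → ℝ | ∀ j, |β j * x j ^ d| ≤ |β i * x i ^ d|}
      = MeasurableEquiv.piFinSuccAbove (fun _ => ℝ) i ⁻¹' A := by
    ext x
    simp only [Set.mem_ofPred_eq, Set.mem_preimage, hA, MeasurableEquiv.piFinSuccAbove_apply,
      abs_mul_pow_le_iff hd (hβ _)]
    rw [Fin.forall_iff_succAbove i]
    simp [Fin.removeNth, hc, abs_pos.2 (hβ i) |>.ne']
  have h1 : (gaussVec (Fin (m + 1)) 1).real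
      (MeasurableEquiv.piFinSuccAbove (fun _ => ℝ) i ⁻¹' A)
      = ((gaussianReal 0 1).prod (gaussVec (Fin m) 1)).real A := by
    rw [← hmp.map_eq, map_measureReal_apply (MeasurableEquiv.measurable _) hAm]
  rw [hset, h1, measureReal_prod_eq_integral hAm]
  have h2 : ∀ x : ℝ, (gaussVec (Fin m) 1).real (Prod.mk x ⁻¹' A)
      = ∏ j, ∫ y in (0 : ℝ)..(c (i.succAbove j) * |x|), √(2 / Real.pi) * Real.exp (-y ^ 2 / 2) := by
    intro x
    have : Prod.mk x ⁻¹' A = Set.univ.pi fun j => {y : ℝ | |y| ≤ c (i.succAbove j) * |x|} := by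
      ext z; simp [hA]
    rw [this, gaussVec, measureReal_def, Measure.pi_pi, ENNReal.toReal_prod]
    refine Finset.prod_congr rfl fun j _ => ?_
    rw [← gaussianReal_real_abs_le (mul_nonneg (hc0 _) (abs_nonneg _)), measureReal_def]
  simp_rw [h2]
  rw [integral_comp_abs_gaussianReal fun x => ∏ j,
    ∫ y in (0 : ℝ)..(c (i.succAbove j) * x), √(2 / Real.pi) * Real.exp (-y ^ 2 / 2)]
  rw [weight]
  refine integral_congr_ae (ae_of_all _ fun x => ?_)
  simp only
  congr 1
  rw [Fin.univ_succAbove m i, Finset.erase_cons, Finset.prod_map]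
  refine Finset.prod_congr rfl fun j _ => ?_
  simp only [hc, Fin.succAboveEmb_apply]
  push_cast
  ring_nf

/-- Given `x i`, a near tie confines `|x j|` to a window of relative width at most `1 / κ`, because
`q ^ d ≤ q` for `q = 1 - 1 / κ`. -/
lemma gaussVec_real_window_le (hd : 0 < d) {β : Fin r → ℝ} (hβ : ∀ j, β j ≠ 0) {i j : Fin r}
    (hij : i ≠ j) {κ : ℝ} (hκ : 2 ≤ κ) :
    (gaussVec (Fin r) 1).real {x | (1 - 1 / κ) * |β i * x i ^ d| < |β j * x j ^ d| ∧
      |β j * x j ^ d| ≤ |β i * x i ^ d|} ≤ 2 / κ := by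
  set q : ℝ := 1 - 1 / κ with hq
  have hκ0 : 0 < κ := by linarith
  have hκ1 : 1 / κ ≤ 1 / 2 := by gcongr
  have hκ2 : 0 < 1 / κ := by positivity
  set c : ℝ := (|β i| / |β j|) ^ (1 / (d : ℝ)) with hc
  have hc0 : 0 ≤ c := by positivity
  set A : Set (ℝ × ℝ) := {p | q * (c * |p.1|) ≤ |p.2| ∧ |p.2| ≤ c * |p.1|} with hA
  have hAm : MeasurableSet A := by
    change MeasurableSet ({p : ℝ × ℝ | q * (c * |p.1|) ≤ |p.2|} ∩ {p | |p.2| ≤ c * |p.1|})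
    exact (measurableSet_le (by fun_prop) (by fun_prop)).inter
      (measurableSet_le (by fun_prop) (by fun_prop))
  have hmap : (gaussVec (Fin r) 1).map (fun x => (x i, x j))
      = (gaussianReal 0 1).prod (gaussianReal 0 1) := by
    have h1 := (iIndepFun_pi (μ := fun _ : Fin r => gaussianReal 0 1)
      (X := fun _ x => x) (fun _ => by fun_prop)).indepFun hij
    rw [indepFun_iff_map_prod_eq_prod_map_map (measurable_pi_apply i).aemeasurable
      (measurable_pi_apply j).aemeasurable] at h1
    rw [h1, (measurePreserving_eval _ i).map_eq, (measurePreserving_eval _ j).map_eq]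
  have hsub : {x : Fin r → ℝ | q * |β i * x i ^ d| < |β j * x j ^ d| ∧
      |β j * x j ^ d| ≤ |β i * x i ^ d|} ⊆ (fun x => (x i, x j)) ⁻¹' A := by
    rintro x ⟨h1, h2⟩
    have h3 : |x j| ≤ c * |x i| := (abs_mul_pow_le_iff hd (hβ j)).1 h2
    refine ⟨?_, h3⟩
    by_contra hlt
    push Not at hlt
    have h4 : |x j| ≤ c * |q * x i| := by
      rw [abs_mul, abs_of_nonneg (show 0 ≤ q by linarith)]
      exact hlt.le.trans_eq (by ring)
    have h5 := (abs_mul_pow_le_iff hd (hβ j)).2 h4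
    have h6 : |β i * (q * x i) ^ d| ≤ q * |β i * x i ^ d| := by
      have : β i * (q * x i) ^ d = q ^ d * (β i * x i ^ d) := by rw [mul_pow]; ring
      rw [this, abs_mul, abs_of_nonneg (pow_nonneg (by linarith) d)]
      gcongr
      exact pow_le_of_le_one (by linarith) (by linarith) hd.ne'
    linarith
  have h1 : ((gaussianReal 0 1).prod (gaussianReal 0 1)).real A ≤ 2 / κ := by
    rw [measureReal_prod_eq_integral hAm]
    calc ∫ x, (gaussianReal 0 1).real (Prod.mk x ⁻¹' A) ∂(gaussianReal 0 1)
        ≤ ∫ _, 2 / κ ∂(gaussianReal 0 1) := by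
          refine integral_mono_of_nonneg (ae_of_all _ fun _ => measureReal_nonneg)
            (integrable_const _) (ae_of_all _ fun x => ?_)
          refine (gaussianReal_real_window_le (q := q) (z := c * |x|) (by linarith) (by linarith)
            (by positivity)).trans_eq ?_
          rw [hq]; ring
      _ = _ := by simp
  refine (measureReal_mono hsub (measure_ne_top _ _)).trans ?_
  rw [← map_measureReal_apply (by fun_prop) hAm, hmap]
  exact h1

/-- The uniform measure of a scale invariant event in the overlaps. -/
lemma sphereUniform_real_of_scale_invariant (hn : 0 < n) {v : Fin r → EuclideanSpace ℝ (Fin n)}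
    (hv : Orthonormal ℝ v) {A : Set (Fin r → ℝ)} (hA : MeasurableSet A)
    (hinv : ∀ c : ℝ, 0 < c → ∀ x, c • x ∈ A ↔ x ∈ A) :
    (sphereUniform n).real {u | (fun j => (inner ℝ u (v j) : ℝ)) ∈ A} = (gaussVec (Fin r) 1).real A := by
  have hm : Measurable fun (x : EuclideanSpace ℝ (Fin n)) (j : Fin r) => (inner ℝ x (v j) : ℝ) :=
    Continuous.measurable (by fun_prop)
  change (sphereUniform n).real ((fun u j => (inner ℝ u (v j) : ℝ)) ⁻¹' A) = _
  rw [← map_normalize_stdGaussian hn, map_measureReal_apply (by fun_prop) (hm hA),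
    ← map_overlap_stdGaussian hv, map_measureReal_apply hm hA]
  congr 1
  ext x
  rcases eq_or_ne x 0 with rfl | hx
  · simp
  have hx0 : 0 < ‖x‖⁻¹ := inv_pos.2 (norm_pos_iff.2 hx)
  rw [Set.mem_preimage, Set.mem_preimage, Set.mem_preimage, ← hinv _ hx0 (fun j => inner ℝ x (v j))]
  congr! 1
  ext j
  simp [inner_smul_left]

end Weights

end SpikedTensor

namespace SpikedTensor

/-! ### The probability of the good initializations. -/

section Initialization

variable {n r d : ℕ} {β : Fin r → ℝ} {v : Fin r → EuclideanSpace ℝ (Fin n)} {i : Fin r} {κ : ℝ}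

lemma measurableSet_argmax (d : ℕ) (β : Fin r → ℝ) (i : Fin r) :
    MeasurableSet {x : Fin r → ℝ | ∀ j, |β j * x j ^ d| ≤ |β i * x i ^ d|} := by
  have : {x : Fin r → ℝ | ∀ j, |β j * x j ^ d| ≤ |β i * x i ^ d|}
      = ⋂ j, {x | |β j * x j ^ d| ≤ |β i * x i ^ d|} := by ext; simp
  rw [this]
  exact MeasurableSet.iInter fun j => measurableSet_le (by fun_prop) (by fun_prop)

lemma measurableSet_isArgmax (k : ℕ) (β : Fin r → ℝ) (v : Fin r → EuclideanSpace ℝ (Fin n))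
    (i : Fin r) : MeasurableSet {u | IsArgmax k β v i u} := by
  have hm : Measurable fun (x : EuclideanSpace ℝ (Fin n)) (j : Fin r) => (inner ℝ x (v j) : ℝ) :=
    Continuous.measurable (by fun_prop)
  exact hm (measurableSet_argmax (k - 2) β i)

lemma sphereUniform_real_isArgmax (hn : 0 < n) (hd : 0 < d) (hβ : ∀ j, β j ≠ 0)
    (hv : Orthonormal ℝ v) (i : Fin r) :
    (sphereUniform n).real {u | IsArgmax (d + 2) β v i u} = weight (d + 2) β i := by
  rw [← weight_eq_gaussVec hd hβ i, ← sphereUniform_real_of_scale_invariant hn hv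
    (measurableSet_argmax d β i)]
  · rfl
  · intro c hc x
    simp only [Set.mem_ofPred_eq, Pi.smul_apply, smul_eq_mul]
    have h : ∀ j, |β j * (c * x j) ^ d| = c ^ d * |β j * x j ^ d| := fun j => by
      rw [mul_pow, mul_left_comm, abs_mul, abs_of_pos (pow_pos hc d)]
    simp only [h]
    exact forall_congr' fun j => mul_le_mul_iff_right₀ (pow_pos hc d)

lemma sphereUniform_real_window_le (hn : 0 < n) (hd : 0 < d) (hβ : ∀ j, β j ≠ 0)
    (hv : Orthonormal ℝ v) {j : Fin r} (hij : i ≠ j) (hκ : 2 ≤ κ) :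
    (sphereUniform n).real {u | (1 - 1 / κ) * |β i * inner ℝ u (v i) ^ d|
        < |β j * inner ℝ u (v j) ^ d| ∧
      |β j * inner ℝ u (v j) ^ d| ≤ |β i * inner ℝ u (v i) ^ d|} ≤ 2 / κ := by
  refine le_of_eq_of_le ?_ (gaussVec_real_window_le hd hβ hij hκ)
  rw [← sphereUniform_real_of_scale_invariant hn hv]
  · rfl
  · change MeasurableSet ({x : Fin r → ℝ | (1 - 1 / κ) * |β i * x i ^ d| < |β j * x j ^ d|}
      ∩ {x : Fin r → ℝ | |β j * x j ^ d| ≤ |β i * x i ^ d|})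
    exact (measurableSet_lt (by fun_prop) (by fun_prop)).inter
      (measurableSet_le (by fun_prop) (by fun_prop))
  · intro c hc x
    simp only [Set.mem_ofPred_eq, Pi.smul_apply, smul_eq_mul]
    have h : ∀ j, |β j * (c * x j) ^ d| = c ^ d * |β j * x j ^ d| := fun j => by
      rw [mul_pow, mul_left_comm, abs_mul, abs_of_pos (pow_pos hc d)]
    simp only [h]
    rw [mul_left_comm, mul_lt_mul_iff_right₀ (pow_pos hc d), mul_le_mul_iff_right₀ (pow_pos hc d)]

lemma measurableSet_goodInit (k : ℕ) (κ : ℝ) (β : Fin r → ℝ)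
    (v : Fin r → EuclideanSpace ℝ (Fin n)) (i : Fin r) :
    MeasurableSet {u | GoodInit k κ β v i u} := by
  have : {u | GoodInit k κ β v i u} = (⋂ j, ({u : EuclideanSpace ℝ (Fin n) |
        1 / √(κ * n) ≤ |(inner ℝ u (v j) : ℝ)|} ∩ {u | |(inner ℝ u (v j) : ℝ)| ≤ √(κ / n)}))
      ∩ ⋂ j, {u | j ≠ i → |β j * inner ℝ u (v j) ^ (k - 2)|
        ≤ (1 - 1 / κ) * |β i * inner ℝ u (v i) ^ (k - 2)|} := by
    ext u; simp [GoodInit, forall_and]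
  rw [this]
  refine (MeasurableSet.iInter fun j => (measurableSet_le (by fun_prop) (by fun_prop)).inter
    (measurableSet_le (by fun_prop) (by fun_prop))).inter (MeasurableSet.iInter fun j => ?_)
  by_cases hj : j = i
  · simp [hj]
  · simp only [ne_eq, hj, not_false_eq_true, forall_true_left]
    exact measurableSet_le (by fun_prop) (by fun_prop)

lemma GoodInit.isArgmax {k : ℕ} {u : EuclideanSpace ℝ (Fin n)} (hκ : 0 < κ)
    (h : GoodInit k κ β v i u) : IsArgmax k β v i u := by
  intro j
  by_cases hj : j = i
  · rw [hj]
  · refine (h.2 j hj).trans (mul_le_of_le_one_left (abs_nonneg _) ?_)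
    have : 0 < 1 / κ := by positivity
    linarith

/-- The good initializations have almost the probability of the argmax event. -/
lemma abs_sphereUniform_real_goodInit_sub_le (hn : 0 < n) (hd : 0 < d) (hβ : ∀ j, β j ≠ 0)
    (hv : Orthonormal ℝ v) (i : Fin r) (hκ : 1 ≤ κ) :
    |(sphereUniform n).real {u | GoodInit (d + 2) κ β v i u} - weight (d + 2) β i|
      ≤ (6 * r + 2) / √κ := by
  have : IsProbabilityMeasure (sphereUniform n) := isProbabilityMeasure_sphereUniform hn
  have hκ0 : 0 < κ := by linarith
  have hs : 0 < √κ := Real.sqrt_pos.2 hκ0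
  have hsκ := Real.mul_self_sqrt hκ0.le
  have hle : (sphereUniform n).real {u | GoodInit (d + 2) κ β v i u} ≤ weight (d + 2) β i := by
    rw [← sphereUniform_real_isArgmax hn hd hβ hv i]
    exact measureReal_mono fun u hu => GoodInit.isArgmax hκ0 hu
  have h0 : 0 ≤ (sphereUniform n).real {u | GoodInit (d + 2) κ β v i u} := measureReal_nonneg
  have hw1 : weight (d + 2) β i ≤ 1 := by
    rw [← sphereUniform_real_isArgmax hn hd hβ hv i]
    exact measureReal_le_one
  rw [abs_sub_comm, abs_of_nonneg (by linarith)]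
  -- For `κ < 2` the claimed bound exceeds one.
  rcases lt_or_ge κ 2 with h2 | h2
  · have h3 : √κ ≤ 2 := by nlinarith
    have h4 : 1 ≤ (6 * r + 2) / √κ := by
      rw [le_div_iff₀ hs]
      have : (0 : ℝ) ≤ r := Nat.cast_nonneg r
      linarith
    linarith
  set A : Set (EuclideanSpace ℝ (Fin n)) := ⋃ j, {u | |(inner ℝ u (v j) : ℝ)| < 1 / √κ / √n} with hA
  set B : Set (EuclideanSpace ℝ (Fin n)) := ⋃ j, {u | √(κ / n) < |(inner ℝ u (v j) : ℝ)|} with hB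
  set W : Fin r → Set (EuclideanSpace ℝ (Fin n)) := fun j => if i = j then ∅ else
    {u | (1 - 1 / κ) * |β i * inner ℝ u (v i) ^ d| < |β j * inner ℝ u (v j) ^ d| ∧
      |β j * inner ℝ u (v j) ^ d| ≤ |β i * inner ℝ u (v i) ^ d|} with hW
  -- A maximizer fails to be good through a small overlap, a large overlap or a near tie. The small
  -- overlaps dictate the rate `1 / √κ`; the other two have probability `O(1 / κ)`.
  have hsub : {u | IsArgmax (d + 2) β v i u}
      ⊆ {u | GoodInit (d + 2) κ β v i u} ∪ (A ∪ (B ∪ ⋃ j, W j)) := by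
    intro u (hu : IsArgmax (d + 2) β v i u)
    by_contra hc
    simp only [Set.mem_union, not_or, hA, hB, Set.mem_iUnion, not_exists] at hc
    obtain ⟨h1, h2, h3, h4⟩ := hc
    refine h1 ⟨fun j => ⟨?_, not_lt.1 (h3 j)⟩, fun j hj => ?_⟩
    · have h2j : ¬ |(inner ℝ u (v j) : ℝ)| < 1 / √κ / √n := h2 j
      have := not_lt.1 h2j
      rwa [Real.sqrt_mul hκ0.le, ← div_div]
    · by_contra hlt
      refine h4 j ?_
      simp only [hW, if_neg (Ne.symm hj)]
      exact ⟨not_le.1 hlt, hu j⟩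
  have hPA : (sphereUniform n).real A ≤ r * (3 / √κ) := by
    refine (measureReal_iUnion_fintype_le _).trans ?_
    refine (Finset.sum_le_card_nsmul _ _ (3 * (1 / √κ)) fun j _ =>
      sphereUniform_real_overlap_lt_le hn (hv.1 j) (by positivity)).trans_eq ?_
    rw [nsmul_eq_mul, Finset.card_univ, Fintype.card_fin]
    ring
  have hκs : 1 / κ ≤ 1 / √κ := by
    refine one_div_le_one_div_of_le hs ?_
    have : 1 ≤ √κ := Real.one_le_sqrt.2 hκ
    nlinarith
  have hPB : (sphereUniform n).real B ≤ r * (1 / √κ) := by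
    refine (measureReal_iUnion_fintype_le _).trans ?_
    refine (Finset.sum_le_card_nsmul _ _ (1 / √κ) fun j _ =>
      (sphereUniform_real_lt_overlap_le hn (hv.1 j) hκ0).trans hκs).trans_eq ?_
    simp
  have hPW : (sphereUniform n).real (⋃ j, W j) ≤ r * (2 / √κ) := by
    refine (measureReal_iUnion_fintype_le _).trans ?_
    refine (Finset.sum_le_card_nsmul _ _ (2 / √κ) fun j _ => ?_).trans_eq (by simp)
    by_cases hij : i = j
    · simp only [hW, if_pos hij, measureReal_empty]; positivity
    · simp only [hW, if_neg hij]
      refine (sphereUniform_real_window_le hn hd hβ hv hij h2).trans ?_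
      calc 2 / κ = 2 * (1 / κ) := by ring
        _ ≤ 2 * (1 / √κ) := by gcongr
        _ = _ := by ring
  have h5 := measureReal_mono (μ := sphereUniform n) hsub
  rw [sphereUniform_real_isArgmax hn hd hβ hv i] at h5
  have h6 := measureReal_union_le (μ := sphereUniform n) {u | GoodInit (d + 2) κ β v i u}
    (A ∪ (B ∪ ⋃ j, W j))
  have h7 := measureReal_union_le (μ := sphereUniform n) A (B ∪ ⋃ j, W j)
  have h8 := measureReal_union_le (μ := sphereUniform n) B (⋃ j, W j)
  have h9 : (6 * r + 2) / √κ = r * (3 / √κ) + r * (1 / √κ) + r * (2 / √κ) + 2 / √κ := by ring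
  have h10 : 0 ≤ 2 / √κ := by positivity
  linarith

lemma measurable_limitSign (k : ℕ) (b : ℝ) (T : ℕ) : Measurable (limitSign k b T) := by
  have hs : Measurable Real.sign := by
    unfold Real.sign
    exact Measurable.ite measurableSet_Iio measurable_const
      (Measurable.ite measurableSet_Ioi measurable_const measurable_const)
  unfold limitSign
  split_ifs
  · exact measurable_const
  · exact measurable_const.mul hs

lemma measurableSet_goodInit_sign (k : ℕ) (κ : ℝ) (β : Fin r → ℝ)
    (v : Fin r → EuclideanSpace ℝ (Fin n)) (i : Fin r) (T : ℕ) (s : ℝ) :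
    MeasurableSet {u | GoodInit k κ β v i u ∧ limitSign k (β i) T (inner ℝ u (v i)) = s} :=
  (measurableSet_goodInit k κ β v i).inter
    (((measurable_limitSign k (β i) T).comp (by fun_prop : Measurable fun u :
      EuclideanSpace ℝ (Fin n) => (inner ℝ u (v i) : ℝ))) (measurableSet_singleton s))

lemma goodInit_neg {k : ℕ} {u : EuclideanSpace ℝ (Fin n)} :
    GoodInit k κ β v i (-u) ↔ GoodInit k κ β v i u := by
  simp only [GoodInit, inner_neg_left, abs_neg, abs_mul, abs_pow]

lemma limitSign_sq {k : ℕ} {b x : ℝ} (T : ℕ) (hb : b ≠ 0) (hx : x ≠ 0) :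
    limitSign k b T x * limitSign k b T x = 1 := by
  have h1 := sign_sq hb
  have h2 := sign_sq hx
  unfold limitSign
  split_ifs
  · exact h1
  · calc _ = (Real.sign b * Real.sign b) ^ T * (Real.sign x * Real.sign x) := by rw [mul_pow]; ring
      _ = 1 := by rw [h1, h2, one_pow, one_mul]

lemma GoodInit.inner_ne_zero {k : ℕ} {u : EuclideanSpace ℝ (Fin n)} (hn : 0 < n) (hκ : 0 < κ)
    (h : GoodInit k κ β v i u) : (inner ℝ u (v i) : ℝ) ≠ 0 := by
  have hn' : (0 : ℝ) < n := by exact_mod_cast hn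
  have h1 := (h.1 i).1
  have h2 : 0 < 1 / √(κ * n) := by positivity
  exact abs_pos.1 (h2.trans_le h1)

lemma abs_sphereUniform_real_goodInit_sign_sub_le (hn : 0 < n) (hd : 0 < d) (hβ : ∀ j, β j ≠ 0)
    (hv : Orthonormal ℝ v) (i : Fin r) (hκ : 1 ≤ κ) (T : ℕ) (s : ℤˣ) :
    |(sphereUniform n).real {u | GoodInit (d + 2) κ β v i u ∧
        limitSign (d + 2) (β i) T (inner ℝ u (v i)) = ((s : ℤ) : ℝ)}
      - signedWeight (d + 2) β i s| ≤ (6 * r + 2) / √κ := by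
  have : IsProbabilityMeasure (sphereUniform n) := isProbabilityMeasure_sphereUniform hn
  have hκ0 : 0 < κ := by linarith
  have h0 : 0 ≤ (6 * r + 2) / √κ := by positivity
  have hE := abs_sphereUniform_real_goodInit_sub_le hn hd hβ hv i hκ
  by_cases hodd : Odd (d + 2)
  · simp only [limitSign, signedWeight, if_pos hodd]
    by_cases hs : Real.sign (β i) = ((s : ℤ) : ℝ)
    · simpa only [hs, and_true, if_true] using hE
    · simpa only [hs, and_false, if_false, sub_zero, Set.ofPred_false, measureReal_empty, abs_zero]
        using h0
  · simp only [signedWeight, if_neg hodd]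
    set S : ℝ → Set (EuclideanSpace ℝ (Fin n)) := fun s => {u | GoodInit (d + 2) κ β v i u ∧
        limitSign (d + 2) (β i) T (inner ℝ u (v i)) = s} with hS
    have hSm : ∀ s, MeasurableSet (S s) := fun s => measurableSet_goodInit_sign _ _ _ _ _ _ _
    -- For even `k` the limit sign is odd in `u`, while the good event and the uniform law are
    -- invariant under `u ↦ -u`: both signs have equal probability.
    have hneg : ∀ s, (sphereUniform n).real (S (-s)) = (sphereUniform n).real (S s) := by
      intro s
      conv_rhs => rw [← map_neg_sphereUniform hn, map_measureReal_apply (by fun_prop) (hSm s)]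
      congr 1
      ext u
      simp only [hS, Set.mem_preimage, Set.mem_ofPred_eq, goodInit_neg, inner_neg_left, limitSign,
        if_neg hodd, Real.sign_neg, mul_neg, neg_eq_iff_eq_neg]
    have hunion : {u | GoodInit (d + 2) κ β v i u} = S 1 ∪ S (-1) := by
      ext u
      simp only [hS, Set.mem_union, Set.mem_ofPred_eq, ← and_or_left]
      refine ⟨fun h => ⟨h, ?_⟩, fun h => h.1⟩
      exact mul_self_eq_one_iff.1 (limitSign_sq T (hβ i) (h.inner_ne_zero hn hκ0))
    have hdisj : Disjoint (S 1) (S (-1)) := by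
      rw [Set.disjoint_left]
      rintro u ⟨_, h1⟩ ⟨_, h2⟩
      rw [h1] at h2
      norm_num at h2
    have hsum : (sphereUniform n).real {u | GoodInit (d + 2) κ β v i u}
        = 2 * (sphereUniform n).real (S 1) := by
      rw [hunion, measureReal_union hdisj (hSm _), hneg]; ring
    have hs : (sphereUniform n).real (S ((s : ℤ) : ℝ)) = (sphereUniform n).real (S 1) := by
      rcases Int.units_eq_one_or s with rfl | rfl
      · simp
      · simpa using hneg 1
    rw [hsum] at hE
    change |(sphereUniform n).real (S ((s : ℤ) : ℝ)) - _| ≤ _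
    rw [hs]
    have h1 := abs_le.1 hE
    rw [abs_le]
    constructor <;> linarith

end Initialization

end SpikedTensor

namespace SpikedTensor

/-! ### Independence of initialization and noise. -/

section Model

open scoped ENNReal

variable {Ω : Type*} [MeasurableSpace Ω] {P : Measure Ω} {k m n r : ℕ}
  {Z : Ω → Tensor k n} {u : Ω → EuclideanSpace ℝ (Fin n)}

/-- As an inequality this holds for arbitrary sets, so the failure of `OpBound` needs no
measurability proof. -/
lemma real_noise_le (h : HasLaw (fun ω => (Z ω, u ω)) ((noiseLaw k n).prod (sphereUniform n)) P)
    (hn : 0 < n) (B : Set (Tensor k n)) : P.real {ω | Z ω ∈ B} ≤ (noiseLaw k n).real B := by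
  have : IsProbabilityMeasure (sphereUniform n) := isProbabilityMeasure_sphereUniform hn
  have h1 := Measure.le_map_apply h.aemeasurable (B ×ˢ Set.univ)
  rw [h.map_eq, Measure.prod_prod, measure_univ, mul_one] at h1
  refine (ENNReal.toReal_mono (measure_ne_top _ _) ?_)
  refine le_trans (measure_mono fun ω hω => ?_) h1
  exact ⟨hω, Set.mem_univ _⟩

lemma real_init_inter_noise
    (h : HasLaw (fun ω => (Z ω, u ω)) ((noiseLaw k n).prod (sphereUniform n)) P)
    (hn : 0 < n) {A : Set (EuclideanSpace ℝ (Fin n))} {B : Set (Tensor k n)} (hA : MeasurableSet A)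
    (hB : MeasurableSet B) :
    P.real {ω | u ω ∈ A ∧ Z ω ∈ B} = (sphereUniform n).real A * (noiseLaw k n).real B := by
  have : IsProbabilityMeasure (sphereUniform n) := isProbabilityMeasure_sphereUniform hn
  rw [mul_comm, ← measureReal_prod_prod, ← h.map_eq,
    map_measureReal_apply_of_aemeasurable h.aemeasurable (hB.prod hA)]
  congr 1
  ext ω
  exact and_comm

lemma real_init (h : HasLaw (fun ω => (Z ω, u ω)) ((noiseLaw k n).prod (sphereUniform n)) P)
    (hn : 0 < n) {A : Set (EuclideanSpace ℝ (Fin n))} (hA : MeasurableSet A) :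
    P.real {ω | u ω ∈ A} = (sphereUniform n).real A := by
  simpa using real_init_inter_noise h hn hA MeasurableSet.univ

lemma sphereUniform_norm_ne_one (n : ℕ) : sphereUniform n {u | ‖u‖ ≠ 1} = 0 := by
  have hm : MeasurableSet {u : EuclideanSpace ℝ (Fin n) | ‖u‖ ≠ 1} :=
    (measurable_norm (measurableSet_singleton 1)).compl
  rw [sphereUniform, Measure.map_apply measurable_subtype_coe hm]
  have : (Subtype.val : Metric.sphere (0 : EuclideanSpace ℝ (Fin n)) 1 → EuclideanSpace ℝ (Fin n)) ⁻¹'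
      {u | ‖u‖ ≠ 1} = ∅ := by
    ext u; simp
  rw [this, measure_empty]

lemma real_norm_init_ne_one
    (h : HasLaw (fun ω => (Z ω, u ω)) ((noiseLaw k n).prod (sphereUniform n)) P)
    (hn : 0 < n) : P.real {ω | ‖u ω‖ ≠ 1} = 0 := by
  have hm : MeasurableSet {u : EuclideanSpace ℝ (Fin n) | ‖u‖ ≠ 1} :=
    (measurable_norm (measurableSet_singleton 1)).compl
  rw [show {ω | ‖u ω‖ ≠ 1} = {ω | u ω ∈ {u : EuclideanSpace ℝ (Fin n) | ‖u‖ ≠ 1}} from rfl,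
    real_init h hn hm, measureReal_def, sphereUniform_norm_ne_one, ENNReal.toReal_zero]

/-- Fubini: the adaptive bound holds for each fixed unit initialization. -/
lemma real_overlap_tail {Z : Ω → Tensor (m + 1) n}
    (h : HasLaw (fun ω => (Z ω, u ω)) ((noiseLaw (m + 1) n).prod (sphereUniform n)) P) (hn : 0 < n)
    (Y : Tensor (m + 1) n) (v : Fin r → EuclideanSpace ℝ (Fin n))
    (hv : ∀ j, ‖v j‖ = 1) (M : ℕ) {l : ℝ} (hl : 0 ≤ l) :
    P.real {ω | ∃ t < M, ∃ j,
        M * l < |(inner ℝ (v j) (contract (Z ω) (powerIter (Y + Z ω) (u ω) t)) : ℝ)|}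
      ≤ M * (r * (2 * Real.exp (-(n * l ^ 2 / 2)))) := by
  have : IsProbabilityMeasure (sphereUniform n) := isProbabilityMeasure_sphereUniform hn
  set B : Set (Tensor (m + 1) n × EuclideanSpace ℝ (Fin n)) := {p | ∃ t < M, ∃ j,
        M * l < |(inner ℝ (v j) (contract p.1 (powerIter (Y + p.1) p.2 t)) : ℝ)|} with hB
  have hBm : MeasurableSet B := by
    have : B = ⋃ t, ⋃ _ : t < M, ⋃ j, {p |
        M * l < |(inner ℝ (v j) (contract p.1 (powerIter (Y + p.1) p.2 t)) : ℝ)|} := by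
      ext p; simp [hB]
    rw [this]
    refine MeasurableSet.iUnion fun t => MeasurableSet.iUnion fun _ => MeasurableSet.iUnion fun j =>
      measurableSet_lt measurable_const ?_
    have h1 : Measurable fun p : Tensor (m + 1) n × EuclideanSpace ℝ (Fin n) =>
        powerIter (Y + p.1) p.2 t :=
      (measurable_powerIter t).comp (by fun_prop : Measurable fun p :
        Tensor (m + 1) n × EuclideanSpace ℝ (Fin n) => (Y + p.1, p.2))
    have h2 : Measurable fun p : Tensor (m + 1) n × EuclideanSpace ℝ (Fin n) =>
        contract p.1 (powerIter (Y + p.1) p.2 t) :=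
      continuous_contract.measurable.comp (measurable_fst.prodMk h1)
    have h3 : Measurable fun y : EuclideanSpace ℝ (Fin n) => |(inner ℝ (v j) y : ℝ)| := by fun_prop
    exact h3.comp h2
  refine ENNReal.toReal_le_of_le_ofReal (by positivity) ?_
  change P ((fun ω => (Z ω, u ω)) ⁻¹' B) ≤ _
  rw [← Measure.map_apply_of_aemeasurable h.aemeasurable hBm, h.map_eq, Measure.prod_apply_symm hBm]
  have hae : ∀ᵐ w ∂(sphereUniform n), ‖w‖ = 1 := sphereUniform_norm_ne_one n
  calc _ ≤ ∫⁻ _, ENNReal.ofReal (M * (r * (2 * Real.exp (-(n * l ^ 2 / 2))))) ∂(sphereUniform n) := by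
        refine lintegral_mono_ae ?_
        filter_upwards [hae] with w hw
        exact noiseLaw_overlap_tail Y v hv hw.le M hl
    _ = _ := by simp

lemma map_tinner_pureTensor_noiseLaw (hn : 0 < n) {c : ℝ} {w : Fin k → EuclideanSpace ℝ (Fin n)}
    (hc : c ^ 2 * ∏ s, ‖w s‖ ^ 2 = n) :
    (noiseLaw k n).map (fun Z => c * tinner Z (pureTensor w)) = gaussianReal 0 1 := by
  have h1 : (fun Z : Tensor k n => c * tinner Z (pureTensor w))
      = fun Z => (c • pureTensor w) ⬝ᵥ Z := by
    ext Z; rw [tinner_eq_dotProduct, smul_dotProduct, smul_eq_mul]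
  have h2 : (c • pureTensor w) ⬝ᵥ (c • pureTensor w) = n := by
    rw [smul_dotProduct, dotProduct_smul, ← tinner_eq_dotProduct, tinner_pureTensor_pureTensor,
      ← hc]
    simp only [real_inner_self_eq_norm_sq, smul_eq_mul]
    ring
  rw [h1]
  refine (map_dotProduct_gaussVec _ _).trans ?_
  rw [h2]
  congr 1
  have hn' : (n : ℝ≥0) ≠ 0 := by exact_mod_cast hn.ne'
  rw [Real.toNNReal_natCast, mul_inv_cancel₀ hn']

lemma measurable_tinner (η : Tensor k n) : Measurable fun Z : Tensor k n => tinner Z η := by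
  unfold tinner; fun_prop

/-- Selection depends on the initialization and the Gaussian main term on the noise; their
independence makes this factorization exact. -/
lemma real_init_inter_gaussian
    (h : HasLaw (fun ω => (Z ω, u ω)) ((noiseLaw k n).prod (sphereUniform n)) P)
    (hn : 0 < n) {A : Set (EuclideanSpace ℝ (Fin n))} (hA : MeasurableSet A)
    {c : ℝ} {w : Fin k → EuclideanSpace ℝ (Fin n)} (hc : c ^ 2 * ∏ s, ‖w s‖ ^ 2 = n) (t : ℝ) :
    P.real {ω | u ω ∈ A ∧ c * tinner (Z ω) (pureTensor w) ≤ t}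
      = P.real {ω | u ω ∈ A} * (gaussianReal 0 1).real (Set.Iic t) := by
  have hm : Measurable fun Z : Tensor k n => c * tinner Z (pureTensor w) :=
    (measurable_tinner _).const_mul c
  rw [real_init h hn hA, ← map_tinner_pureTensor_noiseLaw hn hc,
    map_measureReal_apply hm measurableSet_Iic]
  exact real_init_inter_noise h hn hA (hm measurableSet_Iic)

lemma real_abs_gaussian_gt_le
    (h : HasLaw (fun ω => (Z ω, u ω)) ((noiseLaw k n).prod (sphereUniform n)) P)
    (hn : 0 < n) {c : ℝ} {w : Fin k → EuclideanSpace ℝ (Fin n)} (hc : c ^ 2 * ∏ s, ‖w s‖ ^ 2 = n)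
    {L : ℝ} (hL : 0 ≤ L) :
    P.real {ω | L < |c * tinner (Z ω) (pureTensor w)|} ≤ 2 * Real.exp (-L ^ 2 / 2) := by
  have hm : Measurable fun Z : Tensor k n => c * tinner Z (pureTensor w) :=
    (measurable_tinner _).const_mul c
  have h1 := gaussianReal_real_abs_gt_le 1 hL
  rw [← map_tinner_pureTensor_noiseLaw hn hc, map_measureReal_apply hm
    (measurableSet_lt measurable_const (by fun_prop))] at h1
  refine (real_noise_le h hn _).trans (h1.trans_eq ?_)
  simp

end Model

/-! ### From closeness of random variables to closeness of distribution functions. -/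

section Transfer

lemma gaussianReal_real_Iic_add_le {t η : ℝ} (hη : 0 ≤ η) :
    (gaussianReal 0 1).real (Set.Iic (t + η)) ≤ (gaussianReal 0 1).real (Set.Iic t) + η := by
  have hsub : Set.Iic (t + η) ⊆ Set.Iic t ∪ Set.Icc t (t + η) := by
    intro y (hy : y ≤ t + η)
    rcases le_total y t with h | h
    · exact Or.inl h
    · exact Or.inr ⟨h, hy⟩
  have h1 : (gaussianReal 0 1).real (Set.Icc t (t + η)) ≤ (t + η - t) * 1 / 2 :=
    gaussianReal_real_Icc_le (by linarith) zero_le_one fun y _ => by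
      rw [Real.exp_le_one_iff]; nlinarith [sq_nonneg y]
  have h2 := (measureReal_mono (μ := gaussianReal 0 1) hsub (measure_ne_top _ _)).trans
    (measureReal_union_le _ _)
  linarith

/-- If `S` is close to a standard Gaussian `G` independent of `E`, off an event `B`, then `S` is
almost standard Gaussian on `E`. -/
lemma abs_real_inter_le_sub_le {Ω : Type*} [MeasurableSpace Ω] {P : Measure Ω}
    [IsProbabilityMeasure P] {E B : Set Ω} {S G : Ω → ℝ} {η : ℝ} (hη : 0 ≤ η)
    (hG : ∀ t, P.real (E ∩ {ω | G ω ≤ t}) = P.real E * (gaussianReal 0 1).real (Set.Iic t))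
    (hS : ∀ ω ∈ E, ω ∉ B → |S ω - G ω| ≤ η) (t : ℝ) :
    |P.real (E ∩ {ω | S ω ≤ t}) - P.real E * (gaussianReal 0 1).real (Set.Iic t)|
      ≤ η + P.real B := by
  have hE1 : P.real E ≤ 1 := measureReal_le_one
  have hE0 : 0 ≤ P.real E := measureReal_nonneg
  have h1 : P.real (E ∩ {ω | S ω ≤ t}) ≤ P.real (E ∩ {ω | G ω ≤ t + η}) + P.real B := by
    refine (measureReal_mono (fun ω hω => ?_) (measure_ne_top _ _)).trans (measureReal_union_le _ _)
    by_cases hB : ω ∈ B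
    · exact Or.inr hB
    · refine Or.inl ⟨hω.1, ?_⟩
      have := abs_le.1 (hS ω hω.1 hB)
      have h2 : S ω ≤ t := hω.2
      change G ω ≤ t + η
      linarith
  have h2 : P.real (E ∩ {ω | G ω ≤ t - η}) ≤ P.real (E ∩ {ω | S ω ≤ t}) + P.real B := by
    refine (measureReal_mono (fun ω hω => ?_) (measure_ne_top _ _)).trans (measureReal_union_le _ _)
    by_cases hB : ω ∈ B
    · exact Or.inr hB
    · refine Or.inl ⟨hω.1, ?_⟩
      have := abs_le.1 (hS ω hω.1 hB)
      have h2 : G ω ≤ t - η := hω.2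
      change S ω ≤ t
      linarith
  rw [hG] at h1 h2
  have h3 := gaussianReal_real_Iic_add_le (t := t) hη
  have h4 := gaussianReal_real_Iic_add_le (t := t - η) hη
  rw [sub_add_cancel] at h4
  rw [abs_le]
  constructor <;> nlinarith

end Transfer

end SpikedTensor

namespace SpikedTensor

/-! ### Comparison with Gaussian mixtures. -/

section Mixture

lemma gaussianReal_real_Iic_eq (μ : ℝ) {v : ℝ≥0} (hv : 0 < v) (t : ℝ) :
    (gaussianReal μ v).real (Set.Iic t)
      = (gaussianReal 0 1).real (Set.Iic ((√(v : ℝ))⁻¹ * (t - μ))) := by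
  have hv' : (0 : ℝ) < v := by exact_mod_cast hv
  have hs : 0 < √(v : ℝ) := Real.sqrt_pos.2 hv'
  have h1 : (gaussianReal 0 1).map (fun x => √(v : ℝ) * x + μ) = gaussianReal μ v := by
    have h2 := gaussianReal_map_const_mul (μ := 0) (v := 1) (√(v : ℝ))
    have h3 := gaussianReal_map_add_const (μ := √(v : ℝ) * 0)
      (v := NNReal.mk (√(v : ℝ) ^ 2) (sq_nonneg _) * 1) μ
    rw [← h2, Measure.map_map (by fun_prop) (by fun_prop)] at h3
    rw [show (fun x => √(v : ℝ) * x + μ) = (fun x => x + μ) ∘ fun x => √(v : ℝ) * x from rfl, h3]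
    congr 1
    · ring
    · ext
      simp [Real.sq_sqrt hv'.le]
  rw [← h1, map_measureReal_apply (by fun_prop) measurableSet_Iic]
  congr 1
  ext x
  simp only [Set.mem_preimage, Set.mem_Iic]
  rw [le_inv_mul_iff₀ hs]
  constructor <;> intro h <;> linarith

/-- The difference is carried by the complement of the union. Null measurability is what an almost
everywhere measurable initialization provides. -/
lemma abs_sum_real_inter_sub_le {Ω ι : Type*} [MeasurableSpace Ω] [Fintype ι] {P : Measure Ω}
    [IsProbabilityMeasure P] {E : ι → Set Ω} (hE : ∀ i, NullMeasurableSet (E i) P)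
    (hd : Pairwise fun i j => Disjoint (E i) (E j)) (A : Set Ω) :
    |P.real A - ∑ i, P.real (E i ∩ A)| ≤ 1 - ∑ i, P.real (E i) := by
  have hd' : Pairwise (Function.onFun (AEDisjoint P) E) := fun i j h => (hd h).aedisjoint
  have h1 : P.real (⋃ i, E i) = ∑ i, P.real (E i) := by
    simp only [measureReal_def]
    rw [measure_iUnion₀ hd' hE, tsum_fintype, ENNReal.toReal_sum fun i _ => measure_ne_top _ _]
  have h2 : ∑ i, P.real (E i ∩ A) = P.real ((⋃ i, E i) ∩ A) := by
    simp only [measureReal_def]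
    rw [← ENNReal.toReal_sum fun i _ => measure_ne_top _ _]
    congr 1
    have hE' : ∀ i, NullMeasurableSet (E i) (P.restrict A) := fun i =>
      (hE i).mono_ac Measure.absolutelyContinuous_restrict
    rw [← Measure.restrict_apply₀ (NullMeasurableSet.iUnion hE'),
      measure_iUnion₀ (fun i j h => (hd h).aedisjoint) hE', tsum_fintype]
    exact Finset.sum_congr rfl fun i _ => (Measure.restrict_apply₀ (hE' i)).symm
  have h3 : P.real (⋃ i, E i)ᶜ = 1 - P.real (⋃ i, E i) :=
    probReal_compl_eq_one_sub₀ (NullMeasurableSet.iUnion hE)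
  rw [h2, ← h1, ← h3, abs_of_nonneg (sub_nonneg.2 (measureReal_mono Set.inter_subset_right))]
  have h4 : A ⊆ ((⋃ i, E i) ∩ A) ∪ (⋃ i, E i)ᶜ := fun ω hω => by
    by_cases h : ω ∈ ⋃ i, E i
    · exact Or.inl ⟨h, hω⟩
    · exact Or.inr h
  have h5 := (measureReal_mono (μ := P) h4).trans (measureReal_union_le _ _)
  linarith

/-- Comparison of a distribution function with a mixture of distribution functions. -/
lemma abs_real_sub_mixture_le {Ω ι : Type*} [MeasurableSpace Ω] [Fintype ι] {P : Measure Ω}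
    [IsProbabilityMeasure P] {E : ι → Set Ω} (hE : ∀ i, NullMeasurableSet (E i) P)
    (hd : Pairwise fun i j => Disjoint (E i) (E j)) {p φ : ι → ℝ} {δ η : ℝ}
    (hp : 1 ≤ ∑ i, p i) (hEp : ∀ i, |P.real (E i) - p i| ≤ η) (hφ0 : ∀ i, 0 ≤ φ i)
    (hφ1 : ∀ i, φ i ≤ 1) {A : Set Ω} (hA : ∀ i, |P.real (E i ∩ A) - P.real (E i) * φ i| ≤ δ) :
    |P.real A - ∑ i, p i * φ i| ≤ Fintype.card ι * δ + 2 * (Fintype.card ι * η) := by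
  have h1 := abs_sum_real_inter_sub_le hE hd A
  have h2 : |∑ i, P.real (E i ∩ A) - ∑ i, p i * φ i| ≤ Fintype.card ι * (δ + η) := by
    rw [← Finset.sum_sub_distrib]
    refine (Finset.abs_sum_le_sum_abs _ _).trans ?_
    refine (Finset.sum_le_card_nsmul _ _ (δ + η) fun i _ => ?_).trans_eq
        (by rw [nsmul_eq_mul, Finset.card_univ])
    have e : P.real (E i ∩ A) - p i * φ i
        = (P.real (E i ∩ A) - P.real (E i) * φ i) + (P.real (E i) - p i) * φ i := by ring
    rw [e]
    refine (abs_add_le _ _).trans (add_le_add (hA i) ?_)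
    rw [abs_mul, abs_of_nonneg (hφ0 i)]
    exact (mul_le_of_le_one_right (abs_nonneg _) (hφ1 i)).trans (hEp i)
  -- As the weights sum to at least one, the mass missed by the events is at most the sum of the
  -- individual errors.
  have h3 : 1 - ∑ i, P.real (E i) ≤ Fintype.card ι * η := by
    have h4 : ∑ i, (p i - P.real (E i)) ≤ Fintype.card ι * η := by
      refine (Finset.sum_le_card_nsmul _ _ η fun i _ => ?_).trans_eq
        (by rw [nsmul_eq_mul, Finset.card_univ])
      linarith [(abs_le.1 (hEp i)).1]
    rw [Finset.sum_sub_distrib] at h4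
    linarith
  calc |P.real A - ∑ i, p i * φ i|
      = |(P.real A - ∑ i, P.real (E i ∩ A)) + (∑ i, P.real (E i ∩ A) - ∑ i, p i * φ i)| := by
        congr 1; ring
    _ ≤ Fintype.card ι * η + Fintype.card ι * (δ + η) :=
        (abs_add_le _ _).trans (add_le_add (h1.trans h3) h2)
    _ = _ := by ring

end Mixture

section Weights

variable {n r d : ℕ} {β : Fin r → ℝ}

/-- A maximum is always attained, so the argmax events cover the space; an inequality suffices and
spares the discussion of ties. -/
lemma one_le_sum_weight [NeZero r] (hd : 0 < d) (hβ : ∀ j, β j ≠ 0) :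
    1 ≤ ∑ i, weight (d + 2) β i := by
  have h1 : (Set.univ : Set (Fin r → ℝ))
      ⊆ ⋃ i, {x | ∀ j, |β j * x j ^ d| ≤ |β i * x i ^ d|} := by
    intro x _
    obtain ⟨i, -, hi⟩ := Finset.exists_max_image Finset.univ (fun j => |β j * x j ^ d|)
      ⟨0, Finset.mem_univ _⟩
    exact Set.mem_iUnion.2 ⟨i, fun j => hi j (Finset.mem_univ j)⟩
  have h2 := (measureReal_mono (μ := gaussVec (Fin r) 1) h1 (measure_ne_top _ _)).trans
    (measureReal_iUnion_fintype_le _)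
  rw [probReal_univ] at h2
  exact h2.trans_eq (Finset.sum_congr rfl fun i _ => weight_eq_gaussVec hd hβ i)

lemma sum_signedWeight {k : ℕ} {i : Fin r} (hβ : β i ≠ 0) :
    ∑ s : ℤˣ, signedWeight k β i s = weight k β i := by
  rw [Fintype.sum_eq_add (1 : ℤˣ) (-1) (by decide)
    (fun s hs => absurd (Int.units_eq_one_or s) (by tauto))]
  unfold signedWeight
  split_ifs with h1 h2 h3 h3
  · exfalso; rw [h2] at h3; norm_num at h3
  · simp
  · simp
  · exfalso
    rcases mul_self_eq_one_iff.1 (sign_sq hβ) with h | h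
    · exact h2 (by simpa using h)
    · exact h3 (by simpa using h)
  · ring

end Weights

end SpikedTensor

namespace SpikedTensor

/-- A bound for the injective norm of the noise that holds with high probability. -/
noncomputable def opConst (d : ℕ) : ℝ :=
  2 ^ (d + 2) * √(2 * (((d + 2 : ℕ) : ℝ) * Real.log 5 + 1))

lemma opConst_pos (d : ℕ) : 0 < opConst d := by
  have : 0 ≤ Real.log 5 := Real.log_nonneg (by norm_num)
  unfold opConst
  positivity

/-! ### The model along a sequence of dimensions, and its exceptional events. -/

section Model

variable {r d : ℕ} [NeZero r] {Ω : ℕ → Type*} [∀ n, MeasurableSpace (Ω n)]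

/-- The spiked tensor model along a sequence of dimensions, with power iteration run up to
time `T`. -/
structure Model (P : ∀ n, Measure (Ω n)) (Z : ∀ n, Ω n → Tensor (d + 2) n)
    (u : ∀ n, Ω n → EuclideanSpace ℝ (Fin n)) (β : ℕ → Fin r → ℝ)
    (v : ∀ n, Fin r → EuclideanSpace ℝ (Fin n)) (T : ℕ → ℕ) (κ ε : ℝ) : Prop where
  law : ∀ n ≥ r, HasLaw (fun ω => (Z n ω, u n ω)) ((noiseLaw (d + 2) n).prod (sphereUniform n)) (P n)
  beta_ne : ∀ n ≥ r, ∀ j, β n j ≠ 0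
  beta_le : ∀ n ≥ r, ∀ j, |β n j| ≤ |β n 0|
  ortho : ∀ n ≥ r, Orthonormal ℝ (v n)
  d_pos : 0 < d
  one_le_kappa : 1 ≤ κ
  eps_pos : 0 < ε
  eps_le : ε ≤ 1 / 2
  beta_ge : ∀ᶠ n : ℕ in atTop, (n : ℝ) ^ ((d : ℝ) / 2 + ε) ≤ |β n 0|
  time : ∀ᶠ n : ℕ in atTop, κ * Real.log (√n * |β n 0|) ≤ ((d : ℝ) + 1) ^ (T n - 1)

/-- The event that the noise is atypical, either globally or along the first `t₁` iterates. -/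
def badNoise (Z : ∀ n, Ω n → Tensor (d + 2) n) (u : ∀ n, Ω n → EuclideanSpace ℝ (Fin n))
    (β : ℕ → Fin r → ℝ) (v : ∀ n, Fin r → EuclideanSpace ℝ (Fin n)) (ε : ℝ) (t₁ n : ℕ) :
    Set (Ω n) :=
  ({ω | ‖u n ω‖ ≠ 1} ∪ {ω | ¬ OpBound (opConst d) (Z n ω)}) ∪
    {ω | ∃ t < t₁, ∃ j, (n : ℝ) ^ (-1 / 2 + ε / 2) < |(inner ℝ (v n j) (contract (Z n ω)
      (powerIter (signal (d + 2) (β n) (v n) + Z n ω) (u n ω) t)) : ℝ)|}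

/-- The noise term of the linear statistic. -/
noncomputable def linNoise (Z : ∀ n, Ω n → Tensor (d + 2) n)
    (v : ∀ n, Fin r → EuclideanSpace ℝ (Fin n)) (a : ∀ n, EuclideanSpace ℝ (Fin n)) (i : Fin r)
    (n : ℕ) (ω : Ω n) : ℝ :=
  √n * inner ℝ (a n - (inner ℝ (a n) (v n i) : ℝ) • v n i) (contract (Z n ω) (v n i))
    / √(1 - inner ℝ (a n) (v n i) ^ 2)

/-- The event that the noise contracted along `v i` is atypical, at level `L`. -/
def badContraction (Z : ∀ n, Ω n → Tensor (d + 2) n)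
    (v : ∀ n, Fin r → EuclideanSpace ℝ (Fin n)) (a : ∀ n, EuclideanSpace ℝ (Fin n)) (i : Fin r)
    (L : ℕ → ℝ) (n : ℕ) : Set (Ω n) :=
  ({ω | L n < √n * |‖contract (Z n ω) (v n i)‖ ^ 2 - 1|} ∪
    {ω | L n < √n * (inner ℝ (v n i) (contract (Z n ω) (v n i)) : ℝ) ^ 2}) ∪
    {ω | L n < |linNoise Z v a i n ω|}

/-- The realizations in the events `E` and outside the events `B`, in all dimensions. -/
abbrev Off (r : ℕ) (E B : ∀ n, Set (Ω n)) : Type _ :=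
  {p : Σ n, Ω n // r ≤ p.1 ∧ p.2 ∈ E p.1 ∧ p.2 ∉ B p.1}

/-- Convergence along `Off r E B` as the dimension tends to infinity is uniform convergence. -/
def offTop (r : ℕ) (E B : ∀ n, Set (Ω n)) : Filter (Off r E B) :=
  comap (fun p => p.1.1) atTop

lemma eventually_offTop {E B : ∀ n, Set (Ω n)} {q : ∀ n, Ω n → Prop} :
    (∀ᶠ p in offTop r E B, q p.1.1 p.1.2) ↔
      ∀ᶠ n in atTop, ∀ ω ∈ E n, ω ∉ B n → q n ω := by
  rw [offTop, eventually_comap]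
  constructor
  · intro h
    filter_upwards [h, eventually_ge_atTop r] with n hn hr ω hE hB
    exact hn ⟨⟨n, ω⟩, hr, hE, hB⟩ rfl
  · intro h
    filter_upwards [h] with n hn
    rintro ⟨⟨m, ω⟩, hr, hE, hB⟩ rfl
    exact hn ω hE hB

lemma eventually_offTop_of_atTop {E B : ∀ n, Set (Ω n)} {q : ℕ → Prop} (h : ∀ᶠ n in atTop, q n) :
    ∀ᶠ p in offTop r E B, q p.1.1 :=
  tendsto_comap.eventually h

variable {P : ∀ n, Measure (Ω n)} [∀ n, IsProbabilityMeasure (P n)]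

/-- A statistic that is uniformly close to an independent standard Gaussian outside events of
vanishing probability is asymptotically Gaussian, uniformly in the threshold. -/
lemma eventually_abs_real_inter_le_sub_le {E B : ∀ n, Set (Ω n)} {S G : ∀ n, Ω n → ℝ}
    (hB : Tendsto (fun n => (P n).real (B n)) atTop (𝓝 0))
    (hG : ∀ᶠ n in atTop, ∀ t, (P n).real (E n ∩ {ω | G n ω ≤ t})
      = (P n).real (E n) * (gaussianReal 0 1).real (Set.Iic t))
    (hS : Tendsto (fun p : Off r E B => S p.1.1 p.1.2 - G p.1.1 p.1.2) (offTop r E B) (𝓝 0))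
    {δ : ℝ} (hδ : 0 < δ) : ∀ᶠ n in atTop, ∀ t,
      |(P n).real (E n ∩ {ω | S n ω ≤ t}) - (P n).real (E n) * (gaussianReal 0 1).real (Set.Iic t)|
        ≤ δ := by
  have h1 : ∀ᶠ p in offTop r E B, |S p.1.1 p.1.2 - G p.1.1 p.1.2| ≤ δ / 2 := by
    have := hS.abs
    rw [abs_zero] at this
    exact this.eventually_le_const (by positivity)
  filter_upwards [(eventually_offTop (q := fun n ω => |S n ω - G n ω| ≤ δ / 2)).1 h1, hG,
    hB.eventually_le_const (show 0 < δ / 2 by positivity)] with n h2 h3 h4 t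
  have := abs_real_inter_le_sub_le (show 0 ≤ δ / 2 by positivity) h3 h2 t
  linarith

lemma asympNormalOn_of_eventually {E : ∀ n, Set (Ω n)} {S : ∀ n, Ω n → ℝ}
    (h : ∀ δ > 0, ∀ᶠ n in atTop, ∀ t,
      |(P n).real (E n ∩ {ω | S n ω ≤ t}) - (P n).real (E n) * (gaussianReal 0 1).real (Set.Iic t)|
        ≤ δ) : AsympNormalOn P E S := by
  intro t
  rw [Metric.tendsto_nhds]
  intro δ hδ
  filter_upwards [h (δ / 2) (by positivity)] with n hn
  rw [Real.dist_eq, sub_zero]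
  linarith [hn t]

namespace Model

variable {Z : ∀ n, Ω n → Tensor (d + 2) n} {u : ∀ n, Ω n → EuclideanSpace ℝ (Fin n)}
  {β : ℕ → Fin r → ℝ} {v : ∀ n, Fin r → EuclideanSpace ℝ (Fin n)} {T : ℕ → ℕ} {κ ε : ℝ}
  {a : ∀ n, EuclideanSpace ℝ (Fin n)} {i : Fin r} {t₁ : ℕ}

lemma eventually_pos (r : ℕ) : ∀ᶠ n : ℕ in atTop, r ≤ n ∧ 0 < n :=
  (eventually_ge_atTop r).and (eventually_gt_atTop 0)

/-- The threshold `n ^ (-1/2 + ε/2)` is written as `t₁ * l`, as the adaptive bound requires. As `t₁`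
is fixed, the exponent `n ^ ε / (2 t₁ ^ 2)` diverges. -/
lemma tendsto_real_badNoise (H : Model P Z u β v T κ ε) (ht : 0 < t₁) :
    Tendsto (fun n => (P n).real (badNoise Z u β v ε t₁ n)) atTop (𝓝 0) := by
  have hε := H.eps_pos
  have ht' : (0 : ℝ) < t₁ := by exact_mod_cast ht
  have h1 : Tendsto (fun n : ℕ => (n : ℝ)) atTop atTop := tendsto_natCast_atTop_atTop
  have h2 : Tendsto (fun n : ℕ => (n : ℝ) ^ ε / (2 * (t₁ : ℝ) ^ 2)) atTop atTop :=
    ((tendsto_rpow_atTop hε).comp h1).atTop_div_const (by positivity)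
  have hlim : Tendsto (fun n : ℕ => 2 * Real.exp (-(n : ℝ))
      + t₁ * (r * (2 * Real.exp (-((n : ℝ) ^ ε / (2 * (t₁ : ℝ) ^ 2)))))) atTop (𝓝 0) := by
    have e1 := (Real.tendsto_exp_neg_atTop_nhds_zero.comp h1).const_mul 2
    have e2 := (((Real.tendsto_exp_neg_atTop_nhds_zero.comp h2).const_mul 2).const_mul
      (r : ℝ)).const_mul (t₁ : ℝ)
    simpa using e1.add e2
  refine squeeze_zero' (Eventually.of_forall fun n => measureReal_nonneg) ?_ hlim
  filter_upwards [eventually_pos r] with n ⟨hr, hn⟩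
  have hn' : (0 : ℝ) < n := by exact_mod_cast hn
  have hlaw := H.law n hr
  have b1 := real_norm_init_ne_one hlaw hn
  have b2 := (real_noise_le hlaw hn {Z | ¬ OpBound (opConst d) Z}).trans
    (noiseLaw_real_not_opBound_le (d + 2) n)
  have b3 := real_overlap_tail hlaw hn (signal (d + 2) (β n) (v n)) (v n) (H.ortho n hr).1 t₁
    (l := (n : ℝ) ^ (-1 / 2 + ε / 2) / t₁) (by positivity)
  have e1 : (t₁ : ℝ) * ((n : ℝ) ^ (-1 / 2 + ε / 2) / t₁) = (n : ℝ) ^ (-1 / 2 + ε / 2) := by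
    field_simp
  have e2 : (n : ℝ) * ((n : ℝ) ^ (-1 / 2 + ε / 2) / t₁) ^ 2 / 2 = (n : ℝ) ^ ε / (2 * (t₁ : ℝ) ^ 2) := by
    have : (n : ℝ) * ((n : ℝ) ^ (-1 / 2 + ε / 2)) ^ 2 = (n : ℝ) ^ ε := by
      rw [← Real.rpow_natCast ((n : ℝ) ^ (-1 / 2 + ε / 2)), ← Real.rpow_mul hn'.le]
      nth_rewrite 1 [← Real.rpow_one (n : ℝ)]
      rw [← Real.rpow_add hn']
      congr 1
      push_cast
      ring
    rw [← this]
    field_simp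
  rw [e1, e2] at b3
  refine (measureReal_union_le _ _).trans (add_le_add ((measureReal_union_le _ _).trans ?_) b3)
  rw [b1, zero_add]
  exact b2

variable {E B : ∀ n, Set (Ω n)}

/-- The realization of the model at a point outside the bad events. -/
def sample (H : Model P Z u β v T κ ε) (hB : ∀ n, badNoise Z u β v ε t₁ n ⊆ B n)
    (p : Off r E B) : Sample r d (opConst d) where
  n := p.1.1
  β := β p.1.1
  v := v p.1.1
  Z := Z p.1.1 p.1.2
  u := u p.1.1 p.1.2
  ortho := H.ortho _ p.2.1
  norm_u := by
    by_contra h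
    exact p.2.2.2 (hB _ (Or.inl (Or.inl h)))
  op := by
    by_contra h
    exact p.2.2.2 (hB _ (Or.inl (Or.inr h)))
  M_pos := opConst_pos d

lemma selects (H : Model P Z u β v T κ ε) (hB : ∀ n, badNoise Z u β v ε t₁ n ⊆ B n)
    (hE : ∀ n, ∀ ω ∈ E n, GoodInit (d + 2) κ (β n) (v n) i (u n ω)) :
    Sample.Selects (offTop r E B) (H.sample hB) (fun p => T p.1.1) i κ ε t₁ := by
  refine ⟨H.one_le_kappa, H.eps_pos, H.eps_le, H.d_pos,
    tendsto_natCast_atTop_atTop.comp tendsto_comap,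
    eventually_offTop_of_atTop H.beta_ge,
    eventually_offTop_of_atTop ((eventually_ge_atTop r).mono H.beta_le),
    Eventually.of_forall fun p => hE _ _ p.2.2.1, Eventually.of_forall fun p t ht j => ?_,
    eventually_offTop_of_atTop H.time⟩
  by_contra h
  exact p.2.2.2 (hB _ (Or.inr ⟨t, ht, j, not_le.1 h⟩))

end Model

end Model

end SpikedTensor

namespace SpikedTensor

/-! ### Selection events and the size of the noise terms on them. -/

section Model

variable {r d : ℕ} [NeZero r] {Ω : ℕ → Type*} [∀ n, MeasurableSpace (Ω n)]

/-- The event that spike `i` is selected, with sign `s`. -/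
def selectionEvent (k : ℕ) (u : ∀ n, Ω n → EuclideanSpace ℝ (Fin n)) (β : ℕ → Fin r → ℝ)
    (v : ∀ n, Fin r → EuclideanSpace ℝ (Fin n)) (T : ℕ → ℕ) (κ : ℝ) (i : Fin r) (s : ℤˣ) (n : ℕ) :
    Set (Ω n) :=
  {ω | GoodInit k κ (β n) (v n) i (u n ω) ∧
    limitSign k (β n i) (T n) (inner ℝ (u n ω) (v n i)) = ((s : ℤ) : ℝ)}

lemma units_cast_mul_self (s : ℤˣ) : ((s : ℤ) : ℝ) * ((s : ℤ) : ℝ) = 1 := by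
  rcases Int.units_eq_one_or s with rfl | rfl <;> norm_num

variable {P : ∀ n, Measure (Ω n)} [∀ n, IsProbabilityMeasure (P n)]

namespace Model

variable {Z : ∀ n, Ω n → Tensor (d + 2) n} {u : ∀ n, Ω n → EuclideanSpace ℝ (Fin n)}
  {β : ℕ → Fin r → ℝ} {v : ∀ n, Fin r → EuclideanSpace ℝ (Fin n)} {T : ℕ → ℕ} {κ ε : ℝ}
  {a : ∀ n, EuclideanSpace ℝ (Fin n)} {i : Fin r} {t₁ : ℕ}

lemma real_selectionEvent_inter_gaussian (H : Model P Z u β v T κ ε) {n : ℕ} (hr : r ≤ n) (s : ℤˣ)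
    {c : ℝ} {w : Fin (d + 2) → EuclideanSpace ℝ (Fin n)} (hc : c ^ 2 * ∏ s, ‖w s‖ ^ 2 = n) (t : ℝ) :
    (P n).real (selectionEvent (d + 2) u β v T κ i s n
        ∩ {ω | c * tinner (Z n ω) (pureTensor w) ≤ t})
      = (P n).real (selectionEvent (d + 2) u β v T κ i s n)
        * (gaussianReal 0 1).real (Set.Iic t) :=
  real_init_inter_gaussian (H.law n hr) ((Nat.pos_of_ne_zero (NeZero.ne r)).trans_le hr)
    (measurableSet_goodInit_sign (d + 2) κ (β n) (v n) i (T n) ((s : ℤ) : ℝ)) hc t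

lemma spike_gaussian_scale (H : Model P Z u β v T κ ε) {n : ℕ} (hr : r ≤ n) {σ : ℝ}
    (hσ : σ * σ = 1) : (σ * √n) ^ 2 * ∏ _s : Fin (d + 2), ‖v n i‖ ^ 2 = n := by
  rw [(H.ortho n hr).1 i]
  simp only [one_pow, Finset.prod_const_one, mul_one]
  rw [mul_pow, sq σ, hσ, one_mul, Real.sq_sqrt (Nat.cast_nonneg n)]

lemma linNoise_eq (n : ℕ) (ω : Ω n) (σ : ℝ) : σ * linNoise Z v a i n ω
    = (σ * √n / √(1 - inner ℝ (a n) (v n i) ^ 2)) * tinner (Z n ω)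
      (pureTensor (headTail (d + 1) (a n - (inner ℝ (a n) (v n i) : ℝ) • v n i) (v n i))) := by
  rw [linNoise, inner_contract]
  ring

lemma linear_gaussian_scale (H : Model P Z u β v T κ ε) {n : ℕ} (hr : r ≤ n) (ha : ‖a n‖ = 1)
    (hA : 0 < √(1 - inner ℝ (a n) (v n i) ^ 2)) {σ : ℝ} (hσ : σ * σ = 1) :
    (σ * √n / √(1 - inner ℝ (a n) (v n i) ^ 2)) ^ 2 * ∏ s : Fin (d + 1 + 1),
      ‖headTail (d + 1) (a n - (inner ℝ (a n) (v n i) : ℝ) • v n i) (v n i) s‖ ^ 2 = n := by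
  have hv := (H.ortho n hr).1 i
  rw [Fin.prod_univ_succ]
  simp only [headTail, Fin.cons_zero, Fin.cons_succ, hv, one_pow, Finset.prod_const_one, mul_one]
  rw [norm_sub_inner_smul hv ha, div_pow, div_mul_cancel₀ _ (by positivity), mul_pow, sq σ, hσ,
    one_mul, Real.sq_sqrt (Nat.cast_nonneg n)]

/-- Chebyshev handles the squared norm and Gaussian tails the two scalar terms, all of which already
have the right scale; the level only has to diverge. -/
lemma tendsto_real_badContraction (H : Model P Z u β v T κ ε) (ha : ∀ n ≥ r, ‖a n‖ = 1)
    (hA : ∀ᶠ n in atTop, 0 < √(1 - inner ℝ (a n) (v n i) ^ 2)) {L : ℕ → ℝ}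
    (hL : Tendsto L atTop atTop) :
    Tendsto (fun n => (P n).real (badContraction Z v a i L n)) atTop (𝓝 0) := by
  obtain ⟨c, hc0, hc⟩ := noiseLaw_real_abs_norm_sq_sub_one_gt_le
  have hL2 : Tendsto (fun n => L n / 2) atTop atTop := hL.atTop_div_const (by norm_num)
  have hlim : Tendsto (fun n => c / L n + 2 * Real.exp (-(L n / 2)) + 2 * Real.exp (-(L n / 2)))
      atTop (𝓝 0) := by
    have e1 := (Real.tendsto_exp_neg_atTop_nhds_zero.comp hL2).const_mul 2
    simpa using ((hL.const_div_atTop c).add e1).add e1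
  refine squeeze_zero' (Eventually.of_forall fun n => measureReal_nonneg) ?_ hlim
  filter_upwards [eventually_pos r, hA, hL.eventually_ge_atTop 1] with n ⟨hr, hn⟩ hA hL1
  have hn1 : (1 : ℝ) ≤ n := by exact_mod_cast hn
  have hs1 : 1 ≤ √(n : ℝ) := Real.one_le_sqrt.2 hn1
  have hs := Real.sq_sqrt (show (0 : ℝ) ≤ n by linarith)
  have hlaw := H.law n hr
  have hv := (H.ortho n hr).1 i
  refine (measureReal_union_le _ _).trans (add_le_add ((measureReal_union_le _ _).trans
    (add_le_add ?_ ?_)) ?_)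
  · have h1 := (real_noise_le hlaw hn _).trans (hc (d + 1) n (v n i) hv (L n / √n) (by positivity))
    have h2 : {ω | L n < √n * |‖contract (Z n ω) (v n i)‖ ^ 2 - 1|}
        = {ω | Z n ω ∈ {Z | L n / √n < |‖contract Z (v n i)‖ ^ 2 - 1|}} := by
      ext ω
      simp only [Set.mem_ofPred_eq]
      rw [div_lt_iff₀' (by positivity)]
    rw [h2]
    refine h1.trans ?_
    rw [div_pow, hs, mul_div_cancel₀ _ (by positivity)]
    gcongr
    nlinarith
  · have h1 := real_abs_gaussian_gt_le hlaw hn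
      (H.spike_gaussian_scale (i := i) hr (σ := 1) (by norm_num)) (L := √(L n * √n))
      (Real.sqrt_nonneg _)
    have h2 : {ω | L n < √n * (inner ℝ (v n i) (contract (Z n ω) (v n i)) : ℝ) ^ 2}
        = {ω | √(L n * √n) < |1 * √n * tinner (Z n ω) (pureTensor fun _ => v n i)|} := by
      ext ω
      simp only [Set.mem_ofPred_eq]
      rw [inner_contract_self, Real.sqrt_lt (by positivity) (abs_nonneg _), sq_abs, one_mul,
        ← mul_lt_mul_iff_left₀ (show 0 < √(n : ℝ) by positivity)]
      refine iff_of_eq (congrArg _ ?_)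
      rw [tpow]
      ring
    rw [h2]
    refine h1.trans ?_
    rw [neg_div, Real.sq_sqrt (by positivity)]
    gcongr
    exact le_mul_of_one_le_right (by linarith) hs1
  · have h1 := real_abs_gaussian_gt_le hlaw hn
      (H.linear_gaussian_scale (i := i) hr (ha n hr) hA (σ := 1) (by norm_num)) (L := L n)
      (by linarith)
    have h2 : {ω | L n < |linNoise Z v a i n ω|} = {ω | L n < |(1 * √n / √(1 - inner ℝ (a n) (v n i) ^ 2)) * tinner (Z n ω)
      (pureTensor (headTail (d + 1) (a n - (inner ℝ (a n) (v n i) : ℝ) • v n i) (v n i)))|} := by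
      ext ω
      simp only [Set.mem_ofPred_eq]
      rw [← linNoise_eq, one_mul]
    rw [h2]
    refine h1.trans ?_
    gcongr
    nlinarith

variable {B : ∀ n, Set (Ω n)} {s : ℤˣ}

lemma recovers (H : Model P Z u β v T κ ε) (hB : ∀ n, badNoise Z u β v ε t₁ n ⊆ B n)
    (h1 : 1 / 2 ≤ ε * ((t₁ : ℝ) - 1)) (h2 : 2 ≤ t₁)
    (h3 : r * (κ * (1 - 1 / κ) ^ ((d + 1) ^ (t₁ - 1))) < 1)
    (h4 : 3 * (1 - 1 / κ) ^ ((d + 1) ^ t₁) < Real.exp (-1 / κ) ^ ((d + 1) ^ t₁))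
    (h5 : Real.exp (-1 / κ) ^ ((d + 1) ^ t₁) * (8 * r) ≤ 1) :
    Sample.Recovers (offTop r (selectionEvent (d + 2) u β v T κ i s) B) (H.sample hB) i
      (fun p => (H.sample hB p).U (T p.1.1))
      (fun p => (H.sample hB p).δ i (T p.1.1 - 1)) ((s : ℤ) : ℝ) (κ ^ d) :=
  (H.selects hB fun _ _ h => h.1).recovers (opConst_pos d) h1 h2 h3 h4 h5 (units_cast_mul_self s)
    (Eventually.of_forall fun p => p.2.2.1.2)

/-- The level, the square root of `A |β 0|`, diverges, so that exceeding it is rare, but more slowly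
than `A |β i|`, which is at least `κ ^ (-d) A |β 0|`. -/
lemma linearBounds (H : Model P Z u β v T κ ε) (hB : ∀ n, badNoise Z u β v ε t₁ n ⊆ B n)
    (ha : ∀ n ≥ r, ‖a n‖ = 1)
    (hN : Tendsto (fun n => √(1 - inner ℝ (a n) (v n i) ^ 2) * |β n 0|) atTop atTop)
    (hB' : ∀ n, badContraction Z v a i
      (fun n => √(√(1 - inner ℝ (a n) (v n i) ^ 2) * |β n 0|)) n ⊆ B n) :
    Sample.Recovers.LinearBounds (offTop r (selectionEvent (d + 2) u β v T κ i s) B) (H.sample hB) i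
      (fun p => a p.1.1) (fun p => √(√(1 - inner ℝ (a p.1.1) (v p.1.1 i) ^ 2) * |β p.1.1 0|)) := by
  have hκ := H.one_le_kappa
  set N : ℕ → ℝ := fun n => √(1 - inner ℝ (a n) (v n i) ^ 2) * |β n 0| with hNdef
  set l := offTop r (selectionEvent (d + 2) u β v T κ i s) B
  have hl : Tendsto (fun p : Off r (selectionEvent (d + 2) u β v T κ i s) B => p.1.1) l atTop :=
    tendsto_comap
  have hN' := hN.comp hl
  have hsel := H.selects (i := i) (E := selectionEvent (d + 2) u β v T κ i s) hB fun _ _ h => h.1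
  have hinit := hsel.init
  have hle : ∀ᶠ p in l, 0 < √(1 - inner ℝ (a p.1.1) (v p.1.1 i) ^ 2) * |β p.1.1 i| ∧
      1 ≤ N p.1.1 ∧ N p.1.1 ≤ κ ^ d * (√(1 - inner ℝ (a p.1.1) (v p.1.1 i) ^ 2) * |β p.1.1 i|) := by
    filter_upwards [hinit, hN'.eventually_ge_atTop 1] with p h1 h2
    have h3 : N p.1.1 ≤ κ ^ d * (√(1 - inner ℝ (a p.1.1) (v p.1.1 i) ^ 2) * |β p.1.1 i|) := by
      have : |β p.1.1 0| ≤ κ ^ d * |β p.1.1 i| := h1.1 0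
      calc _ ≤ √(1 - inner ℝ (a p.1.1) (v p.1.1 i) ^ 2) * (κ ^ d * |β p.1.1 i|) :=
            mul_le_mul_of_nonneg_left this (Real.sqrt_nonneg _)
        _ = _ := by ring
    refine ⟨?_, h2, h3⟩
    have h4 : (1 : ℝ) ≤ N p.1.1 := h2
    by_contra h5
    have : κ ^ d * (√(1 - inner ℝ (a p.1.1) (v p.1.1 i) ^ 2) * |β p.1.1 i|) ≤ 0 :=
      mul_nonpos_of_nonneg_of_nonpos (by positivity) (not_lt.1 h5)
    linarith
  refine ⟨?_, ?_, ?_, ?_, ?_, ?_, ?_, ?_⟩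
  · exact eventually_offTop_of_atTop ((eventually_ge_atTop r).mono ha)
  · filter_upwards [hle] with p hp
    exact pos_of_mul_pos_left hp.1 (abs_nonneg _)
  · filter_upwards [hle] with p hp
    exact Real.one_le_sqrt.2 hp.2.1
  · refine squeeze_zero' (Eventually.of_forall fun p => ?_) ?_ (hN'.const_div_atTop (κ ^ d))
    · exact div_nonneg zero_le_one (mul_nonneg (Real.sqrt_nonneg _) (abs_nonneg _))
    · filter_upwards [hle] with p ⟨h1, h2, h3⟩
      change 1 / (√(1 - inner ℝ (a p.1.1) (v p.1.1 i) ^ 2) * |β p.1.1 i|) ≤ κ ^ d / N p.1.1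
      rw [div_le_div_iff₀ h1 (by linarith)]
      linarith
  · refine squeeze_zero' (Eventually.of_forall fun p => ?_) ?_
      ((Real.tendsto_sqrt_atTop.comp hN').const_div_atTop (κ ^ d))
    · exact div_nonneg (Real.sqrt_nonneg _) (mul_nonneg (Real.sqrt_nonneg _) (abs_nonneg _))
    · filter_upwards [hle] with p ⟨h1, h2, h3⟩
      change √(N p.1.1) / (√(1 - inner ℝ (a p.1.1) (v p.1.1 i) ^ 2) * |β p.1.1 i|)
        ≤ κ ^ d / √(N p.1.1)
      rw [div_le_div_iff₀ h1 (Real.sqrt_pos.2 (by linarith)), Real.mul_self_sqrt (by linarith)]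
      exact h3
  · refine Eventually.of_forall fun p => ?_
    by_contra h
    exact p.2.2.2 (hB' _ (Or.inl (Or.inl (not_le.1 h))))
  · refine Eventually.of_forall fun p => ?_
    by_contra h
    exact p.2.2.2 (hB' _ (Or.inl (Or.inr (not_le.1 h))))
  · refine Eventually.of_forall fun p => ?_
    by_contra h
    exact p.2.2.2 (hB' _ (Or.inr (not_le.1 h)))

end Model

end Model

end SpikedTensor

namespace SpikedTensor

/-! ### Central limit theorems and mixtures for the model. -/

section Model

variable {r d : ℕ} [NeZero r] {Ω : ℕ → Type*} [∀ n, MeasurableSpace (Ω n)]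
  {P : ∀ n, Measure (Ω n)} [∀ n, IsProbabilityMeasure (P n)]
  {Z : ∀ n, Ω n → Tensor (d + 2) n} {u : ∀ n, Ω n → EuclideanSpace ℝ (Fin n)}
  {β : ℕ → Fin r → ℝ} {v : ∀ n, Fin r → EuclideanSpace ℝ (Fin n)} {T : ℕ → ℕ} {κ ε : ℝ}
  {a : ∀ n, EuclideanSpace ℝ (Fin n)}

/-- The power iteration estimator of a spike vector. -/
noncomputable def vecHat (Z : ∀ n, Ω n → Tensor (d + 2) n)
    (u : ∀ n, Ω n → EuclideanSpace ℝ (Fin n)) (β : ℕ → Fin r → ℝ)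
    (v : ∀ n, Fin r → EuclideanSpace ℝ (Fin n)) (T : ℕ → ℕ) (n : ℕ) (ω : Ω n) :
    EuclideanSpace ℝ (Fin n) :=
  powerIter (signal (d + 2) (β n) (v n) + Z n ω) (u n ω) (T n)

/-- The power iteration estimator of a spike strength. -/
noncomputable def strengthHat (Z : ∀ n, Ω n → Tensor (d + 2) n)
    (u : ∀ n, Ω n → EuclideanSpace ℝ (Fin n)) (β : ℕ → Fin r → ℝ)
    (v : ∀ n, Fin r → EuclideanSpace ℝ (Fin n)) (T : ℕ → ℕ) (n : ℕ) (ω : Ω n) : ℝ :=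
  betaHat (signal (d + 2) (β n) (v n) + Z n ω) (vecHat Z u β v T n ω)

/-- The statistic `S` is asymptotically standard normal on the events `E`, uniformly in the
threshold. -/
def UnifNormalOn (P : ∀ n, Measure (Ω n)) (E : ∀ n, Set (Ω n)) (S : ∀ n, Ω n → ℝ) : Prop :=
  ∀ δ > 0, ∀ᶠ n in atTop, ∀ t,
    |(P n).real (E n ∩ {ω | S n ω ≤ t}) - (P n).real (E n) * (gaussianReal 0 1).real (Set.Iic t)|
      ≤ δ

namespace Model

/-- Up to a sign, the main term of both statistics is `√n ⟨Z, v i ^ ⊗k⟩`, exactly standard normal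
and independent of the event. The second statistic has the deterministic centring that the mixture
needs. -/
theorem strength_unifNormalOn (H : Model P Z u β v T κ ε) (i : Fin r) (s : ℤˣ) :
    UnifNormalOn P (selectionEvent (d + 2) u β v T κ i s)
      (fun n ω => strengthStat (d + 2) n (((s : ℤ) : ℝ) ^ (d + 2) * β n i)
        (strengthHat Z u β v T n ω)) ∧
    UnifNormalOn P (selectionEvent (d + 2) u β v T κ i s)
      (fun n ω => √n * (strengthHat Z u β v T n ω - (((s : ℤ) : ℝ) ^ (d + 2) * β n i
        - (((d + 2 : ℕ) : ℝ) / 2 - 1) / (((s : ℤ) : ℝ) ^ (d + 2) * β n i)))) := by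
  obtain ⟨t₁, h1, h2, h3, h4, h5⟩ :=
    OverlapOrbit.exists_phaseOne_time r H.d_pos H.one_le_kappa H.eps_pos
  have hB := H.tendsto_real_badNoise (show 0 < t₁ by omega)
  have R := H.recovers (i := i) (s := s) (fun n => Set.Subset.rfl) h1 h2 h3 h4 h5
  have hs : ((s : ℤ) : ℝ) ^ (d + 2) * ((s : ℤ) : ℝ) ^ (d + 2) = 1 := by
    rw [← mul_pow, units_cast_mul_self, one_pow]
  have hG : ∀ σ : ℝ, σ * σ = 1 → ∀ᶠ n in atTop, ∀ t,
      (P n).real (selectionEvent (d + 2) u β v T κ i s n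
        ∩ {ω | (σ * √n) * tinner (Z n ω) (pureTensor fun _ => v n i) ≤ t})
      = (P n).real (selectionEvent (d + 2) u β v T κ i s n)
        * (gaussianReal 0 1).real (Set.Iic t) := fun σ hσ => by
    filter_upwards [eventually_ge_atTop r] with n hr t
    exact H.real_selectionEvent_inter_gaussian hr s (H.spike_gaussian_scale hr hσ) t
  refine ⟨fun δ hδ => ?_, fun δ hδ => ?_⟩
  · refine eventually_abs_real_inter_le_sub_le (r := r) hB
      (hG (-((s : ℤ) : ℝ) ^ (d + 2)) (by rw [neg_mul_neg, hs])) ?_ hδ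
    refine (R.tendsto_strengthStat (opConst_pos d)).congr fun p => ?_
    change _ + _ * (_ * tinner (Z p.1.1 p.1.2) (pureTensor fun _ => v p.1.1 i))
      = strengthStat (d + 2) _ _ _ - _
    rw [neg_mul, neg_mul, sub_neg_eq_add, mul_assoc]
    rfl
  · refine eventually_abs_real_inter_le_sub_le (r := r) hB (hG (((s : ℤ) : ℝ) ^ (d + 2)) hs) ?_ hδ
    refine (R.tendsto_strength_mixture (opConst_pos d)).congr fun p => ?_
    change _ - _ * (_ * tinner (Z p.1.1 p.1.2) (pureTensor fun _ => v p.1.1 i)) = _ - _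
    rw [mul_assoc (_ ^ _)]
    rfl

/-- The second statistic carries `|β i|` because the mixture divides by a standard deviation; this
only changes the sign of a symmetric main term. -/
theorem linear_unifNormalOn (H : Model P Z u β v T κ ε) (ha : ∀ n ≥ r, ‖a n‖ = 1) (i : Fin r)
    (s : ℤˣ) (hN : Tendsto (fun n => √(1 - inner ℝ (a n) (v n i) ^ 2) * |β n 0|) atTop atTop) :
    UnifNormalOn P (selectionEvent (d + 2) u β v T κ i s)
      (fun n ω => linearStat (a n) (vecHat Z u β v T n ω) (((s : ℤ) : ℝ) • v n i)
        (strengthHat Z u β v T n ω)) ∧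
    UnifNormalOn P (selectionEvent (d + 2) u β v T κ i s)
      (fun n ω => √n * |β n i| / √(1 - inner ℝ (a n) (v n i) ^ 2) *
        (inner ℝ (a n) (vecHat Z u β v T n ω) - (1 - 1 / (2 * β n i ^ 2)) *
          (((s : ℤ) : ℝ) * inner ℝ (a n) (v n i)))) := by
  obtain ⟨t₁, h1, h2, h3, h4, h5⟩ :=
    OverlapOrbit.exists_phaseOne_time r H.d_pos H.one_le_kappa H.eps_pos
  set L : ℕ → ℝ := fun n => √(√(1 - inner ℝ (a n) (v n i) ^ 2) * |β n 0|) with hL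
  set B : ∀ n, Set (Ω n) := fun n => badNoise Z u β v ε t₁ n ∪ badContraction Z v a i L n with hBdef
  have hB1 : ∀ n, badNoise Z u β v ε t₁ n ⊆ B n := fun n => Set.subset_union_left
  have hA : ∀ᶠ n in atTop, 0 < √(1 - inner ℝ (a n) (v n i) ^ 2) := by
    filter_upwards [hN.eventually_gt_atTop 0] with n hn
    exact pos_of_mul_pos_left hn (abs_nonneg _)
  have hB : Tendsto (fun n => (P n).real (B n)) atTop (𝓝 0) := by
    have := (H.tendsto_real_badNoise (show 0 < t₁ by omega)).add
      (H.tendsto_real_badContraction ha hA (Real.tendsto_sqrt_atTop.comp hN))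
    rw [add_zero] at this
    exact squeeze_zero (fun n => measureReal_nonneg) (fun n => measureReal_union_le _ _) this
  have R := H.recovers (i := i) (s := s) hB1 h1 h2 h3 h4 h5
  have LB := H.linearBounds (i := i) (s := s) hB1 ha hN fun n => Set.subset_union_right
  have hss := units_cast_mul_self s
  have hG : ∀ σ : ℕ → ℝ, (∀ n ≥ r, σ n * σ n = 1) → ∀ᶠ n in atTop, ∀ t,
      (P n).real (selectionEvent (d + 2) u β v T κ i s n
        ∩ {ω | σ n * linNoise Z v a i n ω ≤ t})
      = (P n).real (selectionEvent (d + 2) u β v T κ i s n)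
        * (gaussianReal 0 1).real (Set.Iic t) := fun σ hσ => by
    filter_upwards [eventually_ge_atTop r, hA] with n hr hA t
    simp_rw [linNoise_eq]
    exact H.real_selectionEvent_inter_gaussian hr s
      (H.linear_gaussian_scale hr (ha n hr) hA (hσ n hr)) t
  refine ⟨fun δ hδ => ?_, fun δ hδ => ?_⟩
  · refine eventually_abs_real_inter_le_sub_le (r := r) hB (hG (fun _ => ((s : ℤ) : ℝ) ^ (d + 3))
      fun n _ => by rw [← mul_pow, hss, one_pow]) ?_ hδ
    exact R.tendsto_linearStat (opConst_pos d) LB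
  · have hb : ∀ n ≥ r, β n i ≠ 0 := fun n hn => H.beta_ne n hn i
    refine eventually_abs_real_inter_le_sub_le (r := r) hB (hG (fun n => |β n i| / β n i * ((s : ℤ) : ℝ))
      fun n hn => ?_) ?_ hδ
    · rw [mul_mul_mul_comm, hss, mul_one, ← sq, div_pow, sq_abs, div_self (pow_ne_zero 2 (hb n hn))]
    · refine squeeze_zero_norm (fun p => le_of_eq ?_)
        (tendsto_zero_iff_abs_tendsto_zero _ |>.1 (R.tendsto_linear (opConst_pos d) LB))
      have hb' := hb p.1.1 p.2.1
      have hc : |(|β p.1.1 i| / β p.1.1 i)| = 1 := by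
        rw [abs_div, abs_abs, div_self (abs_ne_zero.2 hb')]
      have e1 : |β p.1.1 i| = |β p.1.1 i| / β p.1.1 i * β p.1.1 i := (div_mul_cancel₀ _ hb').symm
      have e2 : √(p.1.1 : ℝ) * |β p.1.1 i| / √(1 - inner ℝ (a p.1.1) (v p.1.1 i) ^ 2) *
            (inner ℝ (a p.1.1) (vecHat Z u β v T p.1.1 p.1.2) - (1 - 1 / (2 * β p.1.1 i ^ 2)) *
              (((s : ℤ) : ℝ) * inner ℝ (a p.1.1) (v p.1.1 i)))
          - |β p.1.1 i| / β p.1.1 i * ((s : ℤ) : ℝ) * linNoise Z v a i p.1.1 p.1.2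
          = |β p.1.1 i| / β p.1.1 i *
            (√(p.1.1 : ℝ) * β p.1.1 i / √(1 - inner ℝ (a p.1.1) (v p.1.1 i) ^ 2) *
              (inner ℝ (a p.1.1) (vecHat Z u β v T p.1.1 p.1.2) - (1 - 1 / (2 * β p.1.1 i ^ 2)) *
                (((s : ℤ) : ℝ) * inner ℝ (a p.1.1) (v p.1.1 i)))
              - ((s : ℤ) : ℝ) * linNoise Z v a i p.1.1 p.1.2) := by
        nth_rewrite 1 [e1]
        ring
      rw [e2, norm_mul, Real.norm_eq_abs, hc, one_mul]
      rfl

/-- Two selected spikes would each be smaller than the other by the factor `1 - 1 / κ < 1`, which is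
impossible for positive quantities. -/
lemma disjoint_selectionEvent {n : ℕ} (hn : 0 < n) (hβ : ∀ j, β n j ≠ 0) (hκ : 1 ≤ κ) (k : ℕ) :
    Pairwise fun p q : Fin r × ℤˣ => Disjoint (selectionEvent k u β v T κ p.1 p.2 n)
      (selectionEvent k u β v T κ q.1 q.2 n) := by
  rintro ⟨i, s⟩ ⟨j, s'⟩ hne
  rw [Set.disjoint_left]
  rintro ω ⟨h1, h2⟩ ⟨h3, h4⟩
  have hκ0 : 0 < κ := by linarith
  by_cases hij : i = j
  · subst hij
    have : ((s : ℤ) : ℝ) = ((s' : ℤ) : ℝ) := h2.symm.trans h4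
    exact hne (by rw [Units.ext (by exact_mod_cast this : (s : ℤ) = s')])
  · have hx : (inner ℝ (u n ω) (v n i) : ℝ) ≠ 0 := h1.inner_ne_zero hn hκ0
    have b1 := h1.2 j (Ne.symm hij)
    have b2 := h3.2 i hij
    have hpos : 0 < |β n i * inner ℝ (u n ω) (v n i) ^ (k - 2)| :=
      abs_pos.2 (mul_ne_zero (hβ i) (pow_ne_zero _ hx))
    have hq0 : 0 ≤ 1 - 1 / κ := by rw [sub_nonneg, div_le_one hκ0]; exact hκ
    have hq1 : 0 < 1 / κ := by positivity
    nlinarith [abs_nonneg (β n j * inner ℝ (u n ω) (v n j) ^ (k - 2))]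

/-- Comparison of the law of an estimator, asymptotically normal on each selection event, with
the mixture of its asymptotic laws. -/
theorem mixture (H : Model P Z u β v T κ ε) {Y : ∀ n, Ω n → ℝ} {μ : Fin r → ℤˣ → ℕ → ℝ}
    {w : Fin r → ℤˣ → ℕ → ℝ≥0} (hw : ∀ i s, ∀ᶠ n in atTop, 0 < w i s n)
    (h : ∀ i s, UnifNormalOn P (selectionEvent (d + 2) u β v T κ i s)
      fun n ω => (√(w i s n : ℝ))⁻¹ * (Y n ω - μ i s n)) :
    ∀ᶠ n in atTop, ∀ t, |(P n).real {ω | Y n ω ≤ t}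
      - ∑ i, ∑ s : ℤˣ, signedWeight (d + 2) (β n) i s
        * (gaussianReal (μ i s n) (w i s n)).real (Set.Iic t)| ≤ (4 * r * (6 * r + 2) + 1) / √κ := by
  have hκ : 0 < √κ := Real.sqrt_pos.2 (by linarith [H.one_le_kappa])
  have hr : 0 < r := Nat.pos_of_ne_zero (NeZero.ne r)
  have hr' : (0 : ℝ) < r := by exact_mod_cast hr
  -- There are `2 r` components, so the Gaussian approximations cost `1 / √κ` in total.
  set δ : ℝ := 1 / (2 * r * √κ) with hδ
  filter_upwards [eventually_ge_atTop r, eventually_all.2 fun i => eventually_all.2 (hw i),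
    eventually_all.2 fun i => eventually_all.2 fun s => h i s δ (by positivity)] with n hn hw h t
  have hn0 : 0 < n := hr.trans_le hn
  have hβ := H.beta_ne n hn
  have hlaw := H.law n hn
  have key := abs_real_sub_mixture_le (P := P n)
    (E := fun q : Fin r × ℤˣ => selectionEvent (d + 2) u β v T κ q.1 q.2 n)
    (p := fun q => signedWeight (d + 2) (β n) q.1 q.2)
    (φ := fun q => (gaussianReal (μ q.1 q.2 n) (w q.1 q.2 n)).real (Set.Iic t))
    (δ := δ) (η := (6 * r + 2) / √κ) (A := {ω | Y n ω ≤ t}) ?_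
    (disjoint_selectionEvent hn0 hβ H.one_le_kappa _) ?_ ?_ (fun q => measureReal_nonneg)
    (fun q => measureReal_le_one) ?_
  · rw [Fintype.sum_prod_type] at key
    refine key.trans (le_of_eq ?_)
    rw [Fintype.card_prod, Fintype.card_fin, Fintype.card_units_int, hδ]
    push_cast
    field_simp
    ring
  · intro q
    exact hlaw.aemeasurable.snd.nullMeasurableSet_preimage (measurableSet_goodInit_sign (d + 2) κ (β n) (v n) q.1 (T n) ((q.2 : ℤ) : ℝ))
  · rw [Fintype.sum_prod_type]
    simp_rw [sum_signedWeight (hβ _)]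
    exact one_le_sum_weight H.d_pos hβ
  · intro q
    have := abs_sphereUniform_real_goodInit_sign_sub_le hn0 H.d_pos hβ (H.ortho n hn) q.1
      H.one_le_kappa (T n) q.2
    rwa [← real_init hlaw hn0 (measurableSet_goodInit_sign (d + 2) κ (β n) (v n) q.1 (T n) _)] at this
  · intro q
    have h1 := h q.1 q.2 ((√(w q.1 q.2 n : ℝ))⁻¹ * (t - μ q.1 q.2 n))
    have h2 : (0 : ℝ) < (√(w q.1 q.2 n : ℝ))⁻¹ :=
      inv_pos.2 (Real.sqrt_pos.2 (by exact_mod_cast hw q.1 q.2))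
    rw [gaussianReal_real_Iic_eq _ (hw q.1 q.2)]
    convert h1 using 5
    ext ω
    simp only [Set.mem_ofPred_eq]
    rw [mul_le_mul_iff_right₀ h2, sub_le_sub_iff_right]

end Model

end Model

end SpikedTensor

namespace SpikedTensor

/-! ### Conversion of the time bound and of the variances; conclusion. -/

section Model

lemma le_pow_of_log_div_log_le {x b : ℝ} (hb : 1 < b) {T : ℕ}
    (h : 1 + Real.log x / Real.log b ≤ T) : x ≤ b ^ (T - 1) := by
  rcases le_or_gt x 0 with hx | hx
  · exact hx.trans (by positivity)
  have hlog : 0 < Real.log b := Real.log_pos hb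
  have h1 : Real.log x ≤ ((T : ℝ) - 1) * Real.log b := by
    rw [← div_le_iff₀ hlog]
    linarith
  rw [← Real.log_le_log_iff hx (by positivity), Real.log_pow]
  refine h1.trans ?_
  gcongr
  -- Truncated subtraction only enlarges the exponent, at `T = 0`.
  rcases T with _ | T <;> simp

lemma inv_sqrt_coe_natCast_inv (n : ℕ) : (√(((n : ℝ≥0)⁻¹ : ℝ≥0) : ℝ))⁻¹ = √n := by
  rw [NNReal.coe_inv, NNReal.coe_natCast, Real.sqrt_inv, inv_inv]

lemma inv_sqrt_toNNReal_div {n : ℕ} {b y : ℝ} (hy : 0 ≤ y) :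
    (√((Real.toNNReal (y / (n * b ^ 2)) : ℝ≥0) : ℝ))⁻¹ = √n * |b| / √y := by
  rw [Real.coe_toNNReal _ (by positivity), Real.sqrt_div hy, inv_div,
    Real.sqrt_mul (Nat.cast_nonneg n), Real.sqrt_sq_eq_abs]

lemma tendsto_sqrt_mul_abs_atTop {y b : ℕ → ℝ}
    (h : Tendsto (fun n => |b n| ^ 2 * y n) atTop atTop) :
    Tendsto (fun n => √(y n) * |b n|) atTop atTop := by
  refine (Real.tendsto_sqrt_atTop.comp h).congr fun n => ?_
  rw [Function.comp_apply, Real.sqrt_mul (sq_nonneg _), Real.sqrt_sq_eq_abs, abs_abs, mul_comm]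

end Model

end SpikedTensor

open SpikedTensor

theorem corollary2p8 (r : ℕ) [NeZero r] :
    ∃ C : ℝ, 0 < C ∧
    ∀ (k : ℕ) (_ : 3 ≤ k) (ε : ℝ) (_ : 0 < ε) (κ : ℝ) (_ : 1 ≤ κ)
      -- for each `n`, a probability space with a noise tensor `Z` and an initialization `u`
      (Ω : ℕ → Type*) [∀ n, MeasurableSpace (Ω n)]
      (P : ∀ n, Measure (Ω n)) [∀ n, IsProbabilityMeasure (P n)]
      (Z : ∀ n, Ω n → SpikedTensor.Tensor k n)
      (u : ∀ n, Ω n → EuclideanSpace ℝ (Fin n))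
      -- signal strengths, signal vectors, test vector, number of iterations
      (β : ℕ → Fin r → ℝ) (v : ∀ n, Fin r → EuclideanSpace ℝ (Fin n))
      (a : ∀ n, EuclideanSpace ℝ (Fin n)) (T : ℕ → ℕ)
      -- `Z` has i.i.d. `N(0, 1/n)` entries, `u` is uniform on the sphere, independent of `Z`
      (_ : ∀ n ≥ r, HasLaw (fun ω => (Z n ω, u n ω))
        ((SpikedTensor.noiseLaw k n).prod (SpikedTensor.sphereUniform n)) (P n))
      (_ : ∀ n ≥ r, ∀ j, β n j ≠ 0)
      (_ : ∀ n ≥ r, ∀ j, |β n j| ≤ |β n 0|)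
      (_ : ∀ n ≥ r, Orthonormal ℝ (v n))
      (_ : ∀ n ≥ r, ‖a n‖ = 1)
      (_ : ∀ᶠ n : ℕ in atTop, (n : ℝ) ^ (((k : ℝ) - 2) / 2 + ε) ≤ |β n 0|)
      (_ : ∀ᶠ n : ℕ in atTop,
        1 + 1 / ε * (1 / 2 + 2 * Real.log |β n 0| / Real.log n)
          + Real.log (Real.log (√n * |β n 0|)) / Real.log ((k : ℝ) - 1) ≤ (T n : ℝ))
      (_ : ∀ᶠ n : ℕ in atTop,
        1 + Real.log (κ * Real.log (√n * |β n 0|)) / Real.log ((k : ℝ) - 1) ≤ (T n : ℝ)),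
    -- the observation, the estimators, and the events
    let X : ∀ n, Ω n → SpikedTensor.Tensor k n :=
      fun n ω => SpikedTensor.signal k (β n) (v n) + Z n ω
    let vhat : ∀ n, Ω n → EuclideanSpace ℝ (Fin n) :=
      fun n ω => SpikedTensor.powerIter (X n ω) (u n ω) (T n)
    let bhat : ∀ n, Ω n → ℝ := fun n ω => SpikedTensor.betaHat (X n ω) (vhat n ω)
    let E : Fin r → ∀ n, Set (Ω n) :=
      fun i n => {ω | SpikedTensor.GoodInit k κ (β n) (v n) i (u n ω)}
    let Es : Fin r → ℤˣ → ∀ n, Set (Ω n) := fun i s n =>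
      {ω | ω ∈ E i n ∧
        SpikedTensor.limitSign k (β n i) (T n) (inner ℝ (u n ω) (v n i)) = ((s : ℤ) : ℝ)}
    let NonAligned : Fin r → Prop := fun i =>
      Tendsto (fun n => |β n 0| ^ 2 * (1 - inner ℝ (a n) (v n i) ^ 2)) atTop atTop
    -- the weights, and the probabilities of the events
    (∀ i, ∀ n ≥ r,
      (P n).real {ω | SpikedTensor.IsArgmax k (β n) (v n) i (u n ω)}
        = SpikedTensor.weight k (β n) i ∧
      |(P n).real (E i n) - SpikedTensor.weight k (β n) i| ≤ C / √κ ∧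
      ∀ s : ℤˣ,
        |(P n).real (Es i s n) - SpikedTensor.signedWeight k (β n) i s| ≤ C / √κ) ∧
    -- the two central limit theorems, on each event, around the limit `(s ^ k β_i, s v_i)`
    (∀ (i : Fin r) (s : ℤˣ),
      (NonAligned i → SpikedTensor.AsympNormalOn P (Es i s) fun n ω =>
        SpikedTensor.linearStat (a n) (vhat n ω) (((s : ℤ) : ℝ) • v n i) (bhat n ω)) ∧
      SpikedTensor.AsympNormalOn P (Es i s) fun n ω =>
        SpikedTensor.strengthStat k n (((s : ℤ) : ℝ) ^ k * β n i) (bhat n ω)) ∧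
    -- the estimators are asymptotically Gaussian mixtures
    ((∀ i, NonAligned i) → ∀ᶠ n : ℕ in atTop, ∀ t : ℝ,
      |(P n).real {ω | inner ℝ (a n) (vhat n ω) ≤ t} -
        ∑ i, ∑ s : ℤˣ, SpikedTensor.signedWeight k (β n) i s *
          (gaussianReal
            ((1 - 1 / (2 * β n i ^ 2)) * (((s : ℤ) : ℝ) * inner ℝ (a n) (v n i)))
            (Real.toNNReal ((1 - inner ℝ (a n) (v n i) ^ 2) / (n * β n i ^ 2)))).real
              (Set.Iic t)| ≤ C / √κ) ∧
    (∀ᶠ n : ℕ in atTop, ∀ t : ℝ,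
      |(P n).real {ω | bhat n ω ≤ t} -
        ∑ i, ∑ s : ℤˣ, SpikedTensor.signedWeight k (β n) i s *
          (gaussianReal
            (((s : ℤ) : ℝ) ^ k * β n i - ((k : ℝ) / 2 - 1) / (((s : ℤ) : ℝ) ^ k * β n i))
            ((n : ℝ≥0)⁻¹)).real (Set.Iic t)| ≤ C / √κ) := by
  have hr : 0 < r := Nat.pos_of_ne_zero (NeZero.ne r)
  have hr1 : (1 : ℝ) ≤ r := by exact_mod_cast hr
  -- Each of the `2 r` components pays the initialization error `6 r + 2` twice, for its weight and
  -- for the uncovered mass; the final `1` is the Gaussian approximation.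
  refine ⟨4 * r * (6 * r + 2) + 1, by positivity, ?_⟩
  intro k hk ε hε κ hκ Ω _ P _ Z u β v a T hlaw hβ hle hv ha hge _ htime
  obtain ⟨d, rfl⟩ : ∃ d, k = d + 2 := ⟨k - 2, by omega⟩
  have hd : 0 < d := by omega
  -- Lowering `ε` weakens the growth condition, and the exponents of the first phase require `ε ≤ 1
  -- / 2`.
  have H : Model P Z u β v T κ (min ε (1 / 2)) :=
    { law := hlaw
      beta_ne := hβ
      beta_le := hle
      ortho := hv
      d_pos := hd
      one_le_kappa := hκ
      eps_pos := lt_min hε (by norm_num)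
      eps_le := min_le_right _ _
      beta_ge := by
        filter_upwards [hge, eventually_ge_atTop 1] with n h1 h2
        refine le_trans (Real.rpow_le_rpow_of_exponent_le (by exact_mod_cast h2) ?_) h1
        push_cast
        linarith [min_le_left ε (1 / 2)]
      time := by
        filter_upwards [htime] with n hn
        refine le_pow_of_log_div_log_le (by exact_mod_cast Nat.lt_add_of_pos_left hd) ?_
        rwa [show ((d + 2 : ℕ) : ℝ) - 1 = d + 1 by push_cast; ring] at hn }
  have hC : (6 * r + 2) / √κ ≤ (4 * r * (6 * r + 2) + 1) / √κ :=
    div_le_div_of_nonneg_right (by nlinarith) (Real.sqrt_nonneg κ)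
  intro X vhat bhat E Es NonAligned
  refine ⟨fun i n hn => ⟨?_, ?_, fun s => ?_⟩, fun i s => ⟨fun hna => ?_, ?_⟩, fun hna => ?_, ?_⟩
  · rw [← sphereUniform_real_isArgmax (hr.trans_le hn) hd (hβ n hn) (hv n hn) i]
    exact real_init (hlaw n hn) (hr.trans_le hn) (measurableSet_isArgmax _ _ _ _)
  · refine le_trans ?_ hC
    have := abs_sphereUniform_real_goodInit_sub_le (hr.trans_le hn) hd (hβ n hn) (hv n hn) i hκ
    rwa [← real_init (hlaw n hn) (hr.trans_le hn) (measurableSet_goodInit _ _ _ _ _)] at this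
  · refine le_trans ?_ hC
    have := abs_sphereUniform_real_goodInit_sign_sub_le (hr.trans_le hn) hd (hβ n hn) (hv n hn) i
      hκ (T n) s
    rwa [← real_init (hlaw n hn) (hr.trans_le hn)
      (measurableSet_goodInit_sign _ _ _ _ _ _ _)] at this
  · exact asympNormalOn_of_eventually
      (H.linear_unifNormalOn ha i s (tendsto_sqrt_mul_abs_atTop hna)).1
  · exact asympNormalOn_of_eventually (H.strength_unifNormalOn i s).1
  · have hpos : ∀ i, ∀ᶠ n in atTop, 0 < 1 - inner ℝ (a n) (v n i) ^ 2 := fun i => by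
      filter_upwards [(hna i).eventually_gt_atTop 0] with n hn
      exact pos_of_mul_pos_right hn (sq_nonneg _)
    refine H.mixture (Y := fun n ω => inner ℝ (a n) (vhat n ω))
      (μ := fun i s n => (1 - 1 / (2 * β n i ^ 2)) * (((s : ℤ) : ℝ) * inner ℝ (a n) (v n i)))
      (w := fun i s n => Real.toNNReal ((1 - inner ℝ (a n) (v n i) ^ 2) / (n * β n i ^ 2)))
      (fun i s => ?_) (fun i s δ hδ => ?_)
    · filter_upwards [hpos i, eventually_ge_atTop r] with n h1 h2
      have h3 := hβ n h2 i
      have h4 : (0 : ℝ) < n := by exact_mod_cast hr.trans_le h2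
      exact Real.toNNReal_pos.2 (by positivity)
    · filter_upwards [(H.linear_unifNormalOn ha i s (tendsto_sqrt_mul_abs_atTop (hna i))).2 δ hδ,
        hpos i] with n h1 h2
      simp only [inv_sqrt_toNNReal_div h2.le]
      exact h1
  · refine H.mixture (Y := bhat)
      (μ := fun i s n => ((s : ℤ) : ℝ) ^ (d + 2) * β n i
        - (((d + 2 : ℕ) : ℝ) / 2 - 1) / (((s : ℤ) : ℝ) ^ (d + 2) * β n i))
      (w := fun i s n => (n : ℝ≥0)⁻¹) (fun i s => ?_) (fun i s => ?_)
    · filter_upwards [eventually_gt_atTop 0] with n hn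
      exact inv_pos.2 (by exact_mod_cast hn)
    · simp only [inv_sqrt_coe_natCast_inv]
      exact (H.strength_unifNormalOn i s).2
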